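/- **Setting.** Let $\mathsf a_1=(1,0)$, $\mathsf a_2=(\tfrac12,\tfrac{\sqrt3}2)$, $\mathbb L^\#=\mathbb Z\mathsf a_1+\mathbb Z\mathsf a_2$, $\mathbb L_*=\mathbb L^\#\setminus\{0\}$; fix $N\ge 1$, let $\Omega=\{s\mathsf a_1+t\mathsf a_2: 0<s,t\le N\}$, and write $A^\#=A+N\mathbb L^\#$ for $A\subset\mathbb R^2$ (and likewise for families of sets). Let $\Omega_{\rm a}\subset{\rm int}(\Omega)$ (the atomistic region) be a union of closed nearest-neighbour triangles of $\mathbb L^\#$, let $\mathbb V\subset\mathbb L^\#\cap{\rm int}(\Omega_{\rm a})$ be the set of vacancies, $\mathcal L=(\mathbb L^\#\cap\Omega)\setminus\mathbb V$ the set of atoms, and $\Omega_{\rm c}={\rm clos}(\Omega\setminus\Omega_{\rm a})\cap\Omega$. Let $\mathcal T_h$ be a triangulation of ${\rm clos}(\Omega)$ with vertices in $\mathbb L^\#$ which consists of the nearest-neighbour triangles in $\Omega_{\rm a}$ and of a triangulation $\mathcal T_h^{\rm c}$ of the continuum region, and such that $\mathcal T_h^\#$ is a regular triangulation of $\mathbb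 R^2$ (no hanging nodes). Its shape regularity constant is the ratio of the largest to the smallest angle in $\mathcal T_h$. For $x\in\Omega_{\rm c}^\#$ let $h(x)=\max\{{\rm diam}\,T: T\in(\mathcal T_h^{\rm c})^\#,\ x\in T\}$. Let $\mathcal F_h^{\rm c}$ be the set of edges $f$ of $\mathcal T_h^\#$ whose relative interior lies in $\Omega$ and with $f\not\subset\Omega_{\rm a}$; $[\nabla v]$ denotes the jump of $\nabla v$ across such edges, and matrix and tensor norms are Euclidean (Frobenius) norms. Deformations: for $\mathsf B\in\mathbb R^{2\times2}$ with $\det\mathsf B>0$, $\mathscr Y_{\mathsf B}$ is the set of $y:\mathcal L^\#\to\mathbb R^2$ such that $y(x)-\mathsf Bx$ is $N\mathbb L^\#$-periodic and $\mu_{\rm a}(y)=\inf_{x\ne x'\in\mathcal L^\#}\frac{|y(x')-y(x)|}{|x'-x|}>0$; $\mathscr Y=\bigcup_{\mathsf B}\mathscr Y_{\mathsf B}$. A lattice function that is piecewise affine with respect to $(\mathcal T_h^{\rm c})^\#$ is also regarded as a continuous piecewise affine function on $\Omega_{\rm c}^\#$, and for such functions $$\mu_{\rm c}(v)=\inf_{x\in\Omega_{\rm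 c},\,x'\in\Omega_{\rm c}^\#,\,x\neq x'}\frac{|v(x')-v(x)|}{|x'-x|}.$$ $\mathscr Y_h$ is the set of $y_h\in\mathscr Y$ that are piecewise affine with respect to $(\mathcal T_h^{\rm c})^\#$ and satisfy $\mu_{\rm c}(y_h)>0$. For $y\in\mathscr Y$, $I_hy$ is the function that is piecewise affine with respect to $(\mathcal T_h^{\rm c})^\#$, equal to $y$ at the vertices of this mesh and equal to $y$ at the atoms in ${\rm int}(\Omega_{\rm a}^\#)$. For $y\in\mathscr Y_{\mathsf B}$, $\Pi_2(y)$ is the set of $\tilde y\in W^{2,\infty}_{\rm loc}(\mathbb R^2)^2$ (continuous representatives) with $\tilde y=y$ on $\mathcal L^\#$ and $\tilde y(x+N\mathsf a_j)=\mathsf BN\mathsf a_j+\tilde y(x)$ for all $x\in\mathbb R^2$, $j=1,2$. Energies: let $\varphi\in C^2(0,\infty)$, $\phi(r)=\varphi(|r|)$, $M_k(s)=\sup_{|r|\ge s}\|\phi^{(k)}(r)\|\in[0,\infty]$, and assume that $\sum_{r\in\mathbb L_*}M_0(s|r|)<\infty$ for all $s>0$ (so that the energies are absolutely convergent sums). Let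 $\mathcal B=\{(x,x')\in\mathcal L\times\mathcal L^\#: x\neq x'\}$, let $\mathcal B_{\rm c}$ be the set of those $b=(x,x')\in\mathcal B$ whose segment lies in ${\rm int}(\Omega_{\rm c}^\#)$, and $\mathcal B_{\rm a}=\mathcal B\setminus\mathcal B_{\rm c}$. With $D_bv=v(x')-v(x)$, $r_b=x'-x$ and $\nabla_{\!r}v(z)=\lim_{t\searrow0}\frac{v(z+tr)-v(z)}t$, put $$\mathscr E_{\rm a}(y)=\sum_{b\in\mathcal B}\phi(D_by),\qquad \mathscr E_{\rm ac}(y)=\sum_{b\in\mathcal B_{\rm a}}\phi(D_by)+\sum_{b=(x,x')\in\mathcal B_{\rm c}}\int_0^1\phi\big(\nabla_{\!r_b}y(x+tr_b)\big)\,dt .$$ **Lemma.** There are constants $c_1',c_2'$ which depend only on (an upper bound for) the shape regularity constant of $\mathcal T_h$, such that the following holds. (i) For all $y_h\in\mathscr Y_h$, $$\big|\mathscr E_{\rm a}(y_h)-\mathscr E_{\rm ac}(y_h)\big|\le C_1^E\,\big\|[\nabla y_h]\big\|_{L^2(\mathcal F_h^{\rm c})}^2,\qquad C_1^E=c_1'\sum_{r\in\mathbb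 L_*}M_2\big(\mu_{\rm c}(y_h)|r|\big)|r|^4 .$$ (ii) For all $y\in\mathscr Y$ with $\mu_{\rm c}(I_hy)>0$, $$\big|\mathscr E_{\rm a}(I_hy)-\mathscr E_{\rm ac}(I_hy)\big|\le C_2^E\inf_{\tilde y\in\Pi_2(y)}\big\|h^{1/2}\nabla^2\tilde y\big\|_{L^2(\Omega_{\rm c})}^2,\qquad C_2^E=c_2'\sum_{r\in\mathbb L_*}M_2\big(\mu_{\rm c}(I_hy)|r|\big)|r|^4 .$$ The inequalities are read in $[0,\infty]$, with $0\cdot\infty=0$. In (ii), $I_hy$ need not be injective on $\mathcal L^\#$; the finitely many bonds $b \in \mathcal B$ with $D_b I_hy=0$ belong to $\mathcal B_{\rm a}$ and contribute the same (arbitrary) real value $\phi(0)$ to both energies. -/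

import Mathlib

open MeasureTheory Set
open scoped ENNReal NNReal ContDiff

noncomputable section

namespace ACCoupling

/-! ### The triangular lattice and the periodic cell -/

abbrev Plane := EuclideanSpace ℝ (Fin 2)

def a1 : Plane := !₂[1, 0]

def a2 : Plane := !₂[1 / 2, Real.sqrt 3 / 2]

/-- The triangular lattice, without vacancies. -/
def lattice : Set Plane := {x | ∃ m n : ℤ, x = (m : ℝ) • a1 + (n : ℝ) • a2}

/-- The half-open periodic cell `Ω = A₆ (0, N]²`. -/
def cell (N : ℕ) : Set Plane :=
  {x | ∃ s ∈ Ioc (0 : ℝ) N, ∃ t ∈ Ioc (0 : ℝ) N, x = s • a1 + t • a2}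

/-- The periodic continuation `A + N L` of a set `A`, where `L` is the lattice. -/
def periodic (N : ℕ) (A : Set Plane) : Set Plane :=
  {x | ∃ a ∈ A, ∃ z ∈ lattice, x = a + (N : ℝ) • z}

/-! ### Triangulations

A triangle, or an edge, is represented by the finite set of its vertices; the closed triangle
(edge) is the convex hull of this set. -/

/-- The union of the closed triangles in a family. -/
def hullUnion (S : Set (Finset Plane)) : Set Plane := ⋃ T ∈ S, convexHull ℝ (T : Set Plane)

def translate (v : Plane) (T : Finset Plane) : Finset Plane := T.map (addRightEmbedding v)

/-- The family of all `N`-periodic translates of the members of a family. -/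
def periodicFamily (N : ℕ) (S : Set (Finset Plane)) : Set (Finset Plane) :=
  {T' | ∃ T ∈ S, ∃ z ∈ lattice, T' = translate ((N : ℝ) • z) T}

/-- The geometric data of the coupling method in one periodic cell: the vacancies, the atomistic
region (given through the micro-elements it consists of), and the finite element mesh, which
coincides with the canonical micro-triangulation in the atomistic region and which extends
periodically to a regular triangulation (no hanging nodes) of the plane. -/
structure Mesh (N : ℕ) where
  /-- the vacancy sites in the cell -/
  vac : Set Plane
  /-- the elements of the mesh of the whole cell, each given by its vertices -/
  elems : Set (Finset Plane)
  /-- those elements that make up the atomistic region -/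
  atomElems : Set (Finset Plane)
  atomElems_subset : atomElems ⊆ elems
  card_eq : ∀ T ∈ elems, T.card = 3
  nondegenerate : ∀ T ∈ elems, AffineIndependent ℝ ((↑) : T → Plane)
  vertices_mem : ∀ T ∈ elems, (T : Set Plane) ⊆ lattice
  subset_cell : ∀ T ∈ elems, convexHull ℝ (T : Set Plane) ⊆ closure (cell N)
  covers : closure (cell N) ⊆ hullUnion elems
  /-- any two elements of the periodic mesh meet in a common face (or not at all) -/
  regular : ∀ T ∈ periodicFamily N elems, ∀ T' ∈ periodicFamily N elems,
    convexHull ℝ (T : Set Plane) ∩ convexHull ℝ (T' : Set Plane) =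
      convexHull ℝ ((T : Set Plane) ∩ (T' : Set Plane))
  /-- the elements in the atomistic region are nearest-neighbour triangles of the lattice -/
  micro : ∀ T ∈ atomElems, ∀ p ∈ T, ∀ q ∈ T, p ≠ q → dist p q = 1
  /-- the atomistic region lies in the interior of the cell -/
  atomistic_subset : hullUnion atomElems ⊆ interior (cell N)
  vac_subset_lattice : vac ⊆ lattice
  /-- the vacancies lie in the interior of the atomistic region -/
  vac_subset_interior : vac ⊆ interior (hullUnion atomElems)

/-! ### The interaction potential -/

/-- The potential as a function of the bond vector, `φ(r) = ϕ(|r|)`. -/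
def radial (ϕ : ℝ → ℝ) (r : Plane) : ℝ := ϕ ‖r‖

/-- `M_k(s)`, the supremum of the norm of the `k`-th derivative of `φ` over `|r| ≥ s`. -/
def decayM (ϕ : ℝ → ℝ) (k : ℕ) (s : ℝ) : ℝ≥0∞ :=
  ⨆ r : Plane, ⨆ _ : s ≤ ‖r‖, ‖iteratedFDeriv ℝ k (radial ϕ) r‖ₑ

/-- The nonzero lattice vectors. -/
def latticeDirs : Set Plane := lattice \ {0}

/-- `φ ∈ C²(0, ∞)`, with enough decay for the interaction energies to be absolutely
convergent sums. -/
structure IsPotential (ϕ : ℝ → ℝ) : Prop where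
  smooth : ContDiffOn ℝ 2 ϕ (Ioi 0)
  decay : ∀ s : ℝ, 0 < s → ∑' r : latticeDirs, decayM ϕ 0 (s * ‖(r : Plane)‖) ≠ ⊤

/-- The sum `∑ M₂(μ |r|) |r|⁴` over all nonzero lattice vectors `r`. -/
def decaySum (ϕ : ℝ → ℝ) (μ : ℝ) : ℝ≥0∞ :=
  ∑' r : latticeDirs, decayM ϕ 2 (μ * ‖(r : Plane)‖) * ‖(r : Plane)‖ₑ ^ 4

/-! ### Derivatives -/

/-- The one-sided directional derivative `lim_{t ↘ 0} (v (x + t r) - v x) / t`. -/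
def dirDeriv (r : Plane) (v : Plane → Plane) (x : Plane) : Plane :=
  derivWithin (fun t : ℝ => v (x + t • r)) (Ici 0) 0

/-- The squared Frobenius norm of a linear map of the plane. -/
def frobSq (G : Plane →L[ℝ] Plane) : ℝ≥0∞ :=
  ∑ i : Fin 2, ‖G (EuclideanSpace.single i 1)‖ₑ ^ 2

/-- The gradient on a triangle `T` of a map that is affine on `T`: its derivative at the
barycentre. -/
def gradOn (T : Finset Plane) (v : Plane → Plane) : Plane →L[ℝ] Plane :=
  fderiv ℝ v ((3 : ℝ)⁻¹ • ∑ q ∈ T, q)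

/-- `g` is locally (essentially) bounded and measurable. -/
def LocBounded (g : Plane → Plane) : Prop :=
  ∀ R : ℝ, MemLp g ∞ (volume.restrict (Metric.closedBall 0 R))

/-- `g` is the weak `i`-th partial derivative of `u`. -/
def IsWeakPartial (i : Fin 2) (u g : Plane → Plane) : Prop :=
  ∀ ψ : Plane → ℝ, ContDiff ℝ ∞ ψ → HasCompactSupport ψ →
    ∫ x, (fderiv ℝ ψ x (EuclideanSpace.single i 1)) • u x = - ∫ x, ψ x • g x

/-- `w` is (the continuous representative of) a function in `W^{2,∞}_loc(ℝ²)²`, with the weak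
second partial derivatives `H i j`. -/
def HasWeakHessian (w : Plane → Plane) (H : Fin 2 → Fin 2 → Plane → Plane) : Prop :=
  Continuous w ∧ (∀ i j, LocBounded (H i j)) ∧
    ∃ G : Fin 2 → Plane → Plane, (∀ i, LocBounded (G i)) ∧
      (∀ i, IsWeakPartial i w (G i)) ∧ ∀ i j, IsWeakPartial j (G i) (H i j)

namespace Mesh

variable {N : ℕ} (M : Mesh N)

/-! ### Regions, atoms, bonds -/

/-- The atomistic region. -/
def atomRegion : Set Plane := hullUnion M.atomElems

/-- The continuum region in the cell. -/
def contRegion : Set Plane := closure (cell N \ M.atomRegion) ∩ cell N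

/-- The periodic continuation of the continuum region. -/
def contRegionPer : Set Plane := periodic N M.contRegion

/-- All elements of the periodic mesh. -/
def elemsPer : Set (Finset Plane) := periodicFamily N M.elems

/-- The elements of the periodic mesh of the continuum region. -/
def contElemsPer : Set (Finset Plane) := periodicFamily N (M.elems \ M.atomElems)

/-- The atoms in one cell. -/
def atoms : Set Plane := (lattice ∩ cell N) \ M.vac

/-- All atoms: the lattice with a periodic array of vacancies. -/
def atomsPer : Set Plane := periodic N M.atoms

/-- The bonds between atoms in the cell and all other atoms. -/
def bonds : Set (Plane × Plane) := {b | b.1 ∈ M.atoms ∧ b.2 ∈ M.atomsPer ∧ b.1 ≠ b.2}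

/-- The continuum bonds. -/
def contBonds : Set (Plane × Plane) :=
  {b | b ∈ M.bonds ∧ segment ℝ b.1 b.2 ⊆ interior M.contRegionPer}

/-- The atomistic bonds. -/
def atomBonds : Set (Plane × Plane) := M.bonds \ M.contBonds

/-- One periodic copy of all edges of the mesh that are not contained in the atomistic region. -/
def contEdges : Set (Finset Plane) :=
  {f | f.card = 2 ∧ (∃ T ∈ M.elemsPer, f ⊆ T) ∧
    (∀ p ∈ f, ∀ q ∈ f, p ≠ q → openSegment ℝ p q ⊆ cell N) ∧
    ¬ convexHull ℝ (f : Set Plane) ⊆ M.atomRegion}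

/-- The mesh size function: the maximal diameter of an element of the continuum mesh
containing `x`. -/
def meshSize (x : Plane) : ℝ≥0∞ :=
  ⨆ T ∈ M.contElemsPer, ⨆ _ : x ∈ convexHull ℝ (T : Set Plane),
    Metric.ediam (convexHull ℝ (T : Set Plane))

/-- The shape regularity constant, that is, the ratio between the largest and the smallest angle
in the mesh, is at most `σ`. -/
def ShapeRegular (σ : ℝ) : Prop :=
  ∀ T ∈ M.elems, ∀ T' ∈ M.elems,
    ∀ p ∈ T, ∀ q ∈ T, ∀ r ∈ T, ∀ p' ∈ T', ∀ q' ∈ T', ∀ r' ∈ T',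
      p ≠ q → q ≠ r → p ≠ r → p' ≠ q' → q' ≠ r' → p' ≠ r' →
        EuclideanGeometry.angle p q r ≤ σ * EuclideanGeometry.angle p' q' r'

/-! ### Deformations

A deformation is represented by a map of the plane, of which only the values at the atoms (and,
for coarse-grained deformations, in the periodic continuum region) are used. -/

/-- The atomistic injectivity constant `μ_a`. -/
def muA (y : Plane → Plane) : ℝ :=
  sInf {t | ∃ x ∈ M.atomsPer, ∃ x' ∈ M.atomsPer, x ≠ x' ∧ t = ‖y x' - y x‖ / ‖x' - x‖}

/-- The injectivity constant `μ_c` on the periodic continuum region; by periodicity, one of the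
two points may be restricted to the cell. -/
def muC (y : Plane → Plane) : ℝ :=
  sInf {t | ∃ x ∈ M.contRegion, ∃ x' ∈ M.contRegionPer, x ≠ x' ∧ t = ‖y x' - y x‖ / ‖x' - x‖}

/-- Periodic deformations of the defective lattice, with macroscopic strain `B`. -/
structure IsDeformation (B : Plane →L[ℝ] Plane) (y : Plane → Plane) : Prop where
  det_pos : 0 < B.det
  periodic₁ : ∀ x ∈ M.atomsPer, y (x + (N : ℝ) • a1) = y x + B ((N : ℝ) • a1)
  periodic₂ : ∀ x ∈ M.atomsPer, y (x + (N : ℝ) • a2) = y x + B ((N : ℝ) • a2)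
  muA_pos : 0 < M.muA y

/-- Coarse-grained deformations: deformations that are piecewise affine on the continuum region
and have a positive injectivity constant there. -/
structure IsCoarseDeformation (y : Plane → Plane) : Prop where
  deformation : ∃ B : Plane →L[ℝ] Plane, M.IsDeformation B y
  affine : ∀ T ∈ M.contElemsPer, ∃ A : Plane →ᵃ[ℝ] Plane,
    ∀ x ∈ convexHull ℝ (T : Set Plane), y x = A x
  muC_pos : 0 < M.muC y

/-- `v` is the value at `x` of the piecewise affine nodal interpolant of `y` on the continuum mesh,
in barycentric coordinates. -/
def IsNodalValue (y : Plane → Plane) (x v : Plane) : Prop :=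
  ∃ T ∈ M.contElemsPer, ∃ c : Plane → ℝ,
    (∀ q ∈ T, 0 ≤ c q) ∧ ∑ q ∈ T, c q = 1 ∧ ∑ q ∈ T, c q • q = x ∧ v = ∑ q ∈ T, c q • y q

open Classical in
/-- The nodal interpolant `I_h y`: piecewise affine on the periodic continuum mesh with the nodal
values of `y`, and equal to `y` elsewhere. -/
def interp (y : Plane → Plane) (x : Plane) : Plane :=
  if h : ∃ v, M.IsNodalValue y x v then h.choose else y x

/-- The class `Π₂(y)` of `W^{2,∞}_loc`-conforming interpolants of a deformation `y` with
macroscopic strain `B`. -/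
def smoothInterps (B : Plane →L[ℝ] Plane) (y : Plane → Plane) : Set (Plane → Plane) :=
  {w | (∃ H, HasWeakHessian w H) ∧ (∀ x ∈ M.atomsPer, w x = y x) ∧
    (∀ x, w (x + (N : ℝ) • a1) = B ((N : ℝ) • a1) + w x) ∧
    (∀ x, w (x + (N : ℝ) • a2) = B ((N : ℝ) • a2) + w x)}

/-! ### Energies and norms -/

/-- The atomistic energy. -/
def atomEnergy (ϕ : ℝ → ℝ) (y : Plane → Plane) : ℝ :=
  ∑' b : M.bonds, radial ϕ (y b.1.2 - y b.1.1)

/-- The energy of the atomistic-to-continuum coupling method. -/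
def acEnergy (ϕ : ℝ → ℝ) (y : Plane → Plane) : ℝ :=
  ∑' b : M.atomBonds, radial ϕ (y b.1.2 - y b.1.1) +
    ∑' b : M.contBonds, ∫ t in (0 : ℝ)..1,
      radial ϕ (dirDeriv (b.1.2 - b.1.1) y (b.1.1 + t • (b.1.2 - b.1.1)))

/-- The square of the norm of the (constant) jump of `∇y` across the edge `f`. Exactly two elements
contain `f`, so the supremum is attained at these two. -/
def jumpSq (y : Plane → Plane) (f : Finset Plane) : ℝ≥0∞ :=
  ⨆ T ∈ M.elemsPer, ⨆ T' ∈ M.elemsPer, ⨆ _ : f ⊆ T ∧ f ⊆ T', frobSq (gradOn T y - gradOn T' y)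

/-- The square of the `L²`-norm of the jump of `∇y` over the union of the continuum edges. -/
def jumpNormSq (y : Plane → Plane) : ℝ≥0∞ :=
  ∑' f : M.contEdges, Metric.ediam ((f : Finset Plane) : Set Plane) * M.jumpSq y f

/-- The square of the `L²`-norm of `h^{1/2} ∇²w` over the continuum region. The weak derivatives are
unique up to null sets, so the infimum is over equal numbers. -/
def hessNormSq (w : Plane → Plane) : ℝ≥0∞ :=
  ⨅ H, ⨅ _ : HasWeakHessian w H,
    ∫⁻ x in M.contRegion, M.meshSize x * ∑ i : Fin 2, ∑ j : Fin 2, ‖H i j x‖ₑ ^ 2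

end Mesh

end ACCoupling

end

/-! The two energies differ only on the continuum bonds. For such a bond from x to x + r put D = y(x
+ r) - y(x), and let g(t) be the derivative of y in direction r at x + t r. Since D is the mean of
g, the linear term of the expansion of φ at D averages to zero, and the bond contributes at most
M₂(μ_c |r|) sup |g - D|² (`enorm_radial_sub_integral_le`). Both D and g(t) have length at least μ_c
|r|, but the segment joining them may come close to the origin, where M₂ gives no control. The
expansion is therefore made in the radial variable, and the angular remainder is bounded through
ϕ'(t)/t, the tangential eigenvalue of the Hessian (`radial_taylor`).

The oscillation of g is at most a multiple of the sum of the gradient jumps over the edges near the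
bond. A bond ends at lattice points and may run along edges, so the jumps are summed along a segment
shifted off the lattice, and continuity of y leads back to the bond (`adjacency_reachable`,
`enorm_slope_le`). Elements are fat and their edges have length at least one, so the number of edges
near a bond is of order |r|, with constants depending on the shape regularity only
(`exists_elems_ball_bound`). By Cauchy–Schwarz, sup |g - D|² is at most a multiple of |r|³ times the
sum of the squared jumps. Conversely an edge f is near the bonds in direction r of at most order |r|
|f| lattice points (`tsum_atoms_jumpSq_le`), so summing over atoms gives |r|⁴ times the squared
L²-norm of the jump. This is `exists_modelling_error_bound`; it uses periodicity and μ_c > 0 but no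
injectivity on the atoms, and hence serves both parts.

For (ii) the jumps of I_h y are bounded by second derivatives of a conforming interpolant
(`exists_jumpNormSq_le`). The jump across an edge shared by two triangles is controlled by a
combination of the four nodal values that vanishes on affine maps. All four vertices are visible,
within the union of the triangles, from a small triangle at the midpoint of the edge. Taylor
expansion about its points, averaged over it, gives a scale-invariant bound by ∫ |∇²w|² for smooth w
(`exists_jump_functional`), and mollification extends it to W^{2,∞}. Multiplication by |f| ≤ diam T
and summation produce the weight h. -/

namespace ACCoupling

/-! ### Coordinates with respect to the lattice basis -/

/-- The first lattice coordinate. -/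
noncomputable def coordS : Plane →L[ℝ] ℝ :=
  EuclideanSpace.proj (0 : Fin 2) - (1 / Real.sqrt 3) • EuclideanSpace.proj (1 : Fin 2)

/-- The second lattice coordinate. -/
noncomputable def coordT : Plane →L[ℝ] ℝ := (2 / Real.sqrt 3) • EuclideanSpace.proj (1 : Fin 2)

lemma coordS_apply (x : Plane) : coordS x = x 0 - 1 / Real.sqrt 3 * x 1 := rfl

lemma coordT_apply (x : Plane) : coordT x = 2 / Real.sqrt 3 * x 1 := rfl

lemma coord_decomp (x : Plane) : x = coordS x • a1 + coordT x • a2 := by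
  have h3 : Real.sqrt 3 ≠ 0 := by positivity
  ext i
  fin_cases i
  · simp [coordS_apply, coordT_apply, a1, a2]; ring
  · simp [coordT_apply, a1, a2]; field_simp

@[simp] lemma coordS_a1 : coordS a1 = 1 := by simp [coordS_apply, a1]
@[simp] lemma coordT_a1 : coordT a1 = 0 := by simp [coordT_apply, a1]
@[simp] lemma coordS_a2 : coordS a2 = 0 := by
  have h3 : Real.sqrt 3 ≠ 0 := by positivity
  simp [coordS_apply, a2]; field_simp; norm_num
@[simp] lemma coordT_a2 : coordT a2 = 1 := by
  have h3 : Real.sqrt 3 ≠ 0 := by positivity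
  simp [coordT_apply, a2]

lemma norm_sq_coord (x : Plane) :
    ‖x‖ ^ 2 = coordS x ^ 2 + coordS x * coordT x + coordT x ^ 2 := by
  have h3 : Real.sqrt 3 ≠ 0 := by positivity
  have h4 : Real.sqrt 3 ^ 2 = 3 := Real.sq_sqrt (by norm_num)
  rw [EuclideanSpace.norm_sq_eq]
  simp only [Fin.sum_univ_two, Real.norm_eq_abs, sq_abs, coordS_apply, coordT_apply]
  field_simp
  ring_nf
  rw [h4]

lemma coord_ext {x y : Plane} (h : coordS x = coordS y) (h' : coordT x = coordT y) : x = y := by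
  rw [coord_decomp x, coord_decomp y, h, h']

lemma mem_lattice_iff {x : Plane} :
    x ∈ lattice ↔ ∃ m n : ℤ, coordS x = m ∧ coordT x = n := by
  constructor
  · rintro ⟨m, n, rfl⟩
    exact ⟨m, n, by simp, by simp⟩
  · rintro ⟨m, n, h, h'⟩
    exact ⟨m, n, by rw [← h, ← h']; exact coord_decomp x⟩

lemma zero_mem_lattice : (0 : Plane) ∈ lattice := ⟨0, 0, by simp⟩

lemma a1_mem_lattice : a1 ∈ lattice := ⟨1, 0, by simp⟩

lemma a2_mem_lattice : a2 ∈ lattice := ⟨0, 1, by simp⟩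

lemma add_mem_lattice {x y : Plane} (hx : x ∈ lattice) (hy : y ∈ lattice) : x + y ∈ lattice := by
  obtain ⟨m, n, rfl⟩ := hx
  obtain ⟨m', n', rfl⟩ := hy
  exact ⟨m + m', n + n', by push_cast; module⟩

lemma neg_mem_lattice {x : Plane} (hx : x ∈ lattice) : -x ∈ lattice := by
  obtain ⟨m, n, rfl⟩ := hx
  exact ⟨-m, -n, by push_cast; module⟩

lemma sub_mem_lattice {x y : Plane} (hx : x ∈ lattice) (hy : y ∈ lattice) : x - y ∈ lattice := by
  rw [sub_eq_add_neg]; exact add_mem_lattice hx (neg_mem_lattice hy)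

lemma nsmul_mem_lattice (N : ℕ) {x : Plane} (hx : x ∈ lattice) : (N : ℝ) • x ∈ lattice := by
  obtain ⟨m, n, rfl⟩ := hx
  exact ⟨N * m, N * n, by push_cast; module⟩

/-- On the lattice the squared norm is the integer form m² + mn + n², which is positive away from
the origin. -/
lemma one_le_norm_of_mem_lattice {z : Plane} (hz : z ∈ lattice) (h0 : z ≠ 0) : 1 ≤ ‖z‖ := by
  obtain ⟨m, n, hm, hn⟩ := mem_lattice_iff.1 hz
  have h1 : ‖z‖ ^ 2 = ((m ^ 2 + m * n + n ^ 2 : ℤ) : ℝ) := by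
    rw [norm_sq_coord, hm, hn]; push_cast; ring
  have h2 : (0 : ℝ) < ‖z‖ ^ 2 := by positivity
  rw [h1] at h2
  have h3 : 1 ≤ m ^ 2 + m * n + n ^ 2 := by exact_mod_cast h2
  have h4 : (1 : ℝ) ≤ ‖z‖ ^ 2 := by rw [h1]; exact_mod_cast h3
  nlinarith [norm_nonneg z]

lemma one_le_dist_of_mem_lattice {x y : Plane} (hx : x ∈ lattice) (hy : y ∈ lattice)
    (h : x ≠ y) : 1 ≤ dist x y := by
  rw [dist_eq_norm]
  exact one_le_norm_of_mem_lattice (sub_mem_lattice hx hy) (sub_ne_zero.2 h)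

lemma lattice_countable : lattice.Countable := by
  have : lattice ⊆ range (fun p : ℤ × ℤ => (p.1 : ℝ) • a1 + (p.2 : ℝ) • a2) := by
    rintro x ⟨m, n, rfl⟩; exact ⟨(m, n), rfl⟩
  exact (countable_range _).mono this

/-! ### The cell -/

variable {N : ℕ}

lemma mem_cell_iff {x : Plane} :
    x ∈ cell N ↔ coordS x ∈ Ioc (0 : ℝ) N ∧ coordT x ∈ Ioc (0 : ℝ) N := by
  constructor
  · rintro ⟨s, hs, t, ht, rfl⟩
    simpa using ⟨hs, ht⟩
  · rintro ⟨hs, ht⟩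
    exact ⟨_, hs, _, ht, coord_decomp x⟩

lemma closure_cell_subset :
    closure (cell N) ⊆ {x | coordS x ∈ Icc (0 : ℝ) N ∧ coordT x ∈ Icc (0 : ℝ) N} := by
  apply closure_minimal
  · intro x hx
    obtain ⟨h1, h2⟩ := mem_cell_iff.1 hx
    exact ⟨Ioc_subset_Icc_self h1, Ioc_subset_Icc_self h2⟩
  · exact (isClosed_Icc.preimage coordS.continuous).inter (isClosed_Icc.preimage coordT.continuous)

lemma coordS_isOpenMap : IsOpenMap coordS :=
  coordS.isOpenMap (fun y => ⟨y • a1, by simp⟩)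

lemma coordT_isOpenMap : IsOpenMap coordT :=
  coordT.isOpenMap (fun y => ⟨y • a2, by simp⟩)

lemma interior_closure_cell_subset :
    interior (closure (cell N)) ⊆ {x | coordS x ∈ Ioo (0 : ℝ) N ∧ coordT x ∈ Ioo (0 : ℝ) N} := by
  intro x hx
  have h1 := interior_mono closure_cell_subset hx
  have h2 : x ∈ interior (coordS ⁻¹' Icc (0 : ℝ) N) := interior_mono (fun y hy => hy.1) h1
  have h3 : x ∈ interior (coordT ⁻¹' Icc (0 : ℝ) N) := interior_mono (fun y hy => hy.2) h1
  rw [← coordS_isOpenMap.preimage_interior_eq_interior_preimage coordS.continuous,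
    interior_Icc] at h2
  rw [← coordT_isOpenMap.preimage_interior_eq_interior_preimage coordT.continuous,
    interior_Icc] at h3
  exact ⟨h2, h3⟩

lemma interior_closure_cell_subset_cell : interior (closure (cell N)) ⊆ cell N := fun _ hx =>
  mem_cell_iff.2 ⟨Ioo_subset_Ioc_self (interior_closure_cell_subset hx).1,
    Ioo_subset_Ioc_self (interior_closure_cell_subset hx).2⟩

lemma interior_cell_subset :
    interior (cell N) ⊆ {x | coordS x ∈ Ioo (0 : ℝ) N ∧ coordT x ∈ Ioo (0 : ℝ) N} :=
  (interior_mono subset_closure).trans interior_closure_cell_subset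

lemma int_eq_zero_of_mul_lt {a b : ℝ} {m : ℤ} (hN : 0 < N) (h : b = a + N * m)
    (h1 : a - b < N) (h2 : b - a < N) : m = 0 := by
  have hN' : (0 : ℝ) < N := by exact_mod_cast hN
  have h3 : (N : ℝ) * m < N * 1 := by linarith
  have h4 : (N : ℝ) * (-1) < N * m := by linarith
  have h5 : (m : ℝ) < 1 := lt_of_mul_lt_mul_left h3 hN'.le
  have h6 : (-1 : ℝ) < m := lt_of_mul_lt_mul_left h4 hN'.le
  have h7 : m < 1 := by exact_mod_cast h5
  have h8 : -1 < m := by exact_mod_cast h6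
  omega

lemma eq_zero_of_mem_lattice_of_coord (hN : 0 < N) {x z : Plane} (hz : z ∈ lattice)
    (hs : |coordS (x + (N : ℝ) • z) - coordS x| < N)
    (ht : |coordT (x + (N : ℝ) • z) - coordT x| < N) : z = 0 := by
  obtain ⟨m, n, hm, hn⟩ := mem_lattice_iff.1 hz
  rw [abs_lt] at hs ht
  have h1 : m = 0 := int_eq_zero_of_mul_lt (a := coordS x) (b := coordS (x + (N : ℝ) • z)) hN
    (by simp [hm]) (by linarith) (by linarith)
  have h2 : n = 0 := int_eq_zero_of_mul_lt (a := coordT x) (b := coordT (x + (N : ℝ) • z)) hN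
    (by simp [hn]) (by linarith) (by linarith)
  apply coord_ext <;> simp [hm, hn, h1, h2]

lemma eq_zero_of_translate_mem_cell (hN : 0 < N) {x z : Plane} (hz : z ∈ lattice)
    (hx : x ∈ cell N) (hx' : x + (N : ℝ) • z ∈ cell N) : z = 0 := by
  obtain ⟨h1, h2⟩ := mem_cell_iff.1 hx
  obtain ⟨h3, h4⟩ := mem_cell_iff.1 hx'
  exact eq_zero_of_mem_lattice_of_coord (x := x) hN hz
    (by rw [abs_lt]; constructor <;> linarith [h1.1, h1.2, h3.1, h3.2])
    (by rw [abs_lt]; constructor <;> linarith [h2.1, h2.2, h4.1, h4.2])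

/-- Opposite sides of the closed cell are congruent modulo the periods, so a closed-cell version of
the previous fact needs one of the points in the interior. -/
lemma eq_zero_of_translate_mem_closure_cell (hN : 0 < N) {x z : Plane} (hz : z ∈ lattice)
    (hx : x ∈ interior (cell N)) (hx' : x + (N : ℝ) • z ∈ closure (cell N)) : z = 0 := by
  obtain ⟨h1, h2⟩ := interior_cell_subset hx
  obtain ⟨h3, h4⟩ := closure_cell_subset hx'
  exact eq_zero_of_mem_lattice_of_coord (x := x) hN hz
    (by rw [abs_lt]; constructor <;> linarith [h1.1, h1.2, h3.1, h3.2])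
    (by rw [abs_lt]; constructor <;> linarith [h2.1, h2.2, h4.1, h4.2])

lemma exists_int_translate (hN : 0 < N) (a : ℝ) : ∃ m : ℤ, a + N * m ∈ Ioc (0 : ℝ) N := by
  have hN' : (0 : ℝ) < N := by exact_mod_cast hN
  obtain ⟨m, hm, -⟩ := existsUnique_add_zsmul_mem_Ioc hN' a 0
  refine ⟨m, ?_⟩
  simpa [mul_comm] using hm

lemma exists_translate_mem_cell (hN : 0 < N) (x : Plane) :
    ∃ z ∈ lattice, x + (N : ℝ) • z ∈ cell N := by
  obtain ⟨m, hm⟩ := exists_int_translate hN (coordS x)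
  obtain ⟨n, hn⟩ := exists_int_translate hN (coordT x)
  refine ⟨(m : ℝ) • a1 + (n : ℝ) • a2, ⟨m, n, rfl⟩, mem_cell_iff.2 ?_⟩
  simpa using ⟨hm, hn⟩

/-! ### Area forms -/

/-- The area form of the plane. -/
noncomputable def det2 (u v : Plane) : ℝ := u 0 * v 1 - u 1 * v 0

lemma det2_sq (u v : Plane) :
    det2 u v ^ 2 = inner ℝ u u * inner ℝ v v - inner ℝ u v * inner ℝ u v := by
  simp only [det2, PiLp.inner_apply, Fin.sum_univ_two, RCLike.inner_apply, conj_trivial]; ring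

lemma abs_det2_eq_sin (u v : Plane) :
    |det2 u v| = Real.sin (InnerProductGeometry.angle u v) * (‖u‖ * ‖v‖) := by
  rw [InnerProductGeometry.sin_angle_mul_norm_mul_norm, ← det2_sq, Real.sqrt_sq_eq_abs]

lemma abs_det2_le (u v : Plane) : |det2 u v| ≤ ‖u‖ * ‖v‖ := by
  rw [abs_det2_eq_sin]
  exact mul_le_of_le_one_left (by positivity) (Real.sin_le_one _)

lemma det2_add_left (u u' v : Plane) : det2 (u + u') v = det2 u v + det2 u' v := by
  simp [det2]; ring

lemma det2_add_right (u v v' : Plane) : det2 u (v + v') = det2 u v + det2 u v' := by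
  simp [det2]; ring

lemma det2_smul_left (c : ℝ) (u v : Plane) : det2 (c • u) v = c * det2 u v := by
  simp [det2]; ring

lemma det2_smul_right (c : ℝ) (u v : Plane) : det2 u (c • v) = c * det2 u v := by
  simp [det2]; ring

@[simp] lemma det2_self (u : Plane) : det2 u u = 0 := by simp [det2]; ring

/-- Cramer's rule. -/
lemma det2_smul_eq (u v w : Plane) : det2 u v • w = det2 w v • u + det2 u w • v := by
  ext i
  fin_cases i <;> simp [det2] <;> ring

lemma eq_comb_of_det2_ne_zero {u v : Plane} (h : det2 u v ≠ 0) (w : Plane) :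
    w = (det2 w v / det2 u v) • u + (det2 u w / det2 u v) • v := by
  have h1 := congrArg (fun x => (det2 u v)⁻¹ • x) (det2_smul_eq u v w)
  simp only [smul_add, smul_smul, inv_mul_cancel₀ h, one_smul] at h1
  rw [div_eq_inv_mul, div_eq_inv_mul]
  exact h1

/-! ### Measure and packing -/

lemma volume_convexHull_pair (p q : Plane) : volume (convexHull ℝ {p, q}) = 0 := by
  have h1 : (convexHull ℝ {p, q} : Set Plane) ⊆ (affineSpan ℝ {p, q} : Set Plane) :=
    convexHull_subset_affineSpan _
  refine measure_mono_null h1 (Measure.addHaar_affineSubspace _ _ ?_)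
  intro h2
  have h3 := collinear_iff_finrank_le_one.1 (collinear_pair ℝ p q)
  rw [← direction_affineSpan, h2, AffineSubspace.direction_top, finrank_top] at h3
  simp at h3

lemma volume_convexHull_of_card_le {T : Finset Plane} (hT : T.card ≤ 2) :
    volume (convexHull ℝ (T : Set Plane)) = 0 := by
  obtain ⟨p, q, h⟩ : ∃ p q, (T : Set Plane) ⊆ {p, q} := by
    classical
    rcases T.eq_empty_or_nonempty with rfl | ⟨p, hp⟩
    · exact ⟨0, 0, by simp⟩
    · have h1 : (T.erase p).card ≤ 1 := by rw [Finset.card_erase_of_mem hp]; omega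
      rcases (T.erase p).eq_empty_or_nonempty with h2 | ⟨q, hq⟩
      · refine ⟨p, p, fun x hx => ?_⟩
        by_contra h3
        have h4 : x ∈ T.erase p := Finset.mem_erase.2 ⟨fun h => h3 (by simp [h]), hx⟩
        simp [h2] at h4
      · refine ⟨p, q, fun x hx => ?_⟩
        by_cases hxp : x = p
        · simp [hxp]
        · have h4 : x ∈ T.erase p := Finset.mem_erase.2 ⟨hxp, hx⟩
          simp [Finset.card_le_one.1 h1 x h4 q hq]
  exact measure_mono_null (convexHull_mono h) (volume_convexHull_pair p q)

/-- A bound for the number of essentially disjoint sets of volume at least `a` inside a set of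
volume at most `V`. -/
lemma exists_packing_bound (V a : ℝ≥0∞) (hV : V ≠ ⊤) (ha : a ≠ 0) :
    ∃ C : ℕ, ∀ {ι : Type} (s : Set ι) (A : ι → Set Plane) (B : Set Plane),
      volume B ≤ V → (∀ i ∈ s, A i ⊆ B) → (∀ i ∈ s, a ≤ volume (A i)) →
      (∀ i ∈ s, NullMeasurableSet (A i)) →
      (∀ i ∈ s, ∀ j ∈ s, i ≠ j → volume (A i ∩ A j) = 0) → s.encard ≤ C := by
  obtain ⟨C, hC⟩ : ∃ C : ℕ, V < (C + 1 : ℕ) * a := by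
    by_cases ha' : a = ⊤
    · exact ⟨0, by simp [ha', hV.lt_top]⟩
    · obtain ⟨n, hn⟩ := ENNReal.exists_nat_mul_gt ha hV
      exact ⟨n, hn.trans_le (by gcongr; omega)⟩
  refine ⟨C, fun {ι} s A B hB hAB hA hm hd => ?_⟩
  have key : ∀ t : Finset ι, ↑t ⊆ s → t.card ≤ C := by
    intro t ht
    by_contra hcon
    have h1 : volume (⋃ i ∈ t, A i) = ∑ i ∈ t, volume (A i) := measure_biUnion_finset₀
      (fun i hi j hj hij => hd i (ht hi) j (ht hj) hij) (fun i hi => hm i (ht hi))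
    have h2 : volume (⋃ i ∈ t, A i) ≤ V :=
      (measure_mono (iUnion₂_subset fun i hi => hAB i (ht hi))).trans hB
    have h3 : (t.card : ℝ≥0∞) * a ≤ ∑ i ∈ t, volume (A i) := by
      rw [← nsmul_eq_mul]
      exact Finset.card_nsmul_le_sum _ _ _ fun i hi => hA i (ht hi)
    have h4 : ((C + 1 : ℕ) : ℝ≥0∞) * a ≤ t.card * a := by gcongr; omega
    exact absurd (hC.trans_le (h4.trans (h3.trans (h1 ▸ h2)))) (lt_irrefl _)
  have hfin : s.Finite := by
    by_contra hinf
    obtain ⟨t, ht, hc⟩ := Set.Infinite.exists_subset_card_eq hinf (C + 1)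
    have := key t ht
    omega
  rw [hfin.encard_eq_coe_toFinset_card]
  exact_mod_cast key _ (by simp)

/-- Balls of radius 1/2 about distinct lattice points are disjoint, so packing gives a count
independent of the centre. -/
lemma exists_lattice_ball_bound (R : ℝ) :
    ∃ C : ℕ, ∀ c : Plane, (lattice ∩ Metric.closedBall c R).encard ≤ C := by
  obtain ⟨C, hC⟩ := exists_packing_bound (volume (Metric.closedBall (0 : Plane) (R + 1)))
    (volume (Metric.ball (0 : Plane) (1 / 2))) (measure_closedBall_lt_top.ne)
    (Metric.measure_ball_pos _ _ (by norm_num)).ne'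
  refine ⟨C, fun c => hC _ (fun x => Metric.ball x (1 / 2)) (Metric.closedBall c (R + 1)) ?_ ?_ ?_
    ?_ ?_⟩
  · rw [Measure.addHaar_closedBall_center]
  · rintro x ⟨-, hx⟩ y hy
    rw [Metric.mem_closedBall] at *
    rw [Metric.mem_ball] at hy
    linarith [dist_triangle y x c]
  · intro x _
    exact (Measure.addHaar_ball_center _ _ _).symm.le
  · intro x _
    exact measurableSet_ball.nullMeasurableSet
  · rintro x ⟨hx, -⟩ y ⟨hy, -⟩ hxy
    have h1 := one_le_dist_of_mem_lattice hx hy hxy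
    have : Metric.ball x (1 / 2) ∩ Metric.ball y (1 / 2) = ∅ := by
      apply Disjoint.inter_eq
      apply Metric.ball_disjoint_ball
      linarith
    rw [this]
    simp

/-- A positive lower bound for the area of a triangle whose edge vectors have area form one. -/
noncomputable def unitArea : ℝ≥0∞ := volume (Metric.ball (0 : Plane) (1 / 4))

lemma unitArea_pos : 0 < unitArea := Metric.measure_ball_pos _ _ (by norm_num)

lemma unitArea_ne_top : unitArea ≠ ⊤ := measure_ball_lt_top.ne

lemma abs_apply_le_norm (x : Plane) (i : Fin 2) : |x i| ≤ ‖x‖ := by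
  simpa using PiLp.norm_apply_le x i

/-- The reference triangle contains the ball of radius 1/4 about (1/4, 1/4), and the linear map
carrying the reference edges to `q - p` and `r - p` scales volume by the modulus of the area form.
The exact area is never needed. -/
lemma volume_triangle_ge (p q r : Plane) :
    ENNReal.ofReal |det2 (q - p) (r - p)| * unitArea ≤ volume (convexHull ℝ {p, q, r}) := by
  set b := (EuclideanSpace.basisFun (Fin 2) ℝ).toBasis with hb
  set u := q - p with hu
  set v := r - p with hv
  set L : Plane →ₗ[ℝ] Plane := Matrix.toLin b b !![u 0, v 0; u 1, v 1] with hL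
  have hdet : LinearMap.det L = det2 u v := by
    rw [hL, LinearMap.det_toLin, Matrix.det_fin_two_of, det2]; ring
  have hLx : ∀ x : Plane, L x = x 0 • u + x 1 • v := by
    intro x
    ext i
    rw [hL, Matrix.toLin_apply]
    fin_cases i <;>
      simp [hb, Matrix.mulVec, dotProduct, Fin.sum_univ_two] <;> ring
  set c : Plane := !₂[1 / 4, 1 / 4] with hc
  have h1 : L '' Metric.ball c (1 / 4) ⊆ (fun x => -p + x) '' convexHull ℝ {p, q, r} := by
    rintro _ ⟨x, hx, rfl⟩
    refine ⟨p + L x, ?_, by simp⟩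
    rw [Metric.mem_ball, dist_eq_norm] at hx
    have h0 := (abs_apply_le_norm (x - c) 0).trans_lt hx
    have h1 := (abs_apply_le_norm (x - c) 1).trans_lt hx
    simp [hc, abs_lt] at h0 h1
    rw [hLx, show p + (x 0 • u + x 1 • v) = (1 - x 0 - x 1) • p + x 0 • q + x 1 • r by
      rw [hu, hv]; module]
    have hC := convex_convexHull ℝ ({p, q, r} : Set Plane)
    have hp : p ∈ convexHull ℝ ({p, q, r} : Set Plane) := subset_convexHull _ _ (by simp)
    have hq : q ∈ convexHull ℝ ({p, q, r} : Set Plane) := subset_convexHull _ _ (by simp)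
    have hr : r ∈ convexHull ℝ ({p, q, r} : Set Plane) := subset_convexHull _ _ (by simp)
    have h3 := hC.sum_mem (t := Finset.univ) (w := ![1 - x 0 - x 1, x 0, x 1]) (z := ![p, q, r])
      (by intro i _; fin_cases i <;> simp <;> linarith)
      (by simp [Fin.sum_univ_three]; ring) (by intro i _; fin_cases i <;> simp [hp, hq, hr])
    simpa [Fin.sum_univ_three] using h3
  have h2 := measure_mono (μ := volume) h1
  rw [Measure.addHaar_image_linearMap, hdet, Measure.addHaar_ball_center, image_add_left,
    measure_preimage_add] at h2
  exact h2

/-! ### Fat triangles -/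

/-- The area form of two edge vectors is comparable to the product of their lengths. -/
def Fat (κ : ℝ) (T : Finset Plane) : Prop :=
  ∀ p ∈ T, ∀ q ∈ T, ∀ r ∈ T, p ≠ q → q ≠ r → p ≠ r →
    κ * (‖p - q‖ * ‖r - q‖) ≤ |det2 (p - q) (r - q)|

lemma sin_ge_of_mem {θ α : ℝ} (h0 : 0 ≤ θ) (h1 : θ ≤ α) (h2 : α ≤ Real.pi - θ) :
    Real.sin θ ≤ Real.sin α := by
  rcases le_total α (Real.pi / 2) with h | h
  · exact Real.sin_le_sin_of_le_of_le_pi_div_two (by linarith [Real.pi_pos]) h h1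
  · rw [← Real.sin_pi_sub α]
    exact Real.sin_le_sin_of_le_of_le_pi_div_two (by linarith [Real.pi_pos]) (by linarith)
      (by linarith)

/-- All three angles are at most σ times the given one, and they add up to π. -/
lemma Mesh.ShapeRegular.angle_ge {N : ℕ} {M : Mesh N} {σ : ℝ} (h : M.ShapeRegular σ)
    {T : Finset Plane} (hT : T ∈ M.elems) {p q r : Plane} (hp : p ∈ T) (hq : q ∈ T) (hr : r ∈ T)
    (hpq : p ≠ q) (hqr : q ≠ r) (hpr : p ≠ r) :
    1 ≤ σ ∧ Real.pi / (3 * σ) ≤ EuclideanGeometry.angle p q r := by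
  have hsum := EuclideanGeometry.angle_add_angle_add_angle_eq_pi (p₁ := p) (p₂ := q) r hpq.symm
  have e1 := h T hT T hT p hp q hq r hr p hp q hq r hr hpq hqr hpr hpq hqr hpr
  have e2 := h T hT T hT q hq r hr p hp p hp q hq r hr hqr hpr.symm hpq.symm hpq hqr hpr
  have e3 := h T hT T hT r hr p hp q hq p hp q hq r hr hpr.symm hpq hqr.symm hpq hqr hpr
  have hpi := Real.pi_pos
  have n1 := EuclideanGeometry.angle_nonneg p q r
  have n2 := EuclideanGeometry.angle_nonneg q r p
  have n3 := EuclideanGeometry.angle_nonneg r p q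
  set α := EuclideanGeometry.angle p q r
  have hpos : 0 < σ * α := by linarith
  have hα : 0 < α := by
    rcases n1.lt_or_eq with h | h
    · exact h
    · rw [← h] at hpos; simp at hpos
  have hσ : 1 ≤ σ := by
    by_contra hc
    push Not at hc
    nlinarith
  refine ⟨hσ, ?_⟩
  rw [div_le_iff₀ (by linarith)]
  nlinarith

/-- Every angle is at least θ = π/(3σ), hence also at most π - θ because a second angle is at least
θ; so its sine is at least sin θ, and this sine is the ratio of the area form to the product of the
lengths. -/
lemma exists_fat (σ : ℝ) : ∃ κ : ℝ, 0 < κ ∧ κ ≤ 1 ∧ ∀ (N : ℕ) (M : Mesh N), M.ShapeRegular σ →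
    ∀ T ∈ M.elems, Fat κ T := by
  by_cases hσ : 1 ≤ σ
  · have hpi := Real.pi_pos
    have hθ : Real.pi / (3 * σ) < Real.pi := by
      rw [div_lt_iff₀ (by linarith)]; nlinarith
    have hθ0 : 0 < Real.pi / (3 * σ) := by positivity
    refine ⟨Real.sin (Real.pi / (3 * σ)), Real.sin_pos_of_pos_of_lt_pi hθ0 hθ, Real.sin_le_one _,
      fun N M hM T hT p hp q hq r hr hpq hqr hpr => ?_⟩
    rw [abs_det2_eq_sin]
    gcongr
    have h1 := (hM.angle_ge hT hp hq hr hpq hqr hpr).2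
    have h2 := (hM.angle_ge hT hq hr hp hqr hpr.symm hpq.symm).2
    have h3 := EuclideanGeometry.angle_nonneg r p q
    have hsum := EuclideanGeometry.angle_add_angle_add_angle_eq_pi (p₁ := p) (p₂ := q) r hpq.symm
    exact sin_ge_of_mem hθ0.le h1
      (by change EuclideanGeometry.angle p q r ≤ _; linarith)
  -- For σ < 1 no triangle satisfies the angle condition, not even when compared with itself, so any
  -- κ will do.
  · exact ⟨1, one_pos, le_rfl, fun N M hM T hT p hp q hq r hr hpq hqr hpr =>
      absurd (hM.angle_ge hT hp hq hr hpq hqr hpr).1 hσ⟩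

/-- The area form does not change if `p - q` is replaced by `p - r`; cancelling the common factor
`‖r - q‖` shows that all edges of a fat triangle are comparable. -/
lemma Fat.norm_le {κ : ℝ} {T : Finset Plane} (h : Fat κ T) {p q r : Plane}
    (hp : p ∈ T) (hq : q ∈ T) (hr : r ∈ T) (hpq : p ≠ q) (hqr : q ≠ r) (hpr : p ≠ r) :
    κ * ‖p - q‖ ≤ ‖p - r‖ := by
  have h1 := h p hp q hq r hr hpq hqr hpr
  have h2 : det2 (p - q) (r - q) = det2 (p - r) (r - q) := by
    rw [show p - q = (p - r) + (r - q) by abel, det2_add_left, det2_self, add_zero]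
  rw [h2] at h1
  have h3 := h1.trans (abs_det2_le _ _)
  rw [← mul_assoc] at h3
  exact le_of_mul_le_mul_right h3 (norm_pos_iff.2 (sub_ne_zero.2 hqr.symm))

/-! ### Translation by periods. -/

lemma mem_translate {v x : Plane} {T : Finset Plane} : x ∈ translate v T ↔ x - v ∈ T := by
  simp only [translate, Finset.mem_map, addRightEmbedding_apply]
  constructor
  · rintro ⟨a, ha, rfl⟩; simpa
  · intro h; exact ⟨x - v, h, by simp⟩

lemma coe_translate (v : Plane) (T : Finset Plane) :
    ((translate v T : Finset Plane) : Set Plane) = (fun x => x + v) '' (T : Set Plane) := by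
  simp [translate]

@[simp] lemma card_translate (v : Plane) (T : Finset Plane) : (translate v T).card = T.card := by
  simp [translate]

lemma translate_translate (v w : Plane) (T : Finset Plane) :
    translate v (translate w T) = translate (w + v) T := by
  ext x; simp only [mem_translate]; rw [sub_sub, add_comm v w]

@[simp] lemma translate_zero (T : Finset Plane) : translate 0 T = T := by
  ext x; simp [mem_translate]

lemma convexHull_translate (v : Plane) (T : Finset Plane) :
    convexHull ℝ ((translate v T : Finset Plane) : Set Plane) =
      (fun x => x + v) '' convexHull ℝ (T : Set Plane) := by
  rw [coe_translate]
  have h := (AffineEquiv.constVAdd ℝ Plane v).toAffineMap.image_convexHull (T : Set Plane)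
  have e : ⇑(AffineEquiv.constVAdd ℝ Plane v).toAffineMap = fun x => x + v := by
    funext x; simp [add_comm]
  rw [e] at h
  exact h.symm

lemma mem_convexHull_translate {v x : Plane} {T : Finset Plane} :
    x ∈ convexHull ℝ ((translate v T : Finset Plane) : Set Plane) ↔
      x - v ∈ convexHull ℝ (T : Set Plane) := by
  rw [convexHull_translate]
  constructor
  · rintro ⟨a, ha, rfl⟩; simpa
  · intro h; exact ⟨x - v, h, by simp⟩

lemma Fat.translate {κ : ℝ} {T : Finset Plane} (h : Fat κ T) (v : Plane) :
    Fat κ (translate v T) := by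
  intro p hp q hq r hr hpq hqr hpr
  rw [mem_translate] at hp hq hr
  have := h _ hp _ hq _ hr (by simpa using hpq) (by simpa using hqr) (by simpa using hpr)
  simpa using this

lemma translate_mem_periodicFamily {N : ℕ} {S : Set (Finset Plane)} {T : Finset Plane}
    (hT : T ∈ periodicFamily N S) {z : Plane} (hz : z ∈ lattice) :
    translate ((N : ℝ) • z) T ∈ periodicFamily N S := by
  obtain ⟨T0, hT0, z0, hz0, rfl⟩ := hT
  exact ⟨T0, hT0, z0 + z, add_mem_lattice hz0 hz, by rw [translate_translate, smul_add]⟩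

lemma subset_periodicFamily {N : ℕ} {S : Set (Finset Plane)} : S ⊆ periodicFamily N S :=
  fun T hT => ⟨T, hT, 0, zero_mem_lattice, by simp⟩

lemma translate_mem_periodic {N : ℕ} {A : Set Plane} {x z : Plane} (hx : x ∈ periodic N A)
    (hz : z ∈ lattice) : x + (N : ℝ) • z ∈ periodic N A := by
  obtain ⟨a, ha, w, hw, rfl⟩ := hx
  exact ⟨a, ha, w + z, add_mem_lattice hw hz, by rw [smul_add, add_assoc]⟩

lemma translate_mem_periodic_iff {N : ℕ} {A : Set Plane} {x z : Plane} (hz : z ∈ lattice) :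
    x + (N : ℝ) • z ∈ periodic N A ↔ x ∈ periodic N A :=
  ⟨fun h => by simpa using translate_mem_periodic h (neg_mem_lattice hz),
    fun h => translate_mem_periodic h hz⟩

lemma subset_periodic {N : ℕ} {A : Set Plane} : A ⊆ periodic N A :=
  fun a ha => ⟨a, ha, 0, zero_mem_lattice, by simp⟩

/-- Used to move from a boundary point or vertex of an element to nearby interior points, where
open-set arguments apply. -/
lemma convex_closure_interior_convexHull {T : Finset Plane} (hc : T.card = 3)
    (ha : AffineIndependent ℝ ((↑) : T → Plane)) :
    closure (interior (convexHull ℝ (T : Set Plane))) = convexHull ℝ (T : Set Plane) := by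
  have h1 : affineSpan ℝ (T : Set Plane) = ⊤ := by
    have := ha.affineSpan_eq_top_iff_card_eq_finrank_add_one.2 (by simp [hc])
    simpa using this
  have h2 := interior_convexHull_nonempty_iff_affineSpan_eq_top.2 h1
  rw [(convex_convexHull ℝ (T : Set Plane)).closure_interior_eq_closure_of_nonempty_interior h2]
  exact (T.finite_toSet.isCompact_convexHull ℝ).isClosed.closure_eq

lemma isCompact_hull (T : Finset Plane) : IsCompact (convexHull ℝ (T : Set Plane)) :=
  T.finite_toSet.isCompact_convexHull ℝ

/-! ### The periodic mesh and the continuum region. -/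

namespace Mesh

variable {N : ℕ} {M : Mesh N}

lemma elemsPer_card {T : Finset Plane} (hT : T ∈ M.elemsPer) : T.card = 3 := by
  obtain ⟨T0, hT0, z, -, rfl⟩ := hT
  rw [card_translate]; exact M.card_eq T0 hT0

lemma elemsPer_subset_lattice {T : Finset Plane} (hT : T ∈ M.elemsPer) :
    (T : Set Plane) ⊆ lattice := by
  obtain ⟨T0, hT0, z, hz, rfl⟩ := hT
  intro x hx
  have h1 := M.vertices_mem T0 hT0 (mem_translate.1 hx)
  simpa using add_mem_lattice h1 (nsmul_mem_lattice N hz)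

lemma affineIndependent_translate {T : Finset Plane} (h : AffineIndependent ℝ ((↑) : T → Plane))
    (v : Plane) : AffineIndependent ℝ ((↑) : translate v T → Plane) := by
  have h1 := (AffineEquiv.constVAdd ℝ Plane v).affineIndependent_set_of_eq_iff (s := (T : Set Plane))
  have h2 := h1.2 h
  have h3 : (AffineEquiv.constVAdd ℝ Plane v) '' (T : Set Plane) =
      ((translate v T : Finset Plane) : Set Plane) := by
    rw [coe_translate]; congr 1; funext x; simp [add_comm]
  rw [h3] at h2
  exact h2

lemma elemsPer_affineIndependent {T : Finset Plane} (hT : T ∈ M.elemsPer) :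
    AffineIndependent ℝ ((↑) : T → Plane) := by
  obtain ⟨T0, hT0, z, -, rfl⟩ := hT
  exact affineIndependent_translate (M.nondegenerate T0 hT0) _

lemma fat_elemsPer {κ : ℝ} (hF : ∀ T ∈ M.elems, Fat κ T) {T : Finset Plane}
    (hT : T ∈ M.elemsPer) : Fat κ T := by
  obtain ⟨T0, hT0, z, -, rfl⟩ := hT
  exact (hF T0 hT0).translate _

lemma contElemsPer_subset : M.contElemsPer ⊆ M.elemsPer := by
  rintro T ⟨T0, hT0, z, hz, rfl⟩
  exact ⟨T0, hT0.1, z, hz, rfl⟩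

lemma atomElem_mem_elemsPer {T : Finset Plane} (hT : T ∈ M.atomElems) : T ∈ M.elemsPer :=
  subset_periodicFamily (M.atomElems_subset hT)

/-- Two distinct elements share at most two vertices, and by regularity their intersection is the
hull of these. -/
lemma volume_inter_eq_zero {T T' : Finset Plane} (hT : T ∈ M.elemsPer) (hT' : T' ∈ M.elemsPer)
    (h : T ≠ T') : volume (convexHull ℝ (T : Set Plane) ∩ convexHull ℝ (T' : Set Plane)) = 0 := by
  classical
  rw [M.regular T hT T' hT', ← Finset.coe_inter]
  apply volume_convexHull_of_card_le
  by_contra hc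
  push Not at hc
  have h1 := elemsPer_card hT
  have h2 := elemsPer_card hT'
  have h3 : T ∩ T' = T := Finset.eq_of_subset_of_card_le Finset.inter_subset_left (by omega)
  have h4 : T ∩ T' = T' := Finset.eq_of_subset_of_card_le Finset.inter_subset_right (by omega)
  exact h (h3.symm.trans h4)

lemma elemsPer_countable : M.elemsPer.Countable := by
  have h1 : M.elemsPer ⊆ {T : Finset Plane | (T : Set Plane) ⊆ lattice} :=
    fun T hT => elemsPer_subset_lattice hT
  have h2 := (Set.countable_ofPred_finite_subset lattice_countable).preimage
    (Finset.coe_injective (α := Plane))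
  refine h2.mono fun T hT => ?_
  exact And.intro T.finite_toSet (h1 hT)

/-- If `T` were not in `S`, it would meet each of the countably many members of `S` in a null set,
whereas a nonempty open set has positive measure. -/
lemma mem_of_isOpen_subset {S : Set (Finset Plane)} (hS : S ⊆ M.elemsPer) {T : Finset Plane}
    (hT : T ∈ M.elemsPer) {V : Set Plane} (hV : IsOpen V) (hne : V.Nonempty)
    (h1 : V ⊆ convexHull ℝ (T : Set Plane)) (h2 : V ⊆ hullUnion S) : T ∈ S := by
  by_contra hTS
  have h3 : volume (⋃ T' ∈ S, convexHull ℝ (T : Set Plane) ∩ convexHull ℝ (T' : Set Plane)) = 0 :=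
    (measure_biUnion_null_iff (elemsPer_countable.mono hS)).2 fun T' hT' =>
      volume_inter_eq_zero hT (hS hT') (fun h => hTS (h ▸ hT'))
  have h4 : V ⊆ ⋃ T' ∈ S, convexHull ℝ (T : Set Plane) ∩ convexHull ℝ (T' : Set Plane) := by
    intro x hx
    obtain ⟨T', hT', hx'⟩ := mem_iUnion₂.1 (h2 hx)
    exact mem_iUnion₂.2 ⟨T', hT', h1 hx, hx'⟩
  exact (hV.measure_pos volume hne).ne' (measure_mono_null h4 h3)

lemma exists_mem_elemsPer (hN : 0 < N) (x : Plane) :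
    ∃ T ∈ M.elemsPer, x ∈ convexHull ℝ (T : Set Plane) := by
  obtain ⟨z, hz, hx⟩ := exists_translate_mem_cell hN x
  obtain ⟨T, hT, hxT⟩ := mem_iUnion₂.1 (M.covers (subset_closure hx))
  refine ⟨translate ((N : ℝ) • (-z)) T, ⟨T, hT, -z, neg_mem_lattice hz, rfl⟩, ?_⟩
  rw [mem_convexHull_translate]
  simpa using hxT

/-- The atomistic region lies in the interior of the cell, so a translate of an element of the
closed cell can be an atomistic element only if the translation is zero. -/
lemma atomElem_not_mem_contElemsPer (hN : 0 < N) {T : Finset Plane} (hT : T ∈ M.atomElems) :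
    T ∉ M.contElemsPer := by
  rintro ⟨T0, hT0, z, hz, rfl⟩
  have hne : (translate ((N : ℝ) • z) T0).Nonempty := by
    rw [← Finset.card_pos, card_translate, M.card_eq T0 hT0.1]; norm_num
  obtain ⟨v, hv⟩ := hne
  have h1 : v ∈ interior (cell N) :=
    M.atomistic_subset (mem_iUnion₂.2 ⟨_, hT, subset_convexHull _ _ hv⟩)
  have h2 : v - (N : ℝ) • z ∈ closure (cell N) :=
    M.subset_cell T0 hT0.1 (subset_convexHull _ _ (mem_translate.1 hv))
  have h3 := eq_zero_of_translate_mem_closure_cell hN (neg_mem_lattice hz) h1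
    (by simpa [← sub_eq_add_neg] using h2)
  have h4 : z = 0 := by simpa using h3
  subst h4
  simp at hT
  exact hT0.2 hT

lemma elemsPer_cases {T : Finset Plane} (hT : T ∈ M.elemsPer) :
    T ∈ M.contElemsPer ∨ ∃ T0 ∈ M.atomElems, ∃ z ∈ lattice, T = translate ((N : ℝ) • z) T0 := by
  obtain ⟨T0, hT0, z, hz, rfl⟩ := hT
  by_cases h : T0 ∈ M.atomElems
  · exact Or.inr ⟨T0, h, z, hz, rfl⟩
  · exact Or.inl ⟨T0, ⟨hT0, h⟩, z, hz, rfl⟩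

lemma finite_elems : M.elems.Finite := by
  have h1 : (lattice ∩ closure (cell N)).Finite := by
    have h2 : lattice ∩ closure (cell N) ⊆
        (fun p : ℤ × ℤ => (p.1 : ℝ) • a1 + (p.2 : ℝ) • a2) '' (Icc 0 (N : ℤ) ×ˢ Icc 0 (N : ℤ)) := by
      rintro x ⟨⟨m, n, rfl⟩, hx⟩
      have := closure_cell_subset hx
      simp at this
      refine ⟨(m, n), ⟨⟨?_, ?_⟩, ⟨?_, ?_⟩⟩, rfl⟩
      · exact_mod_cast this.1.1
      · exact_mod_cast this.1.2
      · exact_mod_cast this.2.1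
      · exact_mod_cast this.2.2
    exact (((finite_Icc _ _).prod (finite_Icc _ _)).image _).subset h2
  refine (h1.toFinset.powerset.finite_toSet).subset fun T hT => ?_
  simp only [Finset.coe_powerset, mem_preimage, mem_powerset_iff, Finite.coe_toFinset]
  exact fun x hx => ⟨M.vertices_mem T hT hx, M.subset_cell T hT (subset_convexHull _ _ hx)⟩

lemma atoms_finite : M.atoms.Finite := by
  have h2 : lattice ∩ cell N ⊆
      (fun p : ℤ × ℤ => (p.1 : ℝ) • a1 + (p.2 : ℝ) • a2) '' (Icc 0 (N : ℤ) ×ˢ Icc 0 (N : ℤ)) := by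
    rintro x ⟨⟨m, n, rfl⟩, hx⟩
    have := closure_cell_subset (subset_closure hx)
    simp at this
    refine ⟨(m, n), ⟨⟨?_, ?_⟩, ⟨?_, ?_⟩⟩, rfl⟩
    · exact_mod_cast this.1.1
    · exact_mod_cast this.1.2
    · exact_mod_cast this.2.1
    · exact_mod_cast this.2.2
  exact ((((finite_Icc _ _).prod (finite_Icc _ _)).image _).subset h2).subset sdiff_subset

lemma isClosed_hullUnion {S : Set (Finset Plane)} (hS : S.Finite) : IsClosed (hullUnion S) :=
  hS.isClosed_biUnion fun T _ => (isCompact_hull T).isClosed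

lemma contRegion_subset : M.contRegion ⊆ hullUnion (M.elems \ M.atomElems) := by
  rintro x ⟨hx, -⟩
  refine closure_minimal ?_ (isClosed_hullUnion (finite_elems.subset sdiff_subset)) hx
  rintro y ⟨hy, hy'⟩
  obtain ⟨T, hT, hyT⟩ := mem_iUnion₂.1 (M.covers (subset_closure hy))
  exact mem_iUnion₂.2 ⟨T, ⟨hT, fun h => hy' (mem_iUnion₂.2 ⟨T, h, hyT⟩)⟩, hyT⟩

lemma contRegionPer_subset : M.contRegionPer ⊆ hullUnion M.contElemsPer := by
  rintro x ⟨a, ha, z, hz, rfl⟩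
  obtain ⟨T, hT, hxT⟩ := mem_iUnion₂.1 (contRegion_subset ha)
  refine mem_iUnion₂.2 ⟨translate ((N : ℝ) • z) T, ⟨T, hT, z, hz, rfl⟩, ?_⟩
  rw [mem_convexHull_translate]; simpa using hxT

/-- The interior of the periodic continuum region. -/
def contInterior (M : Mesh N) : Set Plane := interior M.contRegionPer

lemma isOpen_contInterior : IsOpen M.contInterior := isOpen_interior

lemma translate_mem_contInterior {x z : Plane} (hz : z ∈ lattice) (hx : x ∈ M.contInterior) :
    x + (N : ℝ) • z ∈ M.contInterior := by
  have h1 : (Homeomorph.addRight ((N : ℝ) • z)) ⁻¹' M.contRegionPer = M.contRegionPer := by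
    ext y
    simp only [mem_preimage, Homeomorph.coe_addRight]
    exact translate_mem_periodic_iff hz
  have h2 := (Homeomorph.addRight ((N : ℝ) • z)).preimage_interior M.contRegionPer
  rw [h1] at h2
  unfold contInterior at *
  rw [← h2] at hx
  exact hx

/-- Suppose a translate of an atomistic `T0` contains `x`. After translating back, points near `x`
are interior to `T0` and lie in the continuum region. Such a point is in the cell, hence in the
closure of the cell minus the atomistic region, although a neighbourhood of it lies in `T0`. -/
lemma mem_contElemsPer_of_mem_contInterior (hN : 0 < N) {x : Plane} (hx : x ∈ M.contInterior)
    {T : Finset Plane} (hT : T ∈ M.elemsPer) (hxT : x ∈ convexHull ℝ (T : Set Plane)) :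
    T ∈ M.contElemsPer := by
  rcases elemsPer_cases hT with h | ⟨T0, hT0, z, hz, rfl⟩
  · exact h
  exfalso
  rw [mem_convexHull_translate] at hxT
  have hx' := translate_mem_contInterior (neg_mem_lattice hz) hx
  rw [smul_neg, ← sub_eq_add_neg] at hx'
  rw [← convex_closure_interior_convexHull (M.card_eq T0 (M.atomElems_subset hT0))
    (M.nondegenerate T0 (M.atomElems_subset hT0))] at hxT
  obtain ⟨u, huU, huT⟩ := mem_closure_iff.1 hxT _ isOpen_contInterior hx'
  obtain ⟨a, ⟨ha, hac⟩, w, hw, hu⟩ := interior_subset huU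
  have hsub : convexHull ℝ (T0 : Set Plane) ⊆ M.atomRegion :=
    fun y hy => mem_iUnion₂.2 ⟨T0, hT0, hy⟩
  have huc : u ∈ cell N := interior_subset (M.atomistic_subset (hsub (interior_subset huT)))
  have hw0 : w = 0 := eq_zero_of_translate_mem_cell hN hw hac (hu ▸ huc)
  have hua : u = a := by simp [hu, hw0]
  subst hua
  obtain ⟨v, hv, hv'⟩ := mem_closure_iff.1 ha _ isOpen_interior huT
  exact hv'.2 (hsub (interior_subset hv))

/-- The vertices of the continuum mesh are atoms. -/
lemma contElemsPer_subset_atomsPer (hN : 0 < N) {T : Finset Plane} (hT : T ∈ M.contElemsPer) :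
    (T : Set Plane) ⊆ M.atomsPer := by
  obtain ⟨T0, hT0, z, hz, rfl⟩ := hT
  intro p hp
  have hp0 : p - (N : ℝ) • z ∈ T0 := mem_translate.1 hp
  obtain ⟨w, hw, hc⟩ := exists_translate_mem_cell hN (p - (N : ℝ) • z)
  set c := p - (N : ℝ) • z + (N : ℝ) • w with hcdef
  have hcl : c ∈ lattice := add_mem_lattice (M.vertices_mem T0 hT0.1 hp0) (nsmul_mem_lattice N hw)
  refine ⟨c, ⟨⟨hcl, hc⟩, fun hv => ?_⟩, z - w, sub_mem_lattice hz hw, by rw [hcdef]; module⟩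
  have h1 := M.vac_subset_interior hv
  have h2 : c ∈ interior (cell N) := M.atomistic_subset (interior_subset h1)
  have h3 := eq_zero_of_translate_mem_closure_cell hN (neg_mem_lattice hw) h2
    (by rw [hcdef, smul_neg, add_neg_cancel_right]
        exact M.subset_cell T0 hT0.1 (subset_convexHull _ _ hp0))
  have hw0 : w = 0 := by simpa using h3
  have hcp : c = p - (N : ℝ) • z := by simp [hcdef, hw0]
  rw [← hcp] at hp0
  have h4 : c ∈ closure (interior (convexHull ℝ (T0 : Set Plane))) := by
    rw [convex_closure_interior_convexHull (M.card_eq T0 hT0.1) (M.nondegenerate T0 hT0.1)]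
    exact subset_convexHull _ _ hp0
  obtain ⟨u, hu⟩ := mem_closure_iff.1 h4 _ isOpen_interior h1
  -- A vacancy at a vertex of `T0` is interior to the atomistic region; so are some interior points
  -- of `T0`, which makes `T0` atomistic.
  exact hT0.2 (mem_of_isOpen_subset (S := M.atomElems) (fun T hT => atomElem_mem_elemsPer hT)
    (subset_periodicFamily hT0.1) (isOpen_interior.inter isOpen_interior) ⟨u, hu⟩
    (fun y hy => interior_subset hy.2) (fun y hy => interior_subset hy.1))

end Mesh

/-! ### Counting elements -/

/-- The number of elements meeting a ball of given radius is bounded in terms of the shape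
regularity only. -/
lemma exists_elems_ball_bound {κ : ℝ} (hκ : 0 < κ) (hκ1 : κ ≤ 1) (R : ℝ) :
    ∃ C : ℕ, ∀ (N : ℕ) (M : Mesh N), (∀ T ∈ M.elems, Fat κ T) → ∀ c : Plane,
      {T | T ∈ M.elemsPer ∧ (convexHull ℝ (T : Set Plane) ∩ Metric.closedBall c R).Nonempty}.encard
        ≤ C := by
  obtain ⟨C, hC⟩ := exists_packing_bound (volume (Metric.closedBall (0 : Plane) (R + 1)))
    (ENNReal.ofReal (κ ^ 4) * unitArea) (measure_closedBall_lt_top.ne)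
    (mul_ne_zero (by simp; positivity) unitArea_pos.ne')
  refine ⟨C, fun N M hF c => ?_⟩
  classical
  have key : ∀ T ∈ {T | T ∈ M.elemsPer ∧
      (convexHull ℝ (T : Set Plane) ∩ Metric.closedBall c R).Nonempty},
      ∃ A : Set Plane, A ⊆ convexHull ℝ (T : Set Plane) ∧ A ⊆ Metric.closedBall c (R + 1) ∧
        NullMeasurableSet A ∧ ENNReal.ofReal (κ ^ 4) * unitArea ≤ volume A := by
    rintro T ⟨hT, z, hzT, hzc⟩
    obtain ⟨p, q, r, hpq, hpr, hqr, rfl⟩ := Finset.card_eq_three.1 (Mesh.elemsPer_card hT)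
    have hfat := Mesh.fat_elemsPer hF hT
    have hlat := Mesh.elemsPer_subset_lattice hT
    simp only [Finset.coe_insert, Finset.coe_singleton] at hzT hlat ⊢
    set e := ‖p - q‖ with he
    have he1 : 1 ≤ e := by
      rw [he, ← dist_eq_norm]
      exact one_le_dist_of_mem_lattice (hlat (by simp)) (hlat (by simp)) hpq
    have epr : κ * ‖p - r‖ ≤ e :=
      hfat.norm_le (by simp) (by simp) (by simp) hpr hqr.symm hpq
    have eqr : κ * ‖q - r‖ ≤ e := by
      have := hfat.norm_le (p := q) (q := r) (r := p) (by simp) (by simp) (by simp) hqr hpr.symm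
        hpq.symm
      rwa [norm_sub_rev q p] at this
    have epr' : κ * e ≤ ‖p - r‖ :=
      hfat.norm_le (by simp) (by simp) (by simp) hpq hqr hpr
    -- Large elements are counted through a piece of fixed size: shrinking by `κ / e` towards the
    -- point `z` in the ball brings the element within distance 1 of `z`, and its area, at least `κ
    -- ^ 2 * e ^ 2 * unitArea`, becomes at least `κ ^ 4 * unitArea`.
    set lam := κ / e with hlam
    have hlam0 : 0 < lam := by positivity
    have hlam1 : lam ≤ 1 := by rw [hlam, div_le_one (by linarith)]; linarith
    have hdiam : ∀ x ∈ convexHull ℝ ({p, q, r} : Set Plane), dist x z ≤ e / κ := by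
      intro x hx
      obtain ⟨x', hx', z', hz', hd⟩ := convexHull_exists_dist_ge2 hx hzT
      refine hd.trans ?_
      rw [le_div_iff₀ hκ, mul_comm, dist_eq_norm]
      have e1 : κ * e ≤ e := mul_le_of_le_one_left (by linarith) hκ1
      simp only [mem_insert_iff, mem_singleton_iff] at hx' hz'
      rcases hx' with rfl | rfl | rfl <;> rcases hz' with rfl | rfl | rfl <;>
        first
        | (simp only [sub_self, norm_zero, mul_zero]; linarith)
        | assumption
        | (rw [norm_sub_rev]; assumption)
    refine ⟨AffineMap.homothety z lam '' convexHull ℝ ({p, q, r} : Set Plane), ?_, ?_, ?_, ?_⟩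
    · rintro _ ⟨x, hx, rfl⟩
      rw [AffineMap.homothety_apply, vsub_eq_sub, vadd_eq_add, add_comm]
      exact (convex_convexHull ℝ _).add_smul_sub_mem hzT hx ⟨hlam0.le, hlam1⟩
    · rintro _ ⟨x, hx, rfl⟩
      rw [Metric.mem_closedBall]
      have h1 : dist (AffineMap.homothety z lam x) z ≤ 1 := by
        rw [AffineMap.homothety_apply, vsub_eq_sub, vadd_eq_add, dist_eq_norm, add_sub_cancel_right,
          norm_smul, Real.norm_of_nonneg hlam0.le, ← dist_eq_norm]
        calc lam * dist x z ≤ lam * (e / κ) := by gcongr; exact hdiam x hx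
          _ = 1 := by rw [hlam]; field_simp
      linarith [dist_triangle (AffineMap.homothety z lam x) z c, Metric.mem_closedBall.1 hzc]
    · apply Convex.nullMeasurableSet
      exact (convex_convexHull ℝ _).affine_image _
    · rw [Measure.addHaar_image_homothety, finrank_euclideanSpace_fin]
      refine le_trans ?_ (mul_le_mul_right (volume_triangle_ge p q r) _)
      rw [← mul_assoc, ← ENNReal.ofReal_mul (abs_nonneg _)]
      gcongr
      have h1 : κ * (e * ‖p - r‖) ≤ |det2 (q - p) (r - p)| := by
        have := hfat q (by simp) p (by simp) r (by simp) hpq.symm hpr hqr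
        rwa [norm_sub_rev q p, norm_sub_rev r p] at this
      rw [abs_of_nonneg (by positivity : (0 : ℝ) ≤ lam ^ 2)]
      calc κ ^ 4 = lam ^ 2 * (κ * (e * (κ * e))) := by rw [hlam]; field_simp
        _ ≤ lam ^ 2 * (κ * (e * ‖p - r‖)) := by gcongr
        _ ≤ lam ^ 2 * |det2 (q - p) (r - p)| := by gcongr
  choose! A hA1 hA2 hA3 hA4 using key
  refine hC _ A (Metric.closedBall c (R + 1)) ?_ hA2 hA4 hA3 ?_
  · rw [Measure.addHaar_closedBall_center]
  · intro T hT T' hT' hne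
    exact measure_mono_null (inter_subset_inter (hA1 T hT) (hA1 T' hT'))
      (Mesh.volume_inter_eq_zero hT.1 hT'.1 hne)

/-! ### Piecewise affine functions -/

lemma barycentre_mem_interior {T : Finset Plane} (hc : T.card = 3)
    (ha : AffineIndependent ℝ ((↑) : T → Plane)) :
    (3 : ℝ)⁻¹ • ∑ q ∈ T, q ∈ interior (convexHull ℝ (T : Set Plane)) := by
  have h1 : affineSpan ℝ (range ((↑) : T → Plane)) = ⊤ :=
    ha.affineSpan_eq_top_iff_card_eq_finrank_add_one.2 (by simp [hc])
  let b : AffineBasis T ℝ Plane := ⟨(↑), ha, h1⟩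
  have h2 := b.centroid_mem_interior_convexHull
  have hb : ⇑b = ((↑) : T → Plane) := rfl
  have hne : T.Nonempty := by rw [← Finset.card_pos, hc]; norm_num
  have : Nonempty T := hne.to_subtype
  rw [Finset.centroid_eq_centerMass _ Finset.univ_nonempty, hb, Subtype.range_coe] at h2
  convert! h2 using 1
  rw [Finset.centerMass_eq_of_sum_1]
  · simp [Finset.centroidWeights_apply, hc, Finset.smul_sum]
    exact (Finset.sum_coe_sort T (fun i => (3 : ℝ)⁻¹ • i)).symm
  · exact Finset.sum_centroidWeights_eq_one_of_nonempty ℝ _ Finset.univ_nonempty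

lemma gradOn_eq {T : Finset Plane} (hc : T.card = 3)
    (ha : AffineIndependent ℝ ((↑) : T → Plane)) {y : Plane → Plane} {A : Plane →ᵃ[ℝ] Plane}
    (hA : ∀ x ∈ convexHull ℝ (T : Set Plane), y x = A x) :
    gradOn T y = A.linear.toContinuousLinearMap := by
  have h1 : y =ᶠ[nhds ((3 : ℝ)⁻¹ • ∑ q ∈ T, q)] A := by
    filter_upwards [isOpen_interior.mem_nhds (barycentre_mem_interior hc ha)] with x hx
    exact hA x (interior_subset hx)
  rw [gradOn, h1.fderiv_eq]
  have h2 : ⇑A = fun x => A.linear.toContinuousLinearMap x + A 0 := by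
    funext x
    have := A.map_vadd 0 x
    simpa using this
  rw [h2, fderiv_add_const]
  exact ContinuousLinearMap.fderiv _

/-- The Frobenius norm dominates the operator norm. -/
lemma enorm_apply_sq_le (G : Plane →L[ℝ] Plane) (r : Plane) :
    ‖G r‖ₑ ^ 2 ≤ ‖r‖ₑ ^ 2 * frobSq G := by
  have h1 : r = r 0 • EuclideanSpace.single (0 : Fin 2) (1 : ℝ) +
      r 1 • EuclideanSpace.single (1 : Fin 2) (1 : ℝ) := by
    ext i; fin_cases i <;> simp
  set u := G (EuclideanSpace.single (0 : Fin 2) (1 : ℝ)) with hu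
  set v := G (EuclideanSpace.single (1 : Fin 2) (1 : ℝ)) with hv
  have h2 : G r = r 0 • u + r 1 • v := by
    conv_lhs => rw [h1]
    rw [map_add, map_smul, map_smul]
  have h3 : ‖G r‖ ≤ |r 0| * ‖u‖ + |r 1| * ‖v‖ := by
    rw [h2]
    refine (norm_add_le _ _).trans ?_
    rw [norm_smul, norm_smul, Real.norm_eq_abs, Real.norm_eq_abs]
  have h4 : ‖r‖ ^ 2 = r 0 ^ 2 + r 1 ^ 2 := by
    rw [EuclideanSpace.norm_sq_eq]; simp [Fin.sum_univ_two]
  have h5 : ‖G r‖ ^ 2 ≤ ‖r‖ ^ 2 * (‖u‖ ^ 2 + ‖v‖ ^ 2) := by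
    rw [h4, ← sq_abs (r 0), ← sq_abs (r 1)]
    have h6 : ‖G r‖ ^ 2 ≤ (|r 0| * ‖u‖ + |r 1| * ‖v‖) ^ 2 := by gcongr
    nlinarith [sq_nonneg (|r 0| * ‖v‖ - |r 1| * ‖u‖)]
  have h7 := ENNReal.ofReal_le_ofReal h5
  rw [ENNReal.ofReal_mul (by positivity), ENNReal.ofReal_add (by positivity) (by positivity),
    ENNReal.ofReal_pow (norm_nonneg _), ENNReal.ofReal_pow (norm_nonneg _),
    ENNReal.ofReal_pow (norm_nonneg _), ENNReal.ofReal_pow (norm_nonneg _)] at h7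
  simpa [frobSq, Fin.sum_univ_two] using h7

namespace Mesh

variable {N : ℕ} {M : Mesh N}

/-- A map which is affine on every element of the continuum mesh. -/
def IsPA (M : Mesh N) (y : Plane → Plane) : Prop :=
  ∀ T ∈ M.contElemsPer, ∃ A : Plane →ᵃ[ℝ] Plane,
    ∀ x ∈ convexHull ℝ (T : Set Plane), y x = A x

lemma IsPA.sub_eq {y : Plane → Plane} (hy : M.IsPA y) {T : Finset Plane}
    (hT : T ∈ M.contElemsPer) {x x' : Plane} (hx : x ∈ convexHull ℝ (T : Set Plane))
    (hx' : x' ∈ convexHull ℝ (T : Set Plane)) : y x' - y x = gradOn T y (x' - x) := by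
  obtain ⟨A, hA⟩ := hy T hT
  rw [gradOn_eq (elemsPer_card (contElemsPer_subset hT))
    (elemsPer_affineIndependent (contElemsPer_subset hT)) hA, hA x hx, hA x' hx']
  simpa using (A.linearMap_vsub x' x).symm

lemma IsPA.continuousOn_hull {y : Plane → Plane} (hy : M.IsPA y) {T : Finset Plane}
    (hT : T ∈ M.contElemsPer) : ContinuousOn y (convexHull ℝ (T : Set Plane)) := by
  obtain ⟨A, hA⟩ := hy T hT
  exact (A.continuous_of_finiteDimensional.continuousOn).congr hA

/-- A map which is piecewise affine on the periodic continuum mesh and which is periodic relative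
to the linear map `B`. -/
structure PeriodicPA (M : Mesh N) (B : Plane →L[ℝ] Plane) (y : Plane → Plane) : Prop where
  pa : M.IsPA y
  per : ∀ x ∈ hullUnion M.contElemsPer, ∀ z ∈ lattice,
    y (x + (N : ℝ) • z) = y x + B ((N : ℝ) • z)

lemma PeriodicPA.gradOn_translate {B : Plane →L[ℝ] Plane} {y : Plane → Plane}
    (hy : M.PeriodicPA B y) {T : Finset Plane} (hT : T ∈ M.contElemsPer) {z : Plane}
    (hz : z ∈ lattice) : gradOn (translate ((N : ℝ) • z) T) y = gradOn T y := by
  have hc := elemsPer_card (contElemsPer_subset hT)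
  have hmem := barycentre_mem_interior hc (elemsPer_affineIndependent (contElemsPer_subset hT))
  have h1 : (3 : ℝ)⁻¹ • ∑ q ∈ translate ((N : ℝ) • z) T, q =
      (3 : ℝ)⁻¹ • ∑ q ∈ T, q + (N : ℝ) • z := by
    simp only [translate, Finset.sum_map, addRightEmbedding_apply, Finset.sum_add_distrib,
      Finset.sum_const, hc, smul_add]
    congr 1
    rw [← Nat.cast_smul_eq_nsmul ℝ, smul_smul]
    norm_num
  have h2 : (fun x => y (x + (N : ℝ) • z)) =ᶠ[nhds ((3 : ℝ)⁻¹ • ∑ q ∈ T, q)]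
      fun x => y x + B ((N : ℝ) • z) := by
    filter_upwards [isOpen_interior.mem_nhds hmem] with x hx
    exact hy.per x (mem_iUnion₂.2 ⟨T, hT, interior_subset hx⟩) z hz
  have h3 := h2.fderiv_eq (𝕜 := ℝ)
  rw [fderiv_comp_add_right, fderiv_add_const] at h3
  rw [gradOn, gradOn, h1, h3]

/-! ### Local finiteness -/

lemma finite_elems_ball {κ : ℝ} (hκ : 0 < κ) (hκ1 : κ ≤ 1) (hF : ∀ T ∈ M.elems, Fat κ T)
    (c : Plane) (R : ℝ) :
    {T | T ∈ M.elemsPer ∧ (convexHull ℝ (T : Set Plane) ∩ Metric.closedBall c R).Nonempty}.Finite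
      := by
  obtain ⟨C, hC⟩ := exists_elems_ball_bound hκ hκ1 R
  exact Set.finite_of_encard_le_coe (hC N M hF c)

/-- The closed elements form a locally finite family by the counting bound. No matching condition
appears, because a single function is affine on each closed element. -/
lemma IsPA.continuousOn {y : Plane → Plane} (hy : M.IsPA y) {κ : ℝ} (hκ : 0 < κ) (hκ1 : κ ≤ 1)
    (hF : ∀ T ∈ M.elems, Fat κ T) : ContinuousOn y (hullUnion M.contElemsPer) := by
  have h1 : hullUnion M.contElemsPer =
      ⋃ T : M.contElemsPer, convexHull ℝ ((T : Finset Plane) : Set Plane) := by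
    rw [hullUnion, biUnion_eq_iUnion]
  rw [h1]
  apply LocallyFinite.continuousOn_iUnion
  · intro x
    refine ⟨Metric.closedBall x 1, Metric.closedBall_mem_nhds x one_pos, ?_⟩
    have h2 := finite_elems_ball hκ hκ1 hF x 1
    refine (h2.preimage (Subtype.coe_injective.injOn (s := univ) |>.mono (subset_univ _)) :
      ((↑) ⁻¹' _ : Set M.contElemsPer).Finite).subset ?_
    intro T hT
    exact ⟨contElemsPer_subset T.2, hT⟩
  · exact fun T => (isCompact_hull _).isClosed
  · exact fun T => hy.continuousOn_hull T.2

/-- A ray starts off inside some element. -/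
lemma exists_elem_ray (hN : 0 < N) {κ : ℝ} (hκ : 0 < κ) (hκ1 : κ ≤ 1)
    (hF : ∀ T ∈ M.elems, Fat κ T) (z r : Plane) :
    ∃ T ∈ M.elemsPer, ∃ δ > (0 : ℝ), ∀ ε ∈ Icc 0 δ, z + ε • r ∈ convexHull ℝ (T : Set Plane) := by
  have hfin := finite_elems_ball hκ hκ1 hF z 1
  have hcont : Filter.Tendsto (fun ε : ℝ => z + ε • r) (nhdsWithin 0 (Ioi 0)) (nhds z) := by
    have : Continuous (fun ε : ℝ => z + ε • r) := by fun_prop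
    have h := this.tendsto 0
    simp only [zero_smul, add_zero] at h
    exact h.mono_left nhdsWithin_le_nhds
  -- Finitely many elements come near `z`, so one of them contains points of the ray arbitrarily
  -- close to `z`; being closed and convex, it contains an initial piece of the ray.
  have h1 : ∃ T ∈ {T | T ∈ M.elemsPer ∧
      (convexHull ℝ (T : Set Plane) ∩ Metric.closedBall z 1).Nonempty},
      ∃ᶠ ε in nhdsWithin (0 : ℝ) (Ioi 0), z + ε • r ∈ convexHull ℝ (T : Set Plane) := by
    by_contra hcon
    push Not at hcon
    have h2 := (Filter.eventually_all_finite hfin).2 hcon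
    have h3 := hcont.eventually (Metric.closedBall_mem_nhds z one_pos)
    obtain ⟨ε, h4, h5⟩ := (h2.and h3).exists
    obtain ⟨T, hT, hεT⟩ := exists_mem_elemsPer (M := M) hN (z + ε • r)
    exact h4 T ⟨hT, _, hεT, h5⟩ hεT
  obtain ⟨T, ⟨hT, -⟩, hfr⟩ := h1
  have hz : z ∈ convexHull ℝ (T : Set Plane) :=
    (isCompact_hull T).isClosed.mem_of_frequently_of_tendsto hfr hcont
  obtain ⟨δ, h4, h5⟩ := (hfr.and_eventually self_mem_nhdsWithin).exists
  have hδ : 0 < δ := h5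
  refine ⟨T, hT, δ, hδ, fun ε hε => ?_⟩
  have h6 := (convex_convexHull ℝ (T : Set Plane)).add_smul_mem hz h4
    (t := ε / δ) ⟨div_nonneg hε.1 hδ.le, (div_le_one hδ).2 hε.2⟩
  rwa [smul_smul, div_mul_cancel₀ _ hδ.ne'] at h6

/-! ### Edges -/

/-- Here `p`, `q` are coordinates of the endpoints of an edge in the closed cell, and `k` moves the
midpoint into the half-open interval. The shift is 0 or 1, and it is 1 only for `p = q = 0`, when
the edge lies on the lower side and is moved to the upper one. -/
lemma Ioc_combination {p q a b L : ℝ} {k : ℤ} (hp : p ∈ Icc 0 L) (hq : q ∈ Icc 0 L)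
    (hm : (p + q) / 2 + L * k ∈ Ioc 0 L) (ha : 0 < a) (hb : 0 < b) (hab : a + b = 1) :
    a * p + b * q + L * k ∈ Ioc 0 L := by
  have hL : 0 < L := hm.1.trans_le hm.2
  have hk1 : -1 < (k : ℝ) := by
    by_contra hcon
    push Not at hcon
    nlinarith [hm.1, hp.2, hq.2]
  have hk2 : (k : ℝ) < 2 := by
    by_contra hcon
    push Not at hcon
    nlinarith [hm.2, hp.1, hq.1]
  have hk1' : -1 < k := by exact_mod_cast hk1
  have hk2' : k < 2 := by exact_mod_cast hk2
  have hk : k = 0 ∨ k = 1 := by omega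
  rcases hk with rfl | rfl
  · simp only [Int.cast_zero, mul_zero, add_zero] at hm ⊢
    constructor
    · rcases hp.1.lt_or_eq with h | h
      · nlinarith [hq.1, mul_pos ha h, mul_nonneg hb.le hq.1]
      · have : 0 < q := by linarith [hm.1]
        nlinarith [mul_pos hb this, mul_nonneg ha.le hp.1]
    · nlinarith [mul_le_mul_of_nonneg_left hp.2 ha.le, mul_le_mul_of_nonneg_left hq.2 hb.le]
  · simp only [Int.cast_one, mul_one] at hm ⊢
    have h1 : p = 0 := by linarith [hm.2, hp.1, hq.1]
    have h2 : q = 0 := by linarith [hm.2, hp.1, hq.1]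
    subst h1 h2
    simp [hL]

/-- The translation that brings the midpoint of the edge into the half-open cell brings its whole
relative interior there. The translate is not inside the atomistic region, since it contains a point
of the continuum interior. -/
lemma exists_mem_contEdges_translate (hN : 0 < N) {f T : Finset Plane} (hf : f.card = 2)
    (hT : T ∈ M.elemsPer) (hfT : f ⊆ T) {x : Plane} (hx : x ∈ convexHull ℝ (f : Set Plane))
    (hxU : x ∈ M.contInterior) : ∃ z ∈ lattice, translate ((N : ℝ) • z) f ∈ M.contEdges := by
  obtain ⟨T0, hT0, z0, hz0, rfl⟩ := hT
  obtain ⟨p, q, hpq, rfl⟩ := Finset.card_eq_two.1 hf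
  have hp := mem_translate.1 (hfT (Finset.mem_insert_self p {q}))
  have hq := mem_translate.1 (hfT (Finset.mem_insert_of_mem (Finset.mem_singleton_self q)))
  have hpc := closure_cell_subset (M.subset_cell T0 hT0 (subset_convexHull _ _ hp))
  have hqc := closure_cell_subset (M.subset_cell T0 hT0 (subset_convexHull _ _ hq))
  set p' := p - (N : ℝ) • z0 with hp'
  set q' := q - (N : ℝ) • z0 with hq'
  obtain ⟨z1, hz1, hc⟩ := exists_translate_mem_cell hN ((1 / 2 : ℝ) • (p' + q'))
  have hz : z1 - z0 ∈ lattice := sub_mem_lattice hz1 hz0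
  have hcell : ∀ a b : ℝ, 0 < a → 0 < b → a + b = 1 →
      a • p' + b • q' + (N : ℝ) • z1 ∈ cell N := by
    intro a b ha hb hab
    obtain ⟨m, n, hm, hn⟩ := mem_lattice_iff.1 hz1
    rw [mem_cell_iff] at hc ⊢
    simp only [map_add, map_smul, smul_eq_mul, hm, hn] at hc ⊢
    exact ⟨Ioc_combination hpc.1 hqc.1 (by convert! hc.1 using 1; ring) ha hb hab,
      Ioc_combination hpc.2 hqc.2 (by convert! hc.2 using 1; ring) ha hb hab⟩
  refine ⟨z1 - z0, hz, by rw [card_translate]; exact hf, ⟨translate ((N : ℝ) • (z1 - z0)) (translate ((N : ℝ) • z0) T0),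
    translate_mem_periodicFamily ⟨T0, hT0, z0, hz0, rfl⟩ hz, fun v hv => ?_⟩, ?_, ?_⟩
  · rw [mem_translate] at hv ⊢
    exact hfT hv
  · have hshift : ∀ w, w - (N : ℝ) • (z1 - z0) = p → w = p' + (N : ℝ) • z1 := by
      intro w hw; rw [hp', ← hw]; module
    have hshift' : ∀ w, w - (N : ℝ) • (z1 - z0) = q → w = q' + (N : ℝ) • z1 := by
      intro w hw; rw [hq', ← hw]; module
    intro v hv w hw hvw
    rw [mem_translate, Finset.mem_insert, Finset.mem_singleton] at hv hw
    rintro u ⟨a, b, ha, hb, hab, rfl⟩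
    rcases hv with hv | hv <;> rcases hw with hw | hw
    · exact absurd ((hshift v hv).trans (hshift w hw).symm) hvw
    · rw [hshift v hv, hshift' w hw]
      convert! hcell a b ha hb hab using 1
      obtain rfl : b = 1 - a := by linarith
      module
    · rw [hshift' v hv, hshift w hw]
      convert! hcell b a hb ha (by linarith) using 1
      obtain rfl : b = 1 - a := by linarith
      module
    · exact absurd ((hshift' v hv).trans (hshift' w hw).symm) hvw
  · intro hsub
    have h1 : x + (N : ℝ) • (z1 - z0) ∈
        convexHull ℝ ((translate ((N : ℝ) • (z1 - z0)) {p, q} : Finset Plane) : Set Plane) := by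
      rw [mem_convexHull_translate, add_sub_cancel_right]; exact hx
    obtain ⟨T', hT', hxT'⟩ := mem_iUnion₂.1 (hsub h1)
    exact atomElem_not_mem_contElemsPer hN hT' (mem_contElemsPer_of_mem_contInterior hN
      (translate_mem_contInterior hz hxU) (atomElem_mem_elemsPer hT') hxT')

/-- If `T` were a translate of an atomistic element, the midpoint of `f`, which lies in the cell,
would force the translation to vanish, and then `f` would lie in the atomistic region. -/
lemma mem_contElemsPer_of_contEdges (hN : 0 < N) {f T : Finset Plane} (hf : f ∈ M.contEdges)
    (hT : T ∈ M.elemsPer) (hfT : f ⊆ T) : T ∈ M.contElemsPer := by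
  rcases elemsPer_cases hT with h | ⟨T0, hT0, z, hz, rfl⟩
  · exact h
  exfalso
  obtain ⟨hc, -, hcell, hnot⟩ := hf
  obtain ⟨p, q, hpq, rfl⟩ := Finset.card_eq_two.1 hc
  have hsub : convexHull ℝ (T0 : Set Plane) ⊆ M.atomRegion :=
    fun y hy => mem_iUnion₂.2 ⟨T0, hT0, hy⟩
  have hm : (1 / 2 : ℝ) • p + (1 / 2 : ℝ) • q ∈ openSegment ℝ p q :=
    ⟨1 / 2, 1 / 2, by norm_num, by norm_num, by norm_num, rfl⟩
  have hmc := hcell p (by simp) q (by simp) hpq hm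
  have hp : p ∈ convexHull ℝ ((translate ((N : ℝ) • z) T0 : Finset Plane) : Set Plane) :=
    subset_convexHull _ _ (hfT (by simp))
  have hq : q ∈ convexHull ℝ ((translate ((N : ℝ) • z) T0 : Finset Plane) : Set Plane) :=
    subset_convexHull _ _ (hfT (by simp))
  have hmT := (convex_convexHull ℝ _).segment_subset hp hq (openSegment_subset_segment ℝ p q hm)
  rw [mem_convexHull_translate] at hmT
  have h1 := interior_subset (M.atomistic_subset (hsub hmT))
  have hz0 := eq_zero_of_translate_mem_cell hN (neg_mem_lattice hz) hmc
    (by rw [smul_neg, ← sub_eq_add_neg]; exact h1)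
  have hz0' : z = 0 := by simpa using hz0
  subst hz0'
  simp only [smul_zero, translate_zero] at hfT
  exact hnot ((convexHull_mono hfT).trans hsub)

end Mesh

/-! ### Variation of the gradient along a bond. -/

/-- A path, unlike a walk, visits each vertex at most once, so its total weight is at most the sum
of all weights, whatever its length. -/
lemma edist_le_tsum_of_reachable {V : Type} (G : SimpleGraph V) (g : V → Plane) (w : V → ℝ≥0∞)
    (h : ∀ u v, G.Adj u v → edist (g u) (g v) ≤ w u) {u v : V} (huv : G.Reachable u v) :
    edist (g u) (g v) ≤ ∑' x, w x := by
  classical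
  obtain ⟨p, hp⟩ := huv.exists_isPath
  have h1 : ∀ {a b : V} (q : G.Walk a b), edist (g a) (g b) ≤ (q.support.map w).sum := by
    intro a b q
    induction q with
    | nil => simp
    | cons hadj q ih =>
      rw [SimpleGraph.Walk.support_cons, List.map_cons, List.sum_cons]
      exact (edist_triangle _ _ _).trans (add_le_add (h _ _ hadj) ih)
  refine (h1 p).trans ?_
  rw [← List.sum_toFinset _ hp.support_nodup]
  exact ENNReal.sum_le_tsum _

namespace Mesh

variable {N : ℕ} {M : Mesh N}

/-- The edges of the periodic mesh which meet a given set. -/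
def edgesMeeting (M : Mesh N) (S : Set Plane) : Set (Finset Plane) :=
  {f | f.card = 2 ∧ (∃ T ∈ M.elemsPer, f ⊆ T) ∧ (convexHull ℝ (f : Set Plane) ∩ S).Nonempty}

/-- The elements of the periodic mesh which meet a given set. -/
def elemsMeeting (M : Mesh N) (S : Set Plane) : Set (Finset Plane) :=
  {T | T ∈ M.elemsPer ∧ (convexHull ℝ (T : Set Plane) ∩ S).Nonempty}

/-- The jump of the derivative in direction `r` across the edge `f`, up to the angle between `r`
and the normal. -/
noncomputable def dirJump (M : Mesh N) (y : Plane → Plane) (r : Plane) (f : Finset Plane) :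
    ℝ≥0∞ := ‖r‖ₑ * M.jumpSq y f ^ (1 / 2 : ℝ)

lemma edist_grad_le_dirJump (y : Plane → Plane) (r : Plane) {f T T' : Finset Plane}
    (hT : T ∈ M.elemsPer) (hT' : T' ∈ M.elemsPer) (hf : f ⊆ T) (hf' : f ⊆ T') :
    edist (gradOn T y r) (gradOn T' y r) ≤ M.dirJump y r f := by
  have h1 : frobSq (gradOn T y - gradOn T' y) ≤ M.jumpSq y f :=
    le_iSup₂_of_le T hT (le_iSup₂_of_le T' hT' (le_iSup_of_le ⟨hf, hf'⟩ le_rfl))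
  have h2 := (enorm_apply_sq_le (gradOn T y - gradOn T' y) r).trans (mul_le_mul_right h1 _)
  have h3 := ENNReal.rpow_le_rpow h2 (z := 1 / 2) (by norm_num)
  rw [ENNReal.mul_rpow_of_nonneg _ _ (by norm_num), ← ENNReal.rpow_natCast,
    ← ENNReal.rpow_natCast, ← ENNReal.rpow_mul, ← ENNReal.rpow_mul] at h3
  norm_num at h3
  rw [edist_eq_enorm_sub]
  simpa [dirJump] using h3

/-- Elements meeting `S` are adjacent if they share an edge meeting `S`. -/
def adjacency (M : Mesh N) (S : Set Plane) : SimpleGraph (M.elemsMeeting S) where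
  Adj T T' := T ≠ T' ∧ ∃ f ∈ M.edgesMeeting S, f ⊆ T.1 ∧ f ⊆ T'.1
  symm := ⟨fun _ _ ⟨h, f, hf, h1, h2⟩ => ⟨h.symm, f, hf, h2, h1⟩⟩
  loopless := ⟨fun _ h => h.1 rfl⟩

/-- Otherwise the elements reachable from `T₁` and the remaining ones cover `S` by two closed sets,
and connectedness yields a point of `S` in one element of either kind. These two elements meet in a
common face; it is not a single vertex, as `S` avoids the lattice, so it is an edge meeting `S` and
makes them adjacent. -/
lemma adjacency_reachable (hN : 0 < N) {κ : ℝ} (hκ : 0 < κ) (hκ1 : κ ≤ 1)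
    (hF : ∀ T ∈ M.elems, Fat κ T) {S : Set Plane}
    (hS : IsCompact S) (hconn : IsPreconnected S) (hlat : Disjoint S lattice)
    {T₁ T₂ : Finset Plane} (h₁ : T₁ ∈ M.elemsMeeting S) (h₂ : T₂ ∈ M.elemsMeeting S) :
    (M.adjacency S).Reachable ⟨T₁, h₁⟩ ⟨T₂, h₂⟩ := by
  classical
  by_contra hnot
  obtain ⟨R, hR⟩ := hS.isBounded.subset_closedBall 0
  have hfin : (M.elemsMeeting S).Finite := by
    refine (finite_elems_ball hκ hκ1 hF 0 R).subset ?_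
    rintro T ⟨hT, x, hx, hxS⟩
    exact ⟨hT, x, hx, hR hxS⟩
  have : Finite (M.elemsMeeting S) := hfin
  let C : Set Plane := ⋃ T : {T // (M.adjacency S).Reachable ⟨T₁, h₁⟩ T}, convexHull ℝ (T.1.1 : Set Plane)
  let C' : Set Plane := ⋃ T : {T // ¬ (M.adjacency S).Reachable ⟨T₁, h₁⟩ T}, convexHull ℝ (T.1.1 : Set Plane)
  have hC : IsClosed C := isClosed_iUnion_of_finite fun T => (isCompact_hull _).isClosed
  have hC' : IsClosed C' := isClosed_iUnion_of_finite fun T => (isCompact_hull _).isClosed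
  have hcov : S ⊆ C ∪ C' := by
    intro x hx
    obtain ⟨T, hT, hxT⟩ := exists_mem_elemsPer (M := M) hN x
    have hTm : T ∈ M.elemsMeeting S := ⟨hT, x, hxT, hx⟩
    by_cases h : (M.adjacency S).Reachable ⟨T₁, h₁⟩ ⟨T, hTm⟩
    · exact Or.inl (mem_iUnion.2 ⟨⟨⟨T, hTm⟩, h⟩, hxT⟩)
    · exact Or.inr (mem_iUnion.2 ⟨⟨⟨T, hTm⟩, h⟩, hxT⟩)
  obtain ⟨x₁, hx₁, hxS₁⟩ := h₁.2
  obtain ⟨x₂, hx₂, hxS₂⟩ := h₂.2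
  obtain ⟨z, hzS, hz, hz'⟩ := isPreconnected_closed_iff.1 hconn C C' hC hC' hcov
    ⟨x₁, hxS₁, mem_iUnion.2 ⟨⟨⟨T₁, h₁⟩, SimpleGraph.Reachable.refl _⟩, hx₁⟩⟩
    ⟨x₂, hxS₂, mem_iUnion.2 ⟨⟨⟨T₂, h₂⟩, hnot⟩, hx₂⟩⟩
  obtain ⟨⟨⟨T, hT⟩, hTr⟩, hzT⟩ := mem_iUnion.1 hz
  obtain ⟨⟨⟨T', hT'⟩, hTr'⟩, hzT'⟩ := mem_iUnion.1 hz'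
  have hne : T ≠ T' := by
    rintro rfl; exact hTr' hTr
  have hmem : z ∈ convexHull ℝ ((T ∩ T' : Finset Plane) : Set Plane) := by
    rw [Finset.coe_inter, ← M.regular T hT.1 T' hT'.1]
    exact ⟨hzT, hzT'⟩
  have hcT := elemsPer_card hT.1
  have hcT' := elemsPer_card hT'.1
  have hlt : (T ∩ T').card < 3 := by
    by_contra hc
    push Not at hc
    have h3 : T ∩ T' = T := Finset.eq_of_subset_of_card_le Finset.inter_subset_left (by omega)
    have h4 : T ∩ T' = T' := Finset.eq_of_subset_of_card_le Finset.inter_subset_right (by omega)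
    exact hne (h3.symm.trans h4)
  have hcases : (T ∩ T').card = 0 ∨ (T ∩ T').card = 1 ∨ (T ∩ T').card = 2 := by omega
  rcases hcases with h | h | h
  · rw [Finset.card_eq_zero] at h
    simp [h] at hmem
  · obtain ⟨v, hv⟩ := Finset.card_eq_one.1 h
    rw [hv] at hmem
    simp at hmem
    have hvT : v ∈ T := Finset.inter_subset_left (hv ▸ Finset.mem_singleton_self v)
    exact hlat.notMem_of_mem_left hzS (hmem ▸ elemsPer_subset_lattice hT.1 hvT)
  · apply hTr'
    refine hTr.trans (SimpleGraph.Adj.reachable ?_)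
    exact ⟨fun h => hne (congrArg Subtype.val h), T ∩ T',
      ⟨h, ⟨T, hT.1, Finset.inter_subset_left⟩, z, hmem, hzS⟩, Finset.inter_subset_left,
      Finset.inter_subset_right⟩

/-- Each step of a path is charged to the element that it leaves, whose weight is the sum of the
jumps over all its edges that meet `S`. -/
lemma edist_grad_le_tsum (hN : 0 < N) {κ : ℝ} (hκ : 0 < κ) (hκ1 : κ ≤ 1)
    (hF : ∀ T ∈ M.elems, Fat κ T) (y : Plane → Plane) (r : Plane) {S : Set Plane}
    (hS : IsCompact S) (hconn : IsPreconnected S) (hlat : Disjoint S lattice)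
    {T₁ T₂ : Finset Plane} (h₁ : T₁ ∈ M.elemsMeeting S) (h₂ : T₂ ∈ M.elemsMeeting S) :
    edist (gradOn T₁ y r) (gradOn T₂ y r) ≤
      ∑' T : M.elemsMeeting S, ∑' f : M.edgesMeeting S,
        {f | f ⊆ T.1}.indicator (M.dirJump y r) f := by
  have h := edist_le_tsum_of_reachable (M.adjacency S) (fun T => gradOn T.1 y r)
    (fun T => ∑' f : M.edgesMeeting S, {f | f ⊆ T.1}.indicator (M.dirJump y r) f) ?_
    (adjacency_reachable hN hκ hκ1 hF hS hconn hlat h₁ h₂)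
  · refine le_trans (le_of_eq ?_) (h.trans (le_of_eq ?_))
    · rfl
    · exact tsum_congr fun T => tsum_congr fun f => rfl
  intro T T' hadj
  obtain ⟨f, hf, hfT, hfT'⟩ := hadj.2
  refine (edist_grad_le_dirJump y r T.2.1 T'.2.1 hfT hfT').trans ?_
  refine le_trans (le_of_eq ?_) (ENNReal.le_tsum (⟨f, hf⟩ : M.edgesMeeting S))
  exact (indicator_of_mem (show f ∈ {f | f ⊆ T.1} from hfT) _).symm

/-- After exchanging the sums, each edge counts once for every element containing it, and all of
these meet the ball about one vertex of the edge. -/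
lemma tsum_tsum_dirJump_le {C : ℕ} (hC : ∀ c : Plane,
      {T | T ∈ M.elemsPer ∧ (convexHull ℝ (T : Set Plane) ∩ Metric.closedBall c 2).Nonempty}.encard
        ≤ C) (y : Plane → Plane) (r : Plane) (S : Set Plane) :
    ∑' T : M.elemsMeeting S, ∑' f : M.edgesMeeting S,
        {f | f ⊆ T.1}.indicator (M.dirJump y r) f ≤
      C * ∑' f : M.edgesMeeting S, M.dirJump y r f := by
  rw [ENNReal.tsum_comm, ← ENNReal.tsum_mul_left]
  refine ENNReal.tsum_le_tsum fun f => ?_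
  obtain ⟨f, hf⟩ := f
  obtain ⟨p, hp⟩ : f.Nonempty := by rw [← Finset.card_pos, hf.1]; norm_num
  simp only
  calc ∑' T : M.elemsMeeting S, {f | f ⊆ T.1}.indicator (M.dirJump y r) f
      = ∑' T : M.elemsMeeting S, {T | f ⊆ T}.indicator (fun _ => M.dirJump y r f) T.1 := by
        refine tsum_congr fun T => ?_
        by_cases h : f ⊆ T.1
        · rw [indicator_of_mem (show f ∈ {f | f ⊆ T.1} from h),
            indicator_of_mem (show T.1 ∈ {T | f ⊆ T} from h)]
        · rw [indicator_of_notMem (show f ∉ {f | f ⊆ T.1} from h),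
            indicator_of_notMem (show T.1 ∉ {T | f ⊆ T} from h)]
    _ = ∑' T, (M.elemsMeeting S).indicator
          ({T | f ⊆ T}.indicator (fun _ => M.dirJump y r f)) T := tsum_subtype _ _
    _ ≤ ∑' T, {T | T ∈ M.elemsPer ∧
          (convexHull ℝ (T : Set Plane) ∩ Metric.closedBall p 2).Nonempty}.indicator
            (fun _ => M.dirJump y r f) T := by
        refine ENNReal.tsum_le_tsum fun T => ?_
        by_cases h1 : T ∈ M.elemsMeeting S
        · by_cases h2 : f ⊆ T
          · rw [indicator_of_mem h1, indicator_of_mem (show T ∈ {T | f ⊆ T} from h2),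
              indicator_of_mem]
            exact ⟨h1.1, p, subset_convexHull _ _ (h2 hp), by simp⟩
          · rw [indicator_of_mem h1, indicator_of_notMem (show T ∉ {T | f ⊆ T} from h2)]
            exact zero_le
        · rw [indicator_of_notMem h1]; exact zero_le
    _ = _ := (tsum_subtype _ _).symm
    _ ≤ C * M.dirJump y r f := by
        rw [ENNReal.tsum_set_const]
        gcongr
        exact_mod_cast hC p

/-- A neighbourhood of the segment from `x` to `x + r`, made up of balls. -/
noncomputable def tube (x r : Plane) : Set Plane :=
  ⋃ k ∈ Finset.range (⌈‖r‖⌉₊ + 1), Metric.closedBall (x + ((k : ℝ) / ⌈‖r‖⌉₊) • r) 2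

/-- The radius 2 allows 1 for the spacing of the centres along the bond and 1 for the displacement
`w`. -/
lemma mem_tube {x r w : Plane} {t : ℝ} (ht : t ∈ Icc (0 : ℝ) 1) (hr : r ≠ 0) (hw : ‖w‖ ≤ 1) :
    x + w + t • r ∈ tube x r := by
  set n := ⌈‖r‖⌉₊ with hn
  have hr0 : 0 < ‖r‖ := norm_pos_iff.2 hr
  have hn0 : 0 < n := Nat.ceil_pos.2 hr0
  have hn0' : (0 : ℝ) < n := by exact_mod_cast hn0
  have hrn : ‖r‖ ≤ n := Nat.le_ceil _
  set k := ⌊t * n⌋₊ with hk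
  have h1 : (k : ℝ) ≤ t * n := Nat.floor_le (by have := ht.1; positivity)
  have h2 : t * n < k + 1 := Nat.lt_floor_add_one _
  have hkn : k ≤ n := by
    have : (k : ℝ) ≤ n := h1.trans (mul_le_of_le_one_left hn0'.le ht.2)
    exact_mod_cast this
  refine mem_iUnion₂.2 ⟨k, Finset.mem_range.2 (by omega), ?_⟩
  rw [Metric.mem_closedBall, dist_eq_norm,
    show x + w + t • r - (x + ((k : ℝ) / n) • r) = w + (t - k / n) • r by module]
  refine (norm_add_le _ _).trans ?_
  have h3 : ‖(t - k / n) • r‖ ≤ 1 := by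
    rw [norm_smul, Real.norm_eq_abs, abs_of_nonneg (by rw [sub_nonneg, div_le_iff₀ hn0']; exact h1)]
    have h4 : (t - k / n) * n ≤ 1 := by
      rw [sub_mul, div_mul_cancel₀ _ hn0'.ne']; linarith
    have h5 : 0 ≤ t - k / n := by rw [sub_nonneg, div_le_iff₀ hn0']; exact h1
    exact (mul_le_mul_of_nonneg_left hrn h5).trans h4
  linarith

/-- The edges which a bond and its small translates may cross. -/
def bondEdges (M : Mesh N) (x r : Plane) : Set (Finset Plane) :=
  M.edgesMeeting (M.contInterior ∩ tube x r)

/-- An initial piece of the ray stays in one element, where `y` is affine. Only the one-sided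
derivative exists in general, since `z` may lie on an edge. -/
lemma hasDerivWithinAt_ray (hN : 0 < N) {κ : ℝ} (hκ : 0 < κ) (hκ1 : κ ≤ 1)
    (hF : ∀ T ∈ M.elems, Fat κ T) {y : Plane → Plane} (hy : M.IsPA y) {z : Plane}
    (hz : z ∈ M.contInterior) (r : Plane) :
    ∃ T ∈ M.contElemsPer, z ∈ convexHull ℝ (T : Set Plane) ∧
      (∃ δ > 0, ∀ ε ∈ Icc (0 : ℝ) δ, z + ε • r ∈ convexHull ℝ (T : Set Plane) ∧
        y (z + ε • r) - y z = ε • gradOn T y r) ∧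
      HasDerivWithinAt (fun t : ℝ => y (z + t • r)) (gradOn T y r) (Ici 0) 0 := by
  obtain ⟨T, hT, δ, hδ, h⟩ := exists_elem_ray hN hκ hκ1 hF z r
  have hzT : z ∈ convexHull ℝ (T : Set Plane) := by simpa using h 0 ⟨le_rfl, hδ.le⟩
  have hTc := mem_contElemsPer_of_mem_contInterior hN hz hT hzT
  have h2 : ∀ ε ∈ Icc (0 : ℝ) δ, y (z + ε • r) - y z = ε • gradOn T y r := by
    intro ε hε
    rw [hy.sub_eq hTc hzT (h ε hε), add_sub_cancel_left, map_smul]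
  refine ⟨T, hTc, hzT, ⟨δ, hδ, fun ε hε => ⟨h ε hε, h2 ε hε⟩⟩, ?_⟩
  have h3 : HasDerivWithinAt (fun t : ℝ => y z + t • gradOn T y r) (gradOn T y r) (Ici 0) 0 := by
    have := ((hasDerivAt_id (0 : ℝ)).smul_const (gradOn T y r)).const_add (y z)
    simpa using this.hasDerivWithinAt
  refine h3.congr_of_eventuallyEq ?_ (by simp)
  filter_upwards [inter_mem_nhdsWithin (Ici (0 : ℝ)) (Iio_mem_nhds hδ)] with t ht
  rw [← h2 t ⟨ht.1, le_of_lt ht.2⟩]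
  abel

/-- This is the mean value inequality for right derivatives, applied to `y (x + u • r) - u • g`. The
hypothesis ranges over all elements containing a point of the segment because the one that supplies
the right derivative is not known. -/
lemma norm_slope_sub_le (hN : 0 < N) {κ : ℝ} (hκ : 0 < κ) (hκ1 : κ ≤ 1)
    (hF : ∀ T ∈ M.elems, Fat κ T) {y : Plane → Plane} (hy : M.IsPA y) {x r : Plane}
    (hU : ∀ t ∈ Icc (0 : ℝ) 1, x + t • r ∈ M.contInterior) (g : Plane) {K : ℝ}
    (hK : ∀ t ∈ Ico (0 : ℝ) 1, ∀ T ∈ M.contElemsPer, x + t • r ∈ convexHull ℝ (T : Set Plane) →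
      ‖gradOn T y r - g‖ ≤ K) {s t : ℝ} (hs : 0 ≤ s) (hst : s ≤ t) (ht : t ≤ 1) :
    ‖y (x + t • r) - y (x + s • r) - (t - s) • g‖ ≤ K * (t - s) := by
  have hc : ContinuousOn (fun u : ℝ => y (x + u • r) - u • g) (Icc s t) := by
    refine ContinuousOn.sub ?_ (by fun_prop)
    refine (hy.continuousOn hκ hκ1 hF).comp (by fun_prop) fun u hu => ?_
    exact contRegionPer_subset (interior_subset (hU u ⟨hs.trans hu.1, hu.2.trans ht⟩))
  have hd : ∀ u ∈ Ico s t, ∃ v, HasDerivWithinAt (fun u : ℝ => y (x + u • r) - u • g) v (Ici u) u ∧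
      ‖v‖ ≤ K := by
    intro u hu
    have hu1 : u ∈ Ico (0 : ℝ) 1 := ⟨hs.trans hu.1, hu.2.trans_le ht⟩
    obtain ⟨T, hT, hxT, -, hder⟩ :=
      hasDerivWithinAt_ray hN hκ hκ1 hF hy (hU u ⟨hu1.1, hu1.2.le⟩) r
    refine ⟨gradOn T y r - g, ?_, hK u hu1 T hT hxT⟩
    have h1 : HasDerivWithinAt (fun w : ℝ => w - u) 1 (Ici u) u :=
      ((hasDerivAt_id u).sub_const u).hasDerivWithinAt
    have hder' : HasDerivWithinAt (fun t : ℝ => y (x + u • r + t • r)) (gradOn T y r) (Ici 0)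
        (u - u) := by rw [sub_self]; exact hder
    have h2 := HasDerivWithinAt.scomp (h := fun w : ℝ => w - u) u hder' h1
      (fun w hw => by simpa using hw)
    rw [one_smul] at h2
    have h3 : ((fun t : ℝ => y (x + u • r + t • r)) ∘ fun w : ℝ => w - u) =
        fun w => y (x + w • r) := by
      funext w; simp only [Function.comp]; congr 1; module
    rw [h3] at h2
    have h4 : HasDerivWithinAt (fun w : ℝ => w • g) g (Ici u) u := by
      simpa using ((hasDerivAt_id u).smul_const g).hasDerivWithinAt
    exact h2.sub h4
  choose! v hv hvK using hd
  have := norm_image_sub_le_of_norm_deriv_right_le_segment hc hv hvK t ⟨hst, le_rfl⟩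
  convert! this using 2
  module

/-- A bound for the variation of the directional derivative along a bond. -/
noncomputable def bondVar (M : Mesh N) (C : ℕ) (y : Plane → Plane) (x r : Plane) : ℝ≥0∞ :=
  C * ∑' f : M.bondEdges x r, M.dirJump y r f

/-- The area form with `r` eliminates `t` and recovers the shift from the lattice point that is hit.
-/
lemma countable_lattice_shifts (x : Plane) {r v : Plane} (hv : det2 r v ≠ 0) :
    {ε : ℝ | ∃ t : ℝ, x + ε • v + t • r ∈ lattice}.Countable := by
  refine (lattice_countable.image (fun l => det2 r (l - x) / det2 r v)).mono ?_
  rintro ε ⟨t, ht⟩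
  refine ⟨_, ht, ?_⟩
  simp only
  rw [show x + ε • v + t • r - x = ε • v + t • r by abel, det2_add_right, det2_smul_right,
    det2_smul_right, det2_self]
  field_simp
  ring

lemma eventually_shift_mem {U : Set Plane} (hU : IsOpen U) {x r : Plane} (v : Plane)
    (h : ∀ t ∈ Icc (0 : ℝ) 1, x + t • r ∈ U) :
    ∀ᶠ ε in nhds (0 : ℝ), ∀ t ∈ Icc (0 : ℝ) 1, x + ε • v + t • r ∈ U := by
  have hc : IsCompact ((fun t : ℝ => x + t • r) '' Icc (0 : ℝ) 1) :=
    isCompact_Icc.image (by fun_prop)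
  obtain ⟨δ, hδ, hsub⟩ := hc.exists_cthickening_subset_open hU
    (by rintro _ ⟨t, ht, rfl⟩; exact h t ht)
  have h1 : Filter.Tendsto (fun ε : ℝ => ‖ε • v‖) (nhds 0) (nhds 0) := by
    have : Continuous (fun ε : ℝ => ‖ε • v‖) := by fun_prop
    simpa using this.tendsto 0
  filter_upwards [h1.eventually_lt_const hδ] with ε hε t ht
  apply hsub
  refine Metric.mem_cthickening_of_dist_le _ (x + t • r) δ _ ⟨t, ht, rfl⟩ ?_
  rw [dist_eq_norm, show x + ε • v + t • r - (x + t • r) = ε • v by abel]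
  exact hε.le

/-- A shifted bond avoids all vertices, so the directional derivatives on any two elements that it
meets differ by at most the bond variation; the mean value inequality converts this into a statement
about slopes. -/
lemma norm_slope_shift_le (hN : 0 < N) {κ : ℝ} (hκ : 0 < κ) (hκ1 : κ ≤ 1)
    (hF : ∀ T ∈ M.elems, Fat κ T) {C : ℕ} (hC : ∀ c : Plane,
      {T | T ∈ M.elemsPer ∧ (convexHull ℝ (T : Set Plane) ∩ Metric.closedBall c 2).Nonempty}.encard
        ≤ C) {y : Plane → Plane} (hy : M.IsPA y) {x w r : Plane} (hr : r ≠ 0) (hw : ‖w‖ ≤ 1)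
    (hU : ∀ t ∈ Icc (0 : ℝ) 1, x + w + t • r ∈ M.contInterior)
    (hlat : ∀ t : ℝ, x + w + t • r ∉ lattice) (hK : M.bondVar C y x r ≠ ⊤)
    {s t : ℝ} (hs : 0 ≤ s) (hst : s ≤ t) (ht : t ≤ 1) :
    ‖y (x + w + t • r) - y (x + w + s • r) - (t - s) • (y (x + w + r) - y (x + w))‖ ≤
      (M.bondVar C y x r).toReal * (t - s) := by
  set S := (fun t : ℝ => x + w + t • r) '' Icc (0 : ℝ) 1 with hSdef
  have hS : IsCompact S := isCompact_Icc.image (by fun_prop)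
  have hconn : IsPreconnected S := isPreconnected_Icc.image _ (by fun_prop)
  have hdisj : Disjoint S lattice := by
    rw [Set.disjoint_left]
    rintro _ ⟨t, -, rfl⟩
    exact hlat t
  have hSsub : S ⊆ M.contInterior ∩ tube x r := by
    rintro _ ⟨t, ht, rfl⟩
    exact ⟨hU t ht, mem_tube ht hr hw⟩
  have hedges : M.edgesMeeting S ⊆ M.bondEdges x r := fun f hf =>
    ⟨hf.1, hf.2.1, hf.2.2.mono (inter_subset_inter_right _ hSsub)⟩
  have key : ∀ T₁ ∈ M.elemsMeeting S, ∀ T₂ ∈ M.elemsMeeting S,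
      ‖gradOn T₁ y r - gradOn T₂ y r‖ ≤ (M.bondVar C y x r).toReal := by
    intro T₁ h₁ T₂ h₂
    have h1 := (edist_grad_le_tsum hN hκ hκ1 hF y r hS hconn hdisj h₁ h₂).trans
      (tsum_tsum_dirJump_le hC y r S)
    have h2 : edist (gradOn T₁ y r) (gradOn T₂ y r) ≤ M.bondVar C y x r :=
      h1.trans (mul_le_mul_right (ENNReal.tsum_mono_subtype _ hedges) _)
    rw [← dist_eq_norm, dist_edist]
    exact ENNReal.toReal_mono hK h2
  have hmem : ∀ t ∈ Ico (0 : ℝ) 1, ∀ T ∈ M.contElemsPer,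
      x + w + t • r ∈ convexHull ℝ (T : Set Plane) → T ∈ M.elemsMeeting S :=
    fun t ht T hT hx => ⟨contElemsPer_subset hT, _, hx, t, ⟨ht.1, ht.2.le⟩, rfl⟩
  refine norm_slope_sub_le hN hκ hκ1 hF hy hU _ ?_ hs hst ht
  intro t ht T hT hxT
  -- The mean value inequality is used twice: here with one gradient as reference, which compares it
  -- with the total increment, and in the goal with the total increment as reference.
  have h3 := norm_slope_sub_le hN hκ hκ1 hF hy hU (gradOn T y r)
    (fun t' ht' T' hT' hx' => key T' (hmem t' ht' T' hT' hx') T (hmem t ht T hT hxT))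
    le_rfl zero_le_one le_rfl
  rw [norm_sub_rev]
  simpa using h3

/-- The bond itself may pass through vertices or along edges, so it is approximated by shifts in the
normal direction. All but countably many shifts avoid the lattice, and the bound does not depend on
the shift since the tube accounts for displacements up to 1. Slopes are estimated rather than
gradients because they pass to the limit by continuity of `y`. -/
lemma enorm_slope_le (hN : 0 < N) {κ : ℝ} (hκ : 0 < κ) (hκ1 : κ ≤ 1)
    (hF : ∀ T ∈ M.elems, Fat κ T) {C : ℕ} (hC : ∀ c : Plane,
      {T | T ∈ M.elemsPer ∧ (convexHull ℝ (T : Set Plane) ∩ Metric.closedBall c 2).Nonempty}.encard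
        ≤ C) {y : Plane → Plane} (hy : M.IsPA y) {x r : Plane} (hr : r ≠ 0)
    (hU : ∀ t ∈ Icc (0 : ℝ) 1, x + t • r ∈ M.contInterior) (hK : M.bondVar C y x r ≠ ⊤)
    {s t : ℝ} (hs : 0 ≤ s) (hst : s ≤ t) (ht : t ≤ 1) :
    ‖y (x + t • r) - y (x + s • r) - (t - s) • (y (x + r) - y x)‖ ≤
      (M.bondVar C y x r).toReal * (t - s) := by
  set v : Plane := !₂[-(r 1), r 0] with hv
  have hdet : det2 r v ≠ 0 := by
    have h1 : det2 r v = ‖r‖ ^ 2 := by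
      rw [EuclideanSpace.norm_sq_eq]
      simp [det2, hv, Fin.sum_univ_two]
      ring
    rw [h1]
    have := norm_pos_iff.2 hr
    positivity
  have hfreq : ∃ᶠ ε in nhds (0 : ℝ), ε ∈ {ε : ℝ | ∃ t : ℝ, x + ε • v + t • r ∈ lattice}ᶜ :=
    mem_closure_iff_frequently.1 (((countable_lattice_shifts x hdet).dense_compl ℝ) 0)
  have h1 : ∀ᶠ ε in nhds (0 : ℝ), ‖ε • v‖ ≤ 1 := by
    have : Continuous (fun ε : ℝ => ‖ε • v‖) := by fun_prop
    have h := this.tendsto 0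
    simp only [zero_smul, norm_zero] at h
    filter_upwards [h.eventually_lt_const one_pos] with ε hε using hε.le
  have h2 := eventually_shift_mem isOpen_contInterior v hU
  have hcont : ∀ u ∈ Icc (0 : ℝ) 1,
      Filter.Tendsto (fun ε : ℝ => y (x + ε • v + u • r)) (nhds 0) (nhds (y (x + u • r))) := by
    intro u hu
    have h3 : ContinuousAt y (x + u • r) :=
      ((hy.continuousOn hκ hκ1 hF).mono (interior_subset.trans contRegionPer_subset)).continuousAt
        (isOpen_contInterior.mem_nhds (hU u hu))
    have h4 : Filter.Tendsto (fun ε : ℝ => x + ε • v + u • r) (nhds 0) (nhds (x + u • r)) := by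
      have : Continuous (fun ε : ℝ => x + ε • v + u • r) := by fun_prop
      simpa using this.tendsto 0
    exact h3.tendsto.comp h4
  have c0 := hcont 0 ⟨le_rfl, zero_le_one⟩
  have c1 := hcont 1 ⟨zero_le_one, le_rfl⟩
  simp only [zero_smul, add_zero, one_smul] at c0 c1
  have hlim := (((hcont t ⟨hs.trans hst, ht⟩).sub (hcont s ⟨hs, hst.trans ht⟩)).sub
    ((c1.sub c0).const_smul (t - s))).norm
  refine le_of_tendsto_of_frequently hlim ?_
  refine (hfreq.and_eventually (h1.and h2)).mono ?_
  rintro ε ⟨hε, hε1, hε2⟩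
  exact norm_slope_shift_le hN hκ hκ1 hF hC hy hr hε1 hε2 (fun t ht => hε ⟨t, ht⟩) hK hs hst ht

/-! ### Cardinality estimates -/

/-- Distances between distinct lattice points are at least one, which turns the ball counts below
into multiples of lengths. -/
lemma natCeil_add_one_le {a : ℝ} (ha : 1 ≤ a) : ((⌈a⌉₊ + 1 : ℕ) : ℝ) ≤ 3 * a := by
  have := Nat.ceil_lt_add_one (by linarith : 0 ≤ a)
  push_cast
  linarith

lemma edgesMeeting_closedBall_encard_le {C : ℕ} (hC : ∀ c : Plane,
      {T | T ∈ M.elemsPer ∧ (convexHull ℝ (T : Set Plane) ∩ Metric.closedBall c 2).Nonempty}.encard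
        ≤ C) (c : Plane) :
    (M.edgesMeeting (Metric.closedBall c 2)).encard ≤ (3 * C : ℕ) := by
  classical
  set E := {T | T ∈ M.elemsPer ∧
    (convexHull ℝ (T : Set Plane) ∩ Metric.closedBall c 2).Nonempty} with hE
  have hfin : E.Finite := Set.finite_of_encard_le_coe (hC c)
  have hsub : M.edgesMeeting (Metric.closedBall c 2) ⊆
      (hfin.toFinset.biUnion fun T => T.powersetCard 2 : Finset (Finset Plane)) := by
    rintro f ⟨hf, ⟨T, hT, hfT⟩, hne⟩
    simp only [Finset.coe_biUnion, mem_iUnion]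
    refine ⟨T, ?_, ?_⟩
    · simp only [Finite.coe_toFinset]
      exact ⟨hT, hne.mono (inter_subset_inter_left _ (convexHull_mono hfT))⟩
    · simp [Finset.mem_powersetCard, hfT, hf]
  refine (encard_le_encard hsub).trans ?_
  rw [Set.encard_coe_eq_coe_finsetCard]
  norm_cast
  refine Finset.card_biUnion_le.trans ?_
  have h1 : ∀ T ∈ hfin.toFinset, (T.powersetCard 2).card = 3 := by
    intro T hT
    rw [Finset.card_powersetCard, elemsPer_card ((hfin.mem_toFinset.1 hT).1)]
    rfl
  rw [Finset.sum_congr rfl h1, Finset.sum_const, smul_eq_mul, mul_comm]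
  have h2 : hfin.toFinset.card ≤ C := by
    have := hC c
    rw [← hE, hfin.encard_eq_coe_toFinset_card] at this
    exact_mod_cast this
  omega

lemma bondEdges_encard_le {C : ℕ} (hC : ∀ c : Plane,
      {T | T ∈ M.elemsPer ∧ (convexHull ℝ (T : Set Plane) ∩ Metric.closedBall c 2).Nonempty}.encard
        ≤ C) (x r : Plane) :
    (M.bondEdges x r).encard ≤ ((⌈‖r‖⌉₊ + 1) * (3 * C) : ℕ) := by
  have hsub : M.bondEdges x r ⊆ ⋃ k ∈ Finset.range (⌈‖r‖⌉₊ + 1),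
      M.edgesMeeting (Metric.closedBall (x + ((k : ℝ) / ⌈‖r‖⌉₊) • r) 2) := by
    rintro f ⟨hf, hT, z, hz, -, hzt⟩
    obtain ⟨k, hk, hzk⟩ := mem_iUnion₂.1 hzt
    exact mem_iUnion₂.2 ⟨k, hk, hf, hT, z, hz, hzk⟩
  refine (encard_le_encard hsub).trans ((Finset.set_encard_biUnion_le _ _).trans ?_)
  refine (Finset.sum_le_sum fun k _ => edgesMeeting_closedBall_encard_le hC _).trans ?_
  rw [Finset.sum_const, Finset.card_range, nsmul_eq_mul]
  norm_cast

/-- The number of lattice points from which a given edge is seen in direction `r`. -/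
lemma lattice_tube_encard_le {K : ℕ}
    (hK : ∀ c : Plane, (lattice ∩ Metric.closedBall c 3).encard ≤ K) (p q r : Plane) (hpq : p ≠ q) :
    {x | x ∈ lattice ∧ (segment ℝ p q ∩ tube x r).Nonempty}.encard ≤
      ((⌈‖r‖⌉₊ + 1) * ((⌈‖q - p‖⌉₊ + 1) * K) : ℕ) := by
  set m := ⌈‖q - p‖⌉₊ with hm
  have hm0 : 0 < ‖q - p‖ := norm_pos_iff.2 (sub_ne_zero.2 hpq.symm)
  have hm1 : (0 : ℝ) < m := by exact_mod_cast Nat.ceil_pos.2 hm0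
  have hm2 : ‖q - p‖ ≤ m := Nat.le_ceil _
  -- Both the edge and the bond direction are discretised with steps of length at most 1; the radius
  -- 3 is the tube radius 2 plus one step along the edge.
  have hsub : {x | x ∈ lattice ∧ (segment ℝ p q ∩ tube x r).Nonempty} ⊆
      ⋃ k ∈ Finset.range (⌈‖r‖⌉₊ + 1), ⋃ j ∈ Finset.range (m + 1),
        lattice ∩ Metric.closedBall (p + ((j : ℝ) / m) • (q - p) - ((k : ℝ) / ⌈‖r‖⌉₊) • r) 3 := by
    rintro x ⟨hx, z, hz, hzt⟩
    obtain ⟨k, hk, hzk⟩ := mem_iUnion₂.1 hzt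
    rw [segment_eq_image'] at hz
    obtain ⟨t, ht, rfl⟩ := hz
    set j := ⌊t * m⌋₊ with hj
    have h1 : (j : ℝ) ≤ t * m := Nat.floor_le (by have := ht.1; positivity)
    have h2 : t * m < j + 1 := Nat.lt_floor_add_one _
    have hjm : j ≤ m := by
      have : (j : ℝ) ≤ m := h1.trans (mul_le_of_le_one_left hm1.le ht.2)
      exact_mod_cast this
    refine mem_iUnion₂.2 ⟨k, hk, mem_iUnion₂.2 ⟨j, Finset.mem_range.2 (by omega), hx, ?_⟩⟩
    rw [Metric.mem_closedBall, dist_eq_norm] at hzk ⊢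
    have h3 : ‖(t - j / m) • (q - p)‖ ≤ 1 := by
      have h5 : 0 ≤ t - j / m := by rw [sub_nonneg, div_le_iff₀ hm1]; exact h1
      rw [norm_smul, Real.norm_of_nonneg h5]
      have h4 : (t - j / m) * m ≤ 1 := by
        rw [sub_mul, div_mul_cancel₀ _ hm1.ne']; linarith
      exact (mul_le_mul_of_nonneg_left hm2 h5).trans h4
    have h6 : x - (p + ((j : ℝ) / m) • (q - p) - ((k : ℝ) / ⌈‖r‖⌉₊) • r) =
        (t - j / m) • (q - p) - (p + t • (q - p) - (x + ((k : ℝ) / ⌈‖r‖⌉₊) • r)) := by module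
    rw [h6]
    refine (norm_sub_le _ _).trans ?_
    linarith
  refine (encard_le_encard hsub).trans ((Finset.set_encard_biUnion_le _ _).trans ?_)
  refine (Finset.sum_le_sum fun k _ => (Finset.set_encard_biUnion_le _ _).trans
    (Finset.sum_le_sum fun j _ => hK _)).trans ?_
  simp only [Finset.sum_const, Finset.card_range, nsmul_eq_mul]
  norm_cast

lemma tsum_sq_le {α : Type} {s : Set α} {n : ℕ} (hs : s.encard ≤ n) (a : α → ℝ≥0∞) :
    (∑' x : s, a x) ^ 2 ≤ n * ∑' x : s, a x ^ 2 := by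
  have hfin : s.Finite := Set.finite_of_encard_le_coe hs
  have : Fintype s := hfin.fintype
  rw [tsum_fintype, tsum_fintype]
  have h := ENNReal.rpow_sum_le_const_mul_sum_rpow (Finset.univ : Finset s) (fun x => a x)
    (p := 2) (by norm_num)
  norm_num at h
  refine h.trans ?_
  gcongr
  rw [← hfin.cast_ncard_eq] at hs
  exact_mod_cast hs

end Mesh

/-! ### Radial potentials -/

variable {ϕ : ℝ → ℝ}

lemma radial_hasFDerivAt (h : ContDiffOn ℝ 2 ϕ (Ioi 0)) {x : Plane} (hx : x ≠ 0) :
    HasFDerivAt (radial ϕ) ((deriv ϕ ‖x‖ / ‖x‖) • innerSL ℝ x) x := by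
  have hn : 0 < ‖x‖ := norm_pos_iff.2 hx
  have h1 : HasDerivAt ϕ (deriv ϕ ‖x‖) ‖x‖ :=
    ((h.contDiffAt (Ioi_mem_nhds hn)).differentiableAt (by norm_num)).hasDerivAt
  have h2 : HasFDerivAt (fun x : Plane => ‖x‖) (‖x‖⁻¹ • innerSL ℝ x) x := by
    have h3 := (hasStrictFDerivAt_norm_sq x).hasFDerivAt.sqrt (by positivity)
    simp only [Real.sqrt_sq (norm_nonneg _)] at h3
    convert! h3 using 1
    ext v
    simp
    field_simp
  convert! h1.comp_hasFDerivAt x h2 using 1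
  rw [smul_smul, div_eq_mul_inv]

lemma radial_fderiv_eventuallyEq (h : ContDiffOn ℝ 2 ϕ (Ioi 0)) {x : Plane} (hx : x ≠ 0) :
    fderiv ℝ (radial ϕ) =ᶠ[nhds x] fun z => (deriv ϕ ‖z‖ / ‖z‖) • innerSL ℝ z := by
  filter_upwards [isOpen_ne.mem_nhds hx] with z hz
  exact (radial_hasFDerivAt h hz).fderiv

lemma radial_contDiffAt (h : ContDiffOn ℝ 2 ϕ (Ioi 0)) {x : Plane} (hx : x ≠ 0) :
    ContDiffAt ℝ 2 (radial ϕ) x :=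
  (h.contDiffAt (Ioi_mem_nhds (norm_pos_iff.2 hx))).comp x (contDiffAt_norm ℝ hx)

lemma norm_second_deriv_le {s m : ℝ} (hm : decayM ϕ 2 s ≤ ENNReal.ofReal m) (hm0 : 0 ≤ m)
    {x : Plane} (hx : s ≤ ‖x‖) : ‖fderiv ℝ (fderiv ℝ (radial ϕ)) x‖ ≤ m := by
  have h1 : ‖iteratedFDeriv ℝ 2 (radial ϕ) x‖ₑ ≤ ENNReal.ofReal m :=
    (le_iSup₂ (f := fun (r : Plane) (_ : s ≤ ‖r‖) => ‖iteratedFDeriv ℝ 2 (radial ϕ) r‖ₑ) x hx).trans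
      hm
  rw [← ofReal_norm, ENNReal.ofReal_le_ofReal_iff hm0] at h1
  rwa [← norm_iteratedFDeriv_fderiv, norm_iteratedFDeriv_one] at h1

lemma hasDerivAt_apply_ray {E : Type*} [NormedAddCommGroup E] [NormedSpace ℝ E]
    {F : E → E →L[ℝ] ℝ} {F' : E →L[ℝ] E →L[ℝ] ℝ} {x : E} (h : HasFDerivAt F F' x) (v : E) :
    HasDerivAt (fun u : ℝ => F (x + u • v) v) (F' v v) 0 := by
  have h1 : HasFDerivAt F F' (x + (0 : ℝ) • v) := by rwa [zero_smul, add_zero]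
  have h2 : HasDerivAt (fun u : ℝ => x + u • v) v 0 := by
    simpa using ((hasDerivAt_id (0 : ℝ)).smul_const v).const_add x
  have h3 : HasDerivAt (fun u : ℝ => F (x + u • v)) (F' v) 0 := h1.comp_hasDerivAt (0 : ℝ) h2
  have h4 := h3.clm_apply (hasDerivAt_const (0 : ℝ) v)
  simpa using h4

lemma hasDerivAt_fderiv_apply (h : ContDiffOn ℝ 2 ϕ (Ioi 0)) {x : Plane} (hx : x ≠ 0)
    (v : Plane) : HasDerivAt (fun u : ℝ => (deriv ϕ ‖x + u • v‖ / ‖x + u • v‖) *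
      inner ℝ (x + u • v) v) (fderiv ℝ (fderiv ℝ (radial ϕ)) x v v) 0 := by
  have h1 : DifferentiableAt ℝ (fderiv ℝ (radial ϕ)) x :=
    ((radial_contDiffAt h hx).fderiv_right (m := 1) (by norm_num)).differentiableAt (by norm_num)
  have h3 := hasDerivAt_apply_ray h1.hasFDerivAt v
  refine h3.congr_of_eventuallyEq ?_
  have h4 : Filter.Tendsto (fun u : ℝ => x + u • v) (nhds 0) (nhds x) := by
    have : Continuous (fun u : ℝ => x + u • v) := by fun_prop
    simpa using this.tendsto 0
  filter_upwards [h4.eventually (radial_fderiv_eventuallyEq h hx)] with u hu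
  rw [hu]
  rfl

lemma differentiableAt_deriv (h : ContDiffOn ℝ 2 ϕ (Ioi 0)) {t : ℝ} (ht : 0 < t) :
    DifferentiableAt ℝ (deriv ϕ) t :=
  ((h.deriv_of_isOpen (m := 1) isOpen_Ioi (by norm_num)).contDiffAt
    (Ioi_mem_nhds ht)).differentiableAt (by norm_num)

/-- At a point of norm t the Hessian of the potential has the eigenvalues ϕ''(t) in the radial
direction `e` and ϕ'(t)/t in the tangential direction `e'`; its operator norm bounds both. -/
lemma radial_deriv_bounds (h : ContDiffOn ℝ 2 ϕ (Ioi 0)) {s m : ℝ} (hs : 0 < s) (hm0 : 0 ≤ m)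
    (hm : decayM ϕ 2 s ≤ ENNReal.ofReal m) {t : ℝ} (ht : s ≤ t) :
    |deriv ϕ t| ≤ m * t ∧ |deriv (deriv ϕ) t| ≤ m := by
  have ht0 : 0 < t := hs.trans_le ht
  set e : Plane := EuclideanSpace.single (0 : Fin 2) 1 with he
  set e' : Plane := EuclideanSpace.single (1 : Fin 2) 1 with he'
  have hne : ‖e‖ = 1 := by simp [he]
  have hne' : ‖e'‖ = 1 := by simp [he']
  have hee : inner ℝ e e = (1 : ℝ) := by rw [real_inner_self_eq_norm_sq, hne]; norm_num
  have hee2 : inner ℝ e' e' = (1 : ℝ) := by rw [real_inner_self_eq_norm_sq, hne']; norm_num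
  have hee' : inner ℝ e e' = (0 : ℝ) := by simp [he, he', EuclideanSpace.inner_single_left]
  have hx : t • e ≠ 0 := smul_ne_zero ht0.ne' (by rw [← norm_pos_iff, hne]; exact one_pos)
  have hxn : ‖t • e‖ = t := by rw [norm_smul, hne, mul_one, Real.norm_of_nonneg ht0.le]
  have hB := norm_second_deriv_le hm hm0 (x := t • e) (by rw [hxn]; exact ht)
  have hbound : ∀ v : Plane, ‖v‖ = 1 → |fderiv ℝ (fderiv ℝ (radial ϕ)) (t • e) v v| ≤ m := by
    intro v hv
    have := (fderiv ℝ (fderiv ℝ (radial ϕ)) (t • e)).le_opNorm₂ v v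
    rw [hv, mul_one, mul_one] at this
    exact this.trans hB
  have hdd : DifferentiableAt ℝ (deriv ϕ) t := differentiableAt_deriv h ht0
  constructor
  · have h1 := hasDerivAt_fderiv_apply h hx e'
    have hin : ∀ u : ℝ, inner ℝ (t • e + u • e') e' = u := by
      intro u
      rw [inner_add_left, real_inner_smul_left, real_inner_smul_left, hee', hee2]; ring
    simp only [hin] at h1
    have hc : DifferentiableAt ℝ (fun u : ℝ => deriv ϕ ‖t • e + u • e'‖ / ‖t • e + u • e'‖) 0 := by
      have hn : DifferentiableAt ℝ (fun u : ℝ => ‖t • e + u • e'‖) 0 := by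
        refine DifferentiableAt.norm ℝ (by fun_prop) ?_
        simpa using hx
      have hd : DifferentiableAt ℝ (deriv ϕ) ‖t • e + (0 : ℝ) • e'‖ := by
        simpa [hxn] using hdd
      refine (hd.comp (0 : ℝ) hn).div hn ?_
      simpa using hx
    -- The derivative at `u = 0` of the quotient times `u` is just the value of the quotient at 0.
    have h2 := hc.hasDerivAt.mul (hasDerivAt_id (0 : ℝ))
    have h3 := h2.unique h1
    simp only [id_eq, mul_zero, mul_one, zero_smul, add_zero, zero_add, hxn] at h3
    have h4 := hbound e' hne'
    rw [← h3, abs_div, abs_of_pos ht0, div_le_iff₀ ht0] at h4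
    exact h4
  · have h1 := hasDerivAt_fderiv_apply h hx e
    have hev : (fun u : ℝ => (deriv ϕ ‖t • e + u • e‖ / ‖t • e + u • e‖) *
        inner ℝ (t • e + u • e) e) =ᶠ[nhds 0] fun u => deriv ϕ (t + u) := by
      filter_upwards [Ioi_mem_nhds (show -t < 0 by linarith)] with u hu
      have hu' : 0 < t + u := by have : -t < u := hu; linarith
      rw [← add_smul, norm_smul, hne, mul_one, Real.norm_of_nonneg hu'.le, real_inner_smul_left,
        hee]
      field_simp
    have h2 := h1.congr_of_eventuallyEq hev.symm
    have h3 : HasDerivAt (fun u => deriv ϕ (t + u)) (deriv (deriv ϕ) t) 0 := by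
      have h4 : HasDerivAt (deriv ϕ) (deriv (deriv ϕ) t) (t + 0) := by
        rw [add_zero]; exact hdd.hasDerivAt
      exact h4.comp_const_add t 0
    rw [h3.unique h2]
    exact hbound e hne

/-- Two applications of the mean value inequality; this yields the constant `m` in place of `m / 2`,
which is enough. -/
lemma taylor_one_dim (h : ContDiffOn ℝ 2 ϕ (Ioi 0)) {s m : ℝ} (hs : 0 < s)
    (hm : ∀ t, s ≤ t → |deriv (deriv ϕ) t| ≤ m) {a b : ℝ} (ha : s ≤ a) (hb : s ≤ b) :
    |ϕ b - ϕ a - deriv ϕ a * (b - a)| ≤ m * (b - a) ^ 2 := by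
  have hsub : ∀ t ∈ uIcc a b, s ≤ t := fun t ht => (le_min ha hb).trans ht.1
  have hd1 : ∀ t, s ≤ t → HasDerivAt ϕ (deriv ϕ t) t := fun t ht =>
    ((h.contDiffAt (Ioi_mem_nhds (hs.trans_le ht))).differentiableAt (by norm_num)).hasDerivAt
  have hd2 : ∀ t, s ≤ t → HasDerivAt (deriv ϕ) (deriv (deriv ϕ) t) t := fun t ht =>
    (differentiableAt_deriv h (hs.trans_le ht)).hasDerivAt
  have hm0 : 0 ≤ m := (abs_nonneg _).trans (hm a ha)
  have h1 : ∀ t ∈ uIcc a b, |deriv ϕ t - deriv ϕ a| ≤ m * |b - a| := by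
    intro t ht
    have := (convex_uIcc a b).norm_image_sub_le_of_norm_hasDerivWithin_le
      (fun u hu => (hd2 u (hsub u hu)).hasDerivWithinAt) (fun u hu => hm u (hsub u hu))
      left_mem_uIcc ht
    refine this.trans (mul_le_mul_of_nonneg_left ?_ hm0)
    exact abs_sub_left_of_mem_uIcc ht
  have h2 := (convex_uIcc a b).norm_image_sub_le_of_norm_hasDerivWithin_le
    (f := fun u => ϕ u - deriv ϕ a * u) (f' := fun u => deriv ϕ u - deriv ϕ a)
    (fun u hu => by
      have := (hd1 u (hsub u hu)).sub ((hasDerivAt_id u).const_mul (deriv ϕ a))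
      rw [mul_one] at this
      exact this.hasDerivWithinAt)
    (fun u hu => h1 u hu) left_mem_uIcc right_mem_uIcc
  rw [Real.norm_eq_abs, Real.norm_eq_abs, mul_assoc, ← sq, sq_abs] at h2
  convert! h2 using 2
  ring

/-- Second order expansion of a radial potential away from the origin; the segment between the two
points may pass through the excluded ball. -/
lemma radial_taylor (h : ContDiffOn ℝ 2 ϕ (Ioi 0)) {s m : ℝ} (hs : 0 < s) (hm0 : 0 ≤ m)
    (hm : decayM ϕ 2 s ≤ ENNReal.ofReal m) {a b : Plane} (ha : s ≤ ‖a‖) (hb : s ≤ ‖b‖) :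
    |radial ϕ b - radial ϕ a - deriv ϕ ‖a‖ / ‖a‖ * inner ℝ a (b - a)| ≤ m * ‖b - a‖ ^ 2 := by
  have ha0 : 0 < ‖a‖ := hs.trans_le ha
  have h1 := taylor_one_dim h hs (fun t ht => (radial_deriv_bounds h hs hm0 hm ht).2) ha hb
  have h2 := (radial_deriv_bounds h hs hm0 hm ha).1
  have h3 : ‖b - a‖ ^ 2 = ‖b‖ ^ 2 - 2 * inner ℝ a b + ‖a‖ ^ 2 := by
    rw [norm_sub_sq_real, real_inner_comm]
  have h4 : inner ℝ a b ≤ ‖a‖ * ‖b‖ := real_inner_le_norm a b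
  have h5 : inner ℝ a (b - a) = inner ℝ a b - ‖a‖ ^ 2 := by
    rw [inner_sub_right, real_inner_self_eq_norm_sq]
  set I := inner ℝ a b with hI
  -- The remainder splits into a radial Taylor remainder and an angular defect. Since |b - a|² =
  -- (|b| - |a|)² + 2(|a||b| - a·b), both parts together are at most `m * ‖b - a‖ ^ 2`.
  have h6 : radial ϕ b - radial ϕ a - deriv ϕ ‖a‖ / ‖a‖ * inner ℝ a (b - a) =
      (ϕ ‖b‖ - ϕ ‖a‖ - deriv ϕ ‖a‖ * (‖b‖ - ‖a‖)) +
        deriv ϕ ‖a‖ / ‖a‖ * (‖a‖ * ‖b‖ - I) := by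
    rw [h5, radial, radial]; field_simp; ring
  have h7 : |deriv ϕ ‖a‖ / ‖a‖| ≤ m := by
    rw [abs_div, abs_of_pos ha0, div_le_iff₀ ha0]; exact h2
  rw [h6]
  refine (abs_add_le _ _).trans ?_
  rw [abs_mul, abs_of_nonneg (by linarith : 0 ≤ ‖a‖ * ‖b‖ - I)]
  have h8 := mul_le_mul_of_nonneg_right h7 (by linarith : 0 ≤ ‖a‖ * ‖b‖ - I)
  have h9 : 0 ≤ m * (‖a‖ * ‖b‖ - I) := mul_nonneg hm0 (by linarith)
  rw [h3]
  nlinarith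

lemma enorm_radial_le {s : ℝ} {r : Plane} (hr : s ≤ ‖r‖) : ‖radial ϕ r‖ₑ ≤ decayM ϕ 0 s := by
  have h1 : ‖iteratedFDeriv ℝ 0 (radial ϕ) r‖ₑ ≤ decayM ϕ 0 s :=
    le_iSup₂ (f := fun (r : Plane) (_ : s ≤ ‖r‖) => ‖iteratedFDeriv ℝ 0 (radial ϕ) r‖ₑ) r hr
  rwa [← ofReal_norm, norm_iteratedFDeriv_zero, ofReal_norm] at h1

/-! ### Averages of a radial potential -/

/-- Nothing is known about `ϕ` at and below zero; cutting off its argument at `s` gives a continuous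
function on the whole line that agrees with `ϕ` wherever it is evaluated along a bond. -/
lemma continuous_comp_max (h : ContDiffOn ℝ 2 ϕ (Ioi 0)) {s : ℝ} (hs : 0 < s) :
    Continuous (fun t => ϕ (max t s)) := by
  have h1 := h.continuousOn.comp_continuous (f := fun t : ℝ => max t s) (by fun_prop)
    (fun t => hs.trans_le (le_max_right _ _))
  exact h1

lemma ae_ne_restrict (c : ℝ) (S : Set ℝ) : ∀ᵐ t ∂(volume.restrict S), t ≠ c :=
  ae_restrict_of_ae (by simp [ae_iff])

/-- The bound is asked for on the half-open interval only: at t = 1 the right derivative looks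
beyond the end of the bond, and this single point is negligible. -/
lemma intervalIntegrable_of_bounded {E : Type} [NormedAddCommGroup E] {g : ℝ → E}
    (hg : AEStronglyMeasurable g (volume.restrict (Ioc 0 1))) {L : ℝ}
    (hL : ∀ t ∈ Ico (0 : ℝ) 1, ‖g t‖ ≤ L) : IntervalIntegrable g volume 0 1 := by
  rw [intervalIntegrable_iff_integrableOn_Ioc_of_le zero_le_one]
  refine ⟨hg, HasFiniteIntegral.of_bounded (C := L) ?_⟩
  filter_upwards [ae_ne_restrict 1 (Ioc 0 1), ae_restrict_mem measurableSet_Ioc] with t ht1 ht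
  exact hL t ⟨ht.1.le, lt_of_le_of_ne ht.2 ht1⟩

lemma radial_comp_intervalIntegrable (h : ContDiffOn ℝ 2 ϕ (Ioi 0)) {s : ℝ} (hs : 0 < s)
    {g : ℝ → Plane} (hg : Measurable g) (hgs : ∀ t ∈ Ico (0 : ℝ) 1, s ≤ ‖g t‖) {L : ℝ}
    (hL : ∀ t ∈ Ico (0 : ℝ) 1, ‖g t‖ ≤ L) :
    IntervalIntegrable (fun t => radial ϕ (g t)) volume 0 1 := by
  have hψ := continuous_comp_max h hs
  obtain ⟨B, hB⟩ := isCompact_Icc.exists_bound_of_continuousOn (s := Icc 0 L) hψ.continuousOn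
  have heq : ∀ t ∈ Ico (0 : ℝ) 1, radial ϕ (g t) = ϕ (max ‖g t‖ s) := fun t ht => by
    rw [max_eq_left (hgs t ht), radial]
  refine intervalIntegrable_of_bounded (L := B) ?_ ?_
  · refine AEStronglyMeasurable.congr
      (hψ.measurable.comp hg.norm).aestronglyMeasurable ?_
    filter_upwards [ae_ne_restrict 1 (Ioc 0 1), ae_restrict_mem measurableSet_Ioc] with t ht1 ht
    exact (heq t ⟨ht.1.le, lt_of_le_of_ne ht.2 ht1⟩).symm
  · intro t ht
    rw [heq t ht]
    exact hB _ ⟨norm_nonneg _, hL t ht⟩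

/-- Because `D` is the mean of `g`, the linear term of the expansion at `D` integrates to zero and
only the quadratic remainder is left. -/
lemma enorm_radial_sub_integral_le (h : ContDiffOn ℝ 2 ϕ (Ioi 0)) {s : ℝ} (hs : 0 < s)
    {g : ℝ → Plane} (hg : Measurable g) (hgs : ∀ t ∈ Ico (0 : ℝ) 1, s ≤ ‖g t‖) {D : Plane}
    (hD : s ≤ ‖D‖) (hint : ∫ t in (0 : ℝ)..1, g t = D) {K : ℝ} (hK : 0 ≤ K)
    (hgK : ∀ t ∈ Ico (0 : ℝ) 1, ‖g t - D‖ ≤ K) :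
    ‖radial ϕ D - ∫ t in (0 : ℝ)..1, radial ϕ (g t)‖ₑ ≤ decayM ϕ 2 s * ENNReal.ofReal K ^ 2 := by
  have hL : ∀ t ∈ Ico (0 : ℝ) 1, ‖g t‖ ≤ K + ‖D‖ := fun t ht => by
    have h1 := norm_add_le (g t - D) D
    rw [sub_add_cancel] at h1
    linarith [hgK t ht]
  -- If M₂ is infinite, so is the right-hand side unless `K = 0`; then `g` is constant almost
  -- everywhere and the left-hand side vanishes, in accordance with 0 · ∞ = 0.
  by_cases hm : decayM ϕ 2 s = ⊤
  · rcases hK.lt_or_eq with h0 | h0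
    · rw [hm, ENNReal.top_mul]
      · exact le_top
      · have := ENNReal.ofReal_pos.2 h0
        positivity
    · subst h0
      have h1 : ∫ t in (0 : ℝ)..1, radial ϕ (g t) = ∫ t in (0 : ℝ)..1, radial ϕ D := by
        rw [intervalIntegral.integral_of_le zero_le_one, intervalIntegral.integral_of_le zero_le_one]
        apply integral_congr_ae
        filter_upwards [ae_ne_restrict 1 (Ioc 0 1), ae_restrict_mem measurableSet_Ioc] with t ht1 ht
        have := hgK t ⟨ht.1.le, lt_of_le_of_ne ht.2 ht1⟩
        rw [sub_eq_zero.1 (norm_le_zero_iff.1 this)]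
      rw [h1]
      simp
  · set m := (decayM ϕ 2 s).toReal with hmdef
    have hm0 : 0 ≤ m := ENNReal.toReal_nonneg
    have hme : decayM ϕ 2 s = ENNReal.ofReal m := (ENNReal.ofReal_toReal hm).symm
    have hi1 := radial_comp_intervalIntegrable h hs hg hgs hL
    have hi2 : IntervalIntegrable g volume 0 1 :=
      intervalIntegrable_of_bounded hg.aestronglyMeasurable hL
    set c := deriv ϕ ‖D‖ / ‖D‖ with hc
    have hi3 : IntervalIntegrable (fun t => c * inner ℝ D (g t - D)) volume 0 1 := by
      refine IntervalIntegrable.const_mul (intervalIntegrable_of_bounded (L := ‖D‖ * K) ?_ ?_) c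
      · exact (measurable_const.inner (hg.sub_const D)).aestronglyMeasurable
      · intro t ht
        refine (norm_inner_le_norm _ _).trans ?_
        gcongr
        exact hgK t ht
    have hz : ∫ t in (0 : ℝ)..1, c * inner ℝ D (g t - D) = 0 := by
      rw [intervalIntegral.integral_const_mul]
      have h2 := (innerSL ℝ D).intervalIntegral_comp_comm
        (hi2.sub (intervalIntegrable_const (c := D) (μ := volume) (a := 0) (b := 1)))
      simp only [innerSL_apply_apply] at h2
      rw [h2, intervalIntegral.integral_sub hi2 intervalIntegrable_const, hint]
      simp
    have heq : ∫ t in (0 : ℝ)..1, (radial ϕ (g t) - radial ϕ D - c * inner ℝ D (g t - D)) =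
        (∫ t in (0 : ℝ)..1, radial ϕ (g t)) - radial ϕ D := by
      rw [intervalIntegral.integral_sub (hi1.sub intervalIntegrable_const) hi3, hz,
        intervalIntegral.integral_sub hi1 intervalIntegrable_const]
      simp
    have hbound : ‖∫ t in (0 : ℝ)..1,
        (radial ϕ (g t) - radial ϕ D - c * inner ℝ D (g t - D))‖ ≤ m * K ^ 2 * |1 - 0| := by
      refine intervalIntegral.norm_integral_le_of_norm_le_const_ae ?_
      have : ∀ᵐ t : ℝ, t ≠ 1 := by simp [ae_iff]
      filter_upwards [this] with t ht1 ht
      rw [uIoc_of_le zero_le_one] at ht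
      have ht' : t ∈ Ico (0 : ℝ) 1 := ⟨ht.1.le, lt_of_le_of_ne ht.2 ht1⟩
      refine (radial_taylor h hs hm0 hme.le hD (hgs t ht')).trans ?_
      gcongr
      exact hgK t ht'
    rw [heq, norm_sub_rev] at hbound
    rw [hme, ← ENNReal.ofReal_pow hK, ← ENNReal.ofReal_mul hm0, ← ofReal_norm]
    apply ENNReal.ofReal_le_ofReal
    simpa using hbound

/-! ### The error of a single continuum bond. -/

namespace Mesh

variable {N : ℕ} {M : Mesh N} {ϕ : ℝ → ℝ}

/-- A common period moves the first point into the cell without changing either difference. -/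
lemma PeriodicPA.muC_mul_le {B : Plane →L[ℝ] Plane} {y : Plane → Plane}
    (hy : M.PeriodicPA B y) {x x' : Plane} (hx : x ∈ M.contRegionPer)
    (hx' : x' ∈ M.contRegionPer) : M.muC y * ‖x' - x‖ ≤ ‖y x' - y x‖ := by
  rcases eq_or_ne x x' with rfl | hne
  · simp
  obtain ⟨a, ha, z, hz, rfl⟩ := hx
  have h1 : x' - (N : ℝ) • z ∈ M.contRegionPer := by
    have := translate_mem_periodic hx' (neg_mem_lattice hz)
    rwa [smul_neg, ← sub_eq_add_neg] at this
  have h2 := hy.per a (contRegionPer_subset (subset_periodic ha)) z hz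
  have h3 := hy.per _ (contRegionPer_subset h1) z hz
  rw [sub_add_cancel] at h3
  have hne' : a ≠ x' - (N : ℝ) • z := fun h => hne (by rw [h, sub_add_cancel])
  have hbdd : BddBelow {t | ∃ x ∈ M.contRegion, ∃ x' ∈ M.contRegionPer, x ≠ x' ∧
      t = ‖y x' - y x‖ / ‖x' - x‖} :=
    ⟨0, by rintro t ⟨x, -, x', -, -, rfl⟩; positivity⟩
  have h4 : M.muC y ≤ ‖y (x' - (N : ℝ) • z) - y a‖ / ‖x' - (N : ℝ) • z - a‖ :=
    csInf_le hbdd ⟨a, ha, _, h1, hne', rfl⟩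
  rw [le_div_iff₀ (norm_pos_iff.2 (sub_ne_zero.2 hne'.symm))] at h4
  rw [h2, h3]
  convert! h4 using 2
  · congr 1; abel
  · abel_nf

/-- What the analysis along a single bond uses of a continuum bond. -/
lemma contBonds_segment {b : Plane × Plane} (hb : b ∈ M.contBonds) :
    b.2 - b.1 ≠ 0 ∧ ∀ t ∈ Icc (0 : ℝ) 1, b.1 + t • (b.2 - b.1) ∈ M.contInterior := by
  refine ⟨sub_ne_zero.2 hb.1.2.2.symm, fun t ht => hb.2 ?_⟩
  rw [segment_eq_image']
  exact ⟨t, ht, rfl⟩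

open scoped Pointwise in
-- Along a bond the directional derivative is the right derivative of a function of one variable;
-- measurability in t and the fundamental theorem of calculus are available in that form.
lemma dirDeriv_eq_derivWithin (r : Plane) (y : Plane → Plane) (x : Plane) (t : ℝ) :
    dirDeriv r y (x + t • r) = derivWithin (fun u : ℝ => y (x + u • r)) (Ici t) t := by
  have h := derivWithin_comp_const_add (f := fun u : ℝ => y (x + u • r)) (a := t)
    (s := Ici (0 : ℝ)) (x := 0)
  have h0 : t +ᵥ Ici (0 : ℝ) = Ici t := by
    rw [← Set.image_vadd]
    simp
  rw [h0, add_zero] at h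
  rw [← h, dirDeriv]
  congr 1
  funext s
  congr 1
  module

section Bond

variable {κ : ℝ} (hN : 0 < N) (hκ : 0 < κ) (hκ1 : κ ≤ 1) (hF : ∀ T ∈ M.elems, Fat κ T)
  {B : Plane →L[ℝ] Plane} {y : Plane → Plane} (hy : M.PeriodicPA B y) {x r : Plane} (hr : r ≠ 0)
  (hU : ∀ t ∈ Icc (0 : ℝ) 1, x + t • r ∈ M.contInterior)

include hN hκ hκ1 hF hy hU

lemma hasDerivWithinAt_bond {t : ℝ} (ht : t ∈ Icc (0 : ℝ) 1) :
    HasDerivWithinAt (fun u : ℝ => y (x + u • r)) (dirDeriv r y (x + t • r)) (Ici t) t := by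
  obtain ⟨T, -, -, -, hder⟩ := hasDerivWithinAt_ray hN hκ hκ1 hF hy.pa (hU t ht) r
  rw [dirDeriv_eq_derivWithin]
  refine DifferentiableWithinAt.hasDerivWithinAt ?_
  have h1 : HasDerivWithinAt (fun w : ℝ => w - t) 1 (Ici t) t :=
    ((hasDerivAt_id t).sub_const t).hasDerivWithinAt
  have hder' : HasDerivWithinAt (fun s : ℝ => y (x + t • r + s • r)) (gradOn T y r) (Ici 0)
      (t - t) := by rw [sub_self]; exact hder
  have h2 := HasDerivWithinAt.scomp (h := fun w : ℝ => w - t) t hder' h1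
    (fun w hw => by simpa using hw)
  have h3 : ((fun s : ℝ => y (x + t • r + s • r)) ∘ fun w : ℝ => w - t) =
      fun w => y (x + w • r) := by
    funext w; simp only [Function.comp]; congr 1; module
  rw [h3] at h2
  exact h2.differentiableWithinAt

/-- As `y` is affine on an initial piece of the ray, the directional derivative equals a difference
quotient. Bounds for difference quotients, from below by `muC` and for the deviation from the mean
slope, thus transfer without a limit. -/
lemma exists_dirDeriv_secant {t : ℝ} (ht : t ∈ Ico (0 : ℝ) 1) :
    ∃ ε > 0, t + ε ≤ 1 ∧
      y (x + (t + ε) • r) - y (x + t • r) = ε • dirDeriv r y (x + t • r) := by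
  have ht' : t ∈ Icc (0 : ℝ) 1 := ⟨ht.1, ht.2.le⟩
  obtain ⟨T, -, -, ⟨δ, hδ, h⟩, hder⟩ := hasDerivWithinAt_ray hN hκ hκ1 hF hy.pa (hU t ht') r
  have hd : dirDeriv r y (x + t • r) = gradOn T y r :=
    hder.derivWithin (uniqueDiffOn_Ici 0 0 (by simp))
  have hε : 0 < min δ (1 - t) := lt_min hδ (by linarith [ht.2])
  refine ⟨min δ (1 - t), hε, by linarith [min_le_right δ (1 - t)], ?_⟩
  rw [hd, ← (h _ ⟨hε.le, min_le_left _ _⟩).2, add_smul, add_assoc]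

lemma muC_mul_norm_le_dirDeriv {t : ℝ} (ht : t ∈ Ico (0 : ℝ) 1) :
    M.muC y * ‖r‖ ≤ ‖dirDeriv r y (x + t • r)‖ := by
  obtain ⟨ε, hε, hε1, h⟩ := exists_dirDeriv_secant hN hκ hκ1 hF hy hU ht
  have h1 := hy.muC_mul_le (interior_subset (hU t ⟨ht.1, ht.2.le⟩))
    (interior_subset (hU (t + ε) ⟨by linarith [ht.1], hε1⟩))
  rw [h, show x + (t + ε) • r - (x + t • r) = ε • r by module, norm_smul, norm_smul,
    Real.norm_of_nonneg hε.le] at h1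
  refine le_of_mul_le_mul_left ?_ hε
  linarith

include hr in
lemma norm_dirDeriv_sub_le {C : ℕ} (hC : ∀ c : Plane,
      {T | T ∈ M.elemsPer ∧ (convexHull ℝ (T : Set Plane) ∩ Metric.closedBall c 2).Nonempty}.encard
        ≤ C) (hK : M.bondVar C y x r ≠ ⊤) {t : ℝ} (ht : t ∈ Ico (0 : ℝ) 1) :
    ‖dirDeriv r y (x + t • r) - (y (x + r) - y x)‖ ≤ (M.bondVar C y x r).toReal := by
  obtain ⟨ε, hε, hε1, h⟩ := exists_dirDeriv_secant hN hκ hκ1 hF hy hU ht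
  have h1 := enorm_slope_le hN hκ hκ1 hF hC hy.pa hr hU hK ht.1 (by linarith : t ≤ t + ε) hε1
  rw [h, add_sub_cancel_left, ← smul_sub, norm_smul, Real.norm_of_nonneg hε.le, mul_comm] at h1
  exact le_of_mul_le_mul_right h1 hε

omit hN hκ hκ1 hF hy hU in
lemma measurable_dirDeriv_bond : Measurable fun t : ℝ => dirDeriv r y (x + t • r) := by
  simp_rw [dirDeriv_eq_derivWithin]
  exact measurable_derivWithin_Ici _

include hr in
lemma integral_dirDeriv {C : ℕ} (hC : ∀ c : Plane,
      {T | T ∈ M.elemsPer ∧ (convexHull ℝ (T : Set Plane) ∩ Metric.closedBall c 2).Nonempty}.encard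
        ≤ C) (hK : M.bondVar C y x r ≠ ⊤) :
    ∫ t in (0 : ℝ)..1, dirDeriv r y (x + t • r) = y (x + r) - y x := by
  have h1 : IntervalIntegrable (fun t => dirDeriv r y (x + t • r)) volume 0 1 := by
    refine intervalIntegrable_of_bounded measurable_dirDeriv_bond.aestronglyMeasurable
      (L := (M.bondVar C y x r).toReal + ‖y (x + r) - y x‖) fun t ht => ?_
    have h2 := norm_add_le (dirDeriv r y (x + t • r) - (y (x + r) - y x)) (y (x + r) - y x)
    rw [sub_add_cancel] at h2
    linarith [norm_dirDeriv_sub_le hN hκ hκ1 hF hy hr hU hC hK ht]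
  have hc : ContinuousOn (fun u : ℝ => y (x + u • r)) (Icc 0 1) :=
    (hy.pa.continuousOn hκ hκ1 hF).comp (by fun_prop) fun u hu =>
      contRegionPer_subset (interior_subset (hU u hu))
  have h3 := intervalIntegral.integral_eq_sub_of_hasDeriv_right_of_le zero_le_one hc
    (fun t ht => (hasDerivWithinAt_bond hN hκ hκ1 hF hy hU ⟨ht.1.le, ht.2.le⟩).mono
      Ioi_subset_Ici_self) h1
  simpa using h3

include hr in
lemma enorm_bond_error_le (hϕ : IsPotential ϕ) (hμ : 0 < M.muC y) {C : ℕ} (hC : ∀ c : Plane,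
      {T | T ∈ M.elemsPer ∧ (convexHull ℝ (T : Set Plane) ∩ Metric.closedBall c 2).Nonempty}.encard
        ≤ C) (hK : M.bondVar C y x r ≠ ⊤) :
    ‖radial ϕ (y (x + r) - y x) - ∫ t in (0 : ℝ)..1, radial ϕ (dirDeriv r y (x + t • r))‖ₑ ≤
      decayM ϕ 2 (M.muC y * ‖r‖) * M.bondVar C y x r ^ 2 := by
  have h0 := hU 0 ⟨le_rfl, zero_le_one⟩
  have h1 := hU 1 ⟨zero_le_one, le_rfl⟩
  rw [zero_smul, add_zero] at h0
  rw [one_smul] at h1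
  have hD := hy.muC_mul_le (interior_subset h0) (interior_subset h1)
  rw [add_sub_cancel_left] at hD
  have h := enorm_radial_sub_integral_le hϕ.smooth (mul_pos hμ (norm_pos_iff.2 hr))
    measurable_dirDeriv_bond (fun t ht => muC_mul_norm_le_dirDeriv hN hκ hκ1 hF hy hU ht) hD
    (integral_dirDeriv hN hκ hκ1 hF hy hr hU hC hK) ENNReal.toReal_nonneg
    (fun t ht => norm_dirDeriv_sub_le hN hκ hκ1 hF hy hr hU hC hK ht)
  rwa [ENNReal.ofReal_toReal hK] at h

/-- This crude bound serves only to make the sum of the integrals over all continuum bonds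
absolutely convergent. -/
lemma enorm_integral_bond_le :
    ‖∫ t in (0 : ℝ)..1, radial ϕ (dirDeriv r y (x + t • r))‖ₑ ≤ decayM ϕ 0 (M.muC y * ‖r‖) := by
  by_cases hm : decayM ϕ 0 (M.muC y * ‖r‖) = ⊤
  · rw [hm]; exact le_top
  have h1 : ∀ t ∈ Ico (0 : ℝ) 1, ‖radial ϕ (dirDeriv r y (x + t • r))‖ ≤
      (decayM ϕ 0 (M.muC y * ‖r‖)).toReal := by
    intro t ht
    have := enorm_radial_le (ϕ := ϕ) (muC_mul_norm_le_dirDeriv hN hκ hκ1 hF hy hU ht)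
    have h2 := ENNReal.toReal_mono hm this
    rwa [toReal_enorm] at h2
  have h2 : ‖∫ t in (0 : ℝ)..1, radial ϕ (dirDeriv r y (x + t • r))‖ ≤
      (decayM ϕ 0 (M.muC y * ‖r‖)).toReal * |1 - 0| := by
    refine intervalIntegral.norm_integral_le_of_norm_le_const_ae ?_
    have : ∀ᵐ t : ℝ, t ≠ 1 := by simp [ae_iff]
    filter_upwards [this] with t ht1 ht
    rw [uIoc_of_le zero_le_one] at ht
    exact h1 t ⟨ht.1.le, lt_of_le_of_ne ht.2 ht1⟩
  rw [sub_zero, abs_one, mul_one] at h2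
  rw [← ofReal_norm, ← ENNReal.ofReal_toReal hm]
  exact ENNReal.ofReal_le_ofReal h2

end Bond

/-! ### Finiteness of the jumps -/

lemma frobSq_ne_top (G : Plane →L[ℝ] Plane) : frobSq G ≠ ⊤ := by
  rw [frobSq]
  exact ENNReal.sum_ne_top.2 fun i _ => ENNReal.pow_ne_top enorm_ne_top

lemma jumpSq_ne_top {C : ℕ} (hC : ∀ c : Plane,
      {T | T ∈ M.elemsPer ∧ (convexHull ℝ (T : Set Plane) ∩ Metric.closedBall c 2).Nonempty}.encard
        ≤ C) (y : Plane → Plane) {f : Finset Plane} (hf : f.card = 2) : M.jumpSq y f ≠ ⊤ := by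
  obtain ⟨p, hp⟩ : f.Nonempty := by rw [← Finset.card_pos, hf]; norm_num
  set E := {T | T ∈ M.elemsPer ∧
    (convexHull ℝ (T : Set Plane) ∩ Metric.closedBall p 2).Nonempty} with hE
  have hfin : E.Finite := Set.finite_of_encard_le_coe (hC p)
  have hmem : ∀ T ∈ M.elemsPer, f ⊆ T → T ∈ hfin.toFinset := fun T hT hfT =>
    hfin.mem_toFinset.2 ⟨hT, p, subset_convexHull _ _ (hfT hp), by simp⟩
  have hle : M.jumpSq y f ≤
      ∑ T ∈ hfin.toFinset, ∑ T' ∈ hfin.toFinset, frobSq (gradOn T y - gradOn T' y) := by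
    refine iSup₂_le fun T hT => iSup₂_le fun T' hT' => iSup_le fun hff => ?_
    refine le_trans ?_ (Finset.single_le_sum (fun _ _ => zero_le) (hmem T hT hff.1))
    exact Finset.single_le_sum (f := fun T' => frobSq (gradOn T y - gradOn T' y))
      (fun _ _ => zero_le) (hmem T' hT' hff.2)
  refine ne_top_of_le_ne_top ?_ hle
  exact ENNReal.sum_ne_top.2 fun T _ => ENNReal.sum_ne_top.2 fun T' _ => frobSq_ne_top _

lemma bondVar_ne_top {C : ℕ} (hC : ∀ c : Plane,
      {T | T ∈ M.elemsPer ∧ (convexHull ℝ (T : Set Plane) ∩ Metric.closedBall c 2).Nonempty}.encard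
        ≤ C) (y : Plane → Plane) (x r : Plane) : M.bondVar C y x r ≠ ⊤ := by
  have hfin : (M.bondEdges x r).Finite := Set.finite_of_encard_le_coe (bondEdges_encard_le hC x r)
  have : Fintype (M.bondEdges x r) := hfin.fintype
  rw [bondVar, tsum_fintype]
  refine ENNReal.mul_ne_top (by simp) (ENNReal.sum_ne_top.2 fun f _ => ?_)
  exact ENNReal.mul_ne_top enorm_ne_top
    (ENNReal.rpow_ne_top_of_nonneg (by norm_num) (jumpSq_ne_top hC y f.2.1))

/-- Cauchy–Schwarz over the edges near the bond: their number contributes one power of the length of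
`r`, the directional derivative two. -/
lemma bondVar_sq_le {C : ℕ} (hC : ∀ c : Plane,
      {T | T ∈ M.elemsPer ∧ (convexHull ℝ (T : Set Plane) ∩ Metric.closedBall c 2).Nonempty}.encard
        ≤ C) (y : Plane → Plane) (x r : Plane) :
    M.bondVar C y x r ^ 2 ≤ C ^ 2 * (((⌈‖r‖⌉₊ + 1) * (3 * C) : ℕ) *
      (‖r‖ₑ ^ 2 * ∑' f : M.bondEdges x r, M.jumpSq y f)) := by
  rw [bondVar, mul_pow]
  gcongr
  refine (tsum_sq_le (bondEdges_encard_le hC x r) (M.dirJump y r)).trans ?_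
  gcongr
  rw [← ENNReal.tsum_mul_left]
  refine ENNReal.tsum_le_tsum fun f => ?_
  rw [dirJump, mul_pow, ← ENNReal.rpow_natCast (_ ^ (1 / 2 : ℝ)), ← ENNReal.rpow_mul]
  norm_num

/-! ### Summing over the atoms -/

lemma tube_translate {x r v z : Plane} (hz : z ∈ tube x r) : z + v ∈ tube (x + v) r := by
  obtain ⟨k, hk, h⟩ := mem_iUnion₂.1 hz
  refine mem_iUnion₂.2 ⟨k, hk, ?_⟩
  rw [Metric.mem_closedBall, dist_eq_norm] at h ⊢
  convert! h using 2
  abel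

/-- Periodicity of `y` is available on the continuum mesh only. As the translated edge belongs to
`contEdges`, all elements containing it are continuum elements, and so are their translates at `f`.
-/
lemma PeriodicPA.jumpSq_le_translate (hN : 0 < N) {B : Plane →L[ℝ] Plane} {y : Plane → Plane}
    (hy : M.PeriodicPA B y) {f : Finset Plane} {z : Plane} (hz : z ∈ lattice)
    (hf : translate ((N : ℝ) • z) f ∈ M.contEdges) :
    M.jumpSq y f ≤ M.jumpSq y (translate ((N : ℝ) • z) f) := by
  have key : ∀ T ∈ M.elemsPer, f ⊆ T → translate ((N : ℝ) • z) T ∈ M.elemsPer ∧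
      translate ((N : ℝ) • z) f ⊆ translate ((N : ℝ) • z) T ∧
      gradOn (translate ((N : ℝ) • z) T) y = gradOn T y := by
    intro T hT hfT
    have h1 : translate ((N : ℝ) • z) T ∈ M.elemsPer := translate_mem_periodicFamily hT hz
    have h2 : translate ((N : ℝ) • z) f ⊆ translate ((N : ℝ) • z) T :=
      Finset.map_subset_map.2 hfT
    have h3 := mem_contElemsPer_of_contEdges hN hf h1 h2
    have h4 : T ∈ M.contElemsPer := by
      have := translate_mem_periodicFamily h3 (neg_mem_lattice hz)
      rw [translate_translate, smul_neg, add_neg_cancel, translate_zero] at this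
      exact this
    exact ⟨h1, h2, hy.gradOn_translate h4 hz⟩
  refine iSup₂_le fun T hT => iSup₂_le fun T' hT' => iSup_le fun hff => ?_
  obtain ⟨h1, h2, h3⟩ := key T hT hff.1
  obtain ⟨h1', h2', h3'⟩ := key T' hT' hff.2
  refine le_iSup₂_of_le _ h1 (le_iSup₂_of_le _ h1' (le_iSup_of_le ⟨h2, h2'⟩ ?_))
  rw [h3, h3']

/-- Double counting: a pair of an atom and a nearby edge is moved by the period that takes the edge
into `contEdges`, and then the lattice points near each such edge are counted. Their number is
proportional to the length of the edge, which turns the sum into the L²-norm. -/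
lemma tsum_atoms_jumpSq_le (hN : 0 < N) {K : ℕ}
    (hK : ∀ c : Plane, (lattice ∩ Metric.closedBall c 3).encard ≤ K)
    {B : Plane →L[ℝ] Plane} {y : Plane → Plane} (hy : M.PeriodicPA B y) {r : Plane}
    (hr : 1 ≤ ‖r‖) :
    ∑' x : M.atoms, ∑' f : M.bondEdges x r, M.jumpSq y f ≤
      ENNReal.ofReal (9 * K * ‖r‖) * M.jumpNormSq y := by
  have hex : ∀ p : (Σ x : M.atoms, M.bondEdges x r), ∃ z ∈ lattice,
      translate ((N : ℝ) • z) p.2.1 ∈ M.contEdges := by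
    rintro ⟨x, f, hf, ⟨T, hT, hfT⟩, w, hw, hwU, -⟩
    exact exists_mem_contEdges_translate hN hf hT hfT hw hwU
  choose ζ hζ hζe using hex
  let X : M.contEdges → Set Plane := fun f =>
    {x | x ∈ lattice ∧ (convexHull ℝ (f.1 : Set Plane) ∩ tube x r).Nonempty}
  let Φ : (Σ x : M.atoms, M.bondEdges x r) → (Σ f : M.contEdges, X f) := fun p =>
    ⟨⟨translate ((N : ℝ) • ζ p) p.2.1, hζe p⟩, p.1.1 + (N : ℝ) • ζ p,
      add_mem_lattice p.1.2.1.1 (nsmul_mem_lattice N (hζ p)), by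
        obtain ⟨w, hw, -, hwt⟩ := p.2.2.2.2
        refine ⟨w + (N : ℝ) • ζ p, ?_, tube_translate hwt⟩
        rw [mem_convexHull_translate, add_sub_cancel_right]
        exact hw⟩
  -- Both original atoms lie in the half-open cell, so equality of the shifted atoms forces equal
  -- shifts.
  have hinj : Function.Injective Φ := by
    rintro ⟨⟨x, hx⟩, f, hf⟩ ⟨⟨x', hx'⟩, f', hf'⟩ heq
    have h1 := congrArg (fun q : (Σ f : M.contEdges, X f) => q.1.1) heq
    have h2 := congrArg (fun q : (Σ f : M.contEdges, X f) => (q.2 : Plane)) heq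
    simp only [Φ] at h1 h2
    set z := ζ ⟨⟨x, hx⟩, f, hf⟩
    set z' := ζ ⟨⟨x', hx'⟩, f', hf'⟩
    have hz : z - z' = 0 := eq_zero_of_translate_mem_cell (x := x) hN
      (sub_mem_lattice (hζ _) (hζ _)) hx.1.2
      (by rw [smul_sub, ← add_sub_assoc, h2, add_sub_cancel_right]; exact hx'.1.2)
    have hz' : z = z' := sub_eq_zero.1 hz
    rw [hz'] at h1 h2
    have hxx : x = x' := add_right_cancel h2
    have hff : f = f' := Finset.map_injective _ h1
    subst hxx hff
    rfl
  calc ∑' x : M.atoms, ∑' f : M.bondEdges x r, M.jumpSq y f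
      = ∑' p : (Σ x : M.atoms, M.bondEdges x r), M.jumpSq y p.2.1 :=
        (ENNReal.tsum_sigma (fun (x : M.atoms) (f : M.bondEdges x r) => M.jumpSq y f.1)).symm
    _ ≤ ∑' p : (Σ x : M.atoms, M.bondEdges x r), M.jumpSq y (Φ p).1.1 :=
        ENNReal.tsum_le_tsum fun p => hy.jumpSq_le_translate hN (hζ p) (hζe p)
    _ ≤ ∑' q : (Σ f : M.contEdges, X f), M.jumpSq y q.1.1 :=
        ENNReal.tsum_comp_le_tsum_of_injective hinj (fun q => M.jumpSq y q.1.1)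
    _ = ∑' f : M.contEdges, ∑' _ : X f, M.jumpSq y f.1 :=
        ENNReal.tsum_sigma (fun (f : M.contEdges) (_ : X f) => M.jumpSq y f.1)
    _ ≤ ∑' f : M.contEdges, ENNReal.ofReal (9 * K * ‖r‖) *
          (Metric.ediam ((f : Finset Plane) : Set Plane) * M.jumpSq y f) := by
        refine ENNReal.tsum_le_tsum fun f => ?_
        rw [ENNReal.tsum_set_const, ← mul_assoc]
        gcongr
        obtain ⟨f, hf⟩ := f
        obtain ⟨p, q, hpq, rfl⟩ := Finset.card_eq_two.1 hf.1
        obtain ⟨T, hT, hfT⟩ := hf.2.1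
        have hlat := elemsPer_subset_lattice hT
        have hd : 1 ≤ ‖q - p‖ := by
          rw [← dist_eq_norm]
          exact one_le_dist_of_mem_lattice (hlat (hfT (by simp))) (hlat (hfT (by simp))) hpq.symm
        have h1 := lattice_tube_encard_le hK p q r hpq
        have h2 : X ⟨{p, q}, hf⟩ = {x | x ∈ lattice ∧ (segment ℝ p q ∩ tube x r).Nonempty} := by
          simp only [X, Finset.coe_insert, Finset.coe_singleton, convexHull_pair]
        rw [h2]
        have h3 : Metric.ediam ((({p, q} : Finset Plane)) : Set Plane) =
            ENNReal.ofReal ‖q - p‖ := by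
          rw [Finset.coe_insert, Finset.coe_singleton, Metric.ediam_pair, edist_dist, dist_comm,
            dist_eq_norm]
        rw [h3, ← ENNReal.ofReal_mul (by positivity)]
        refine le_trans (b := (((⌈‖r‖⌉₊ + 1) * ((⌈‖q - p‖⌉₊ + 1) * K) : ℕ) : ℝ≥0∞)) ?_ ?_
        · exact_mod_cast ENat.toENNReal_mono h1
        · rw [← ENNReal.ofReal_natCast]
          apply ENNReal.ofReal_le_ofReal
          have e1 := natCeil_add_one_le hr
          have e2 := natCeil_add_one_le hd
          rw [Nat.cast_mul, Nat.cast_mul]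
          calc ((⌈‖r‖⌉₊ + 1 : ℕ) : ℝ) * (((⌈‖q - p‖⌉₊ + 1 : ℕ) : ℝ) * K)
              ≤ (3 * ‖r‖) * ((3 * ‖q - p‖) * K) := by gcongr
            _ = 9 * K * ‖r‖ * ‖q - p‖ := by ring
    _ = _ := by rw [ENNReal.tsum_mul_left, jumpNormSq]

end Mesh

/-! ### Summation over all bonds and the modelling error. -/

namespace Mesh

variable {N : ℕ} {M : Mesh N} {ϕ : ℝ → ℝ}

/-- A map which is periodic relative to `B` on the atoms. -/
def PeriodicOnAtoms (M : Mesh N) (B : Plane →L[ℝ] Plane) (y : Plane → Plane) : Prop :=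
  ∀ x ∈ M.atomsPer, ∀ z ∈ lattice, y (x + (N : ℝ) • z) = y x + B ((N : ℝ) • z)

lemma atomsPer_subset_lattice : M.atomsPer ⊆ lattice := by
  rintro x ⟨a, ha, z, hz, rfl⟩
  exact add_mem_lattice ha.1.1 (nsmul_mem_lattice N hz)

lemma sub_mem_latticeDirs {b : Plane × Plane} (hb : b ∈ M.bonds) : b.2 - b.1 ∈ latticeDirs :=
  ⟨sub_mem_lattice (atomsPer_subset_lattice hb.2.1) hb.1.1.1, sub_ne_zero.2 hb.2.2.symm⟩

/-- A bond is determined by its direction and its first atom. -/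
lemma tsum_bonds_le (F : Plane → Plane → ℝ≥0∞) {S : Set (Plane × Plane)} (hS : S ⊆ M.bonds) :
    ∑' b : S, F b.1.1 (b.1.2 - b.1.1) ≤ ∑' r : latticeDirs, ∑' x : M.atoms, F x r := by
  let Φ : S → (Σ _ : latticeDirs, M.atoms) :=
    fun b => ⟨⟨b.1.2 - b.1.1, sub_mem_latticeDirs (hS b.2)⟩, ⟨b.1.1, (hS b.2).1⟩⟩
  have hinj : Function.Injective Φ := by
    rintro ⟨⟨x, x'⟩, hb⟩ ⟨⟨u, u'⟩, hb'⟩ heq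
    have h1 := congrArg (fun q : (Σ _ : latticeDirs, M.atoms) => (q.1 : Plane)) heq
    have h2 := congrArg (fun q : (Σ _ : latticeDirs, M.atoms) => (q.2 : Plane)) heq
    simp only [Φ] at h1 h2
    subst h2
    have h3 : x' = u' := sub_left_injective h1
    subst h3
    rfl
  rw [← ENNReal.tsum_sigma (fun (r : latticeDirs) (x : M.atoms) => F x r)]
  exact ENNReal.tsum_comp_le_tsum_of_injective hinj
    (fun q : (Σ _ : latticeDirs, M.atoms) => F q.2 q.1)

lemma tsum_bonds_decay_ne_top (hϕ : IsPotential ϕ) {c : ℝ} (hc : 0 < c) {S : Set (Plane × Plane)}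
    (hS : S ⊆ M.bonds) : ∑' b : S, decayM ϕ 0 (c * ‖b.1.2 - b.1.1‖) ≠ ⊤ := by
  refine ne_top_of_le_ne_top ?_ (tsum_bonds_le (fun _ r => decayM ϕ 0 (c * ‖r‖)) hS)
  simp_rw [ENNReal.tsum_set_const]
  rw [ENNReal.tsum_mul_left]
  refine ENNReal.mul_ne_top ?_ (hϕ.decay c hc)
  rw [atoms_finite.encard_eq_coe_toFinset_card]
  simp

/-- The difference between `y` and the invertible map `B` is periodic, hence bounded on the atoms,
so sufficiently long bonds are not collapsed. Positivity of `muA` is deliberately avoided: it may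
fail for a nodal interpolant. -/
lemma PeriodicOnAtoms.exists_lower_bound {B : Plane →L[ℝ] Plane} {y : Plane → Plane}
    (hB : 0 < B.det) (hy : M.PeriodicOnAtoms B y) :
    ∃ c > 0, ∃ R : ℝ, ∀ b ∈ M.bonds, R ≤ ‖b.2 - b.1‖ → c * ‖b.2 - b.1‖ ≤ ‖y b.2 - y b.1‖ := by
  have hker : B.toLinearMap.ker = ⊥ := by
    rw [← LinearMap.isUnit_iff_ker_eq_bot, LinearMap.isUnit_iff_isUnit_det, isUnit_iff_ne_zero]
    exact hB.ne'
  obtain ⟨K, hK, hanti⟩ := LinearMap.exists_antilipschitzWith B.toLinearMap hker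
  obtain ⟨C, hC⟩ : ∃ C, ∀ a ∈ M.atoms, ‖y a - B a‖ ≤ C := by
    obtain ⟨C, hC⟩ := (atoms_finite.image (fun a => ‖y a - B a‖)).bddAbove
    exact ⟨C, fun a ha => hC ⟨a, ha, rfl⟩⟩
  have hK0 : (0 : ℝ) < K := hK
  -- Up to the factor `K`, the length of a bond is at most the deformed length plus `2 * C`; from
  -- the length `4 * C * K` on, the second term absorbs at most half of the bond.
  refine ⟨1 / (2 * K), by positivity, 4 * C * K, fun b hb hR => ?_⟩
  obtain ⟨a, ha, z, hz, hb2⟩ := hb.2.1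
  have h1 := hy a (subset_periodic ha) z hz
  have h2 : y b.2 - y b.1 = B (b.2 - b.1) + ((y a - B a) - (y b.1 - B b.1)) := by
    rw [map_sub, hb2, h1, map_add]; abel
  have h3 : ‖b.2 - b.1‖ ≤ K * ‖B (b.2 - b.1)‖ := hanti.le_mul_norm (map_zero _) (b.2 - b.1)
  have h4 : ‖(y a - B a) - (y b.1 - B b.1)‖ ≤ 2 * C := by
    refine (norm_sub_le _ _).trans ?_
    linarith [hC a ha, hC b.1 hb.1]
  have h5 : ‖B (b.2 - b.1)‖ ≤ ‖y b.2 - y b.1‖ + 2 * C := by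
    have := norm_sub_le (y b.2 - y b.1) ((y a - B a) - (y b.1 - B b.1))
    rw [h2, add_sub_cancel_right] at this
    rw [h2]
    linarith
  have h6 : ‖b.2 - b.1‖ ≤ K * (‖y b.2 - y b.1‖ + 2 * C) :=
    h3.trans (mul_le_mul_of_nonneg_left h5 hK0.le)
  rw [one_div, inv_mul_le_iff₀ (by positivity)]
  linarith

lemma finite_short_bonds (R : ℝ) : {b | b ∈ M.bonds ∧ ‖b.2 - b.1‖ < R}.Finite := by
  obtain ⟨K, hK⟩ := exists_lattice_ball_bound R
  have h1 : {b | b ∈ M.bonds ∧ ‖b.2 - b.1‖ < R} ⊆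
      ⋃ x ∈ M.atoms, (fun x' => (x, x')) '' (lattice ∩ Metric.closedBall x R) := by
    rintro ⟨x, x'⟩ ⟨hb, hR⟩
    refine mem_iUnion₂.2 ⟨x, hb.1, x', ⟨atomsPer_subset_lattice hb.2.1, ?_⟩, rfl⟩
    rw [Metric.mem_closedBall, dist_eq_norm]
    exact hR.le
  refine (atoms_finite.biUnion fun x _ => Finite.image _ ?_).subset h1
  exact Set.finite_of_encard_le_coe (hK x)

/-- The finitely many short bonds, among them all bonds that `y` may collapse, do not affect
summability; the others are dominated by the decay assumption. -/
lemma PeriodicOnAtoms.summable {B : Plane →L[ℝ] Plane} {y : Plane → Plane}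
    (hB : 0 < B.det) (hy : M.PeriodicOnAtoms B y) (hϕ : IsPotential ϕ) {S : Set (Plane × Plane)}
    (hS : S ⊆ M.bonds) : Summable (fun b : S => radial ϕ (y b.1.2 - y b.1.1)) := by
  obtain ⟨c, hc, R, h⟩ := hy.exists_lower_bound hB
  have hfin : {b : S | ‖b.1.2 - b.1.1‖ < R}.Finite := by
    have h1 := (finite_short_bonds (M := M) R).preimage
      (f := ((↑) : S → Plane × Plane)) Subtype.coe_injective.injOn
    exact h1.subset fun b hb => ⟨hS b.2, hb⟩
  rw [← hfin.summable_compl_iff]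
  apply Summable.of_enorm
  have h2 := tsum_bonds_decay_ne_top hϕ hc hS
  refine ne_top_of_le_ne_top h2 ?_
  refine le_trans ?_ (ENNReal.tsum_comp_le_tsum_of_injective
    (f := ((↑) : ({b : S | ‖b.1.2 - b.1.1‖ < R}ᶜ : Set S) → S)) Subtype.coe_injective _)
  refine ENNReal.tsum_le_tsum fun b => enorm_radial_le ?_
  refine h b.1.1 (hS b.1.2) ?_
  exact not_lt.1 b.2

/-- The energy of the continuum bonds is compared with its Cauchy--Born approximation. -/
lemma atomEnergy_sub_acEnergy (hN : 0 < N) {κ : ℝ} (hκ : 0 < κ) (hκ1 : κ ≤ 1)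
    (hF : ∀ T ∈ M.elems, Fat κ T) {B : Plane →L[ℝ] Plane} {y : Plane → Plane} (hB : 0 < B.det)
    (hy : M.PeriodicOnAtoms B y) (hpa : M.PeriodicPA B y) (hμ : 0 < M.muC y)
    (hϕ : IsPotential ϕ) :
    M.atomEnergy ϕ y - M.acEnergy ϕ y = ∑' b : M.contBonds,
      (radial ϕ (y b.1.2 - y b.1.1) - ∫ t in (0 : ℝ)..1,
        radial ϕ (dirDeriv (b.1.2 - b.1.1) y (b.1.1 + t • (b.1.2 - b.1.1)))) := by
  have hcb : M.contBonds ⊆ M.bonds := fun b hb => hb.1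
  have h1 := hy.summable hB hϕ (sdiff_subset : M.atomBonds ⊆ M.bonds)
  have h2 := hy.summable hB hϕ hcb
  have h3 : Summable (fun b : M.contBonds => ∫ t in (0 : ℝ)..1,
      radial ϕ (dirDeriv (b.1.2 - b.1.1) y (b.1.1 + t • (b.1.2 - b.1.1)))) := by
    apply Summable.of_enorm
    refine ne_top_of_le_ne_top (tsum_bonds_decay_ne_top hϕ hμ hcb) ?_
    refine ENNReal.tsum_le_tsum fun b => ?_
    exact enorm_integral_bond_le hN hκ hκ1 hF hpa (contBonds_segment b.2).2
  have h4 : M.atomEnergy ϕ y = ∑' b : M.atomBonds, radial ϕ (y b.1.2 - y b.1.1) +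
      ∑' b : M.contBonds, radial ϕ (y b.1.2 - y b.1.1) := by
    have h5 : M.bonds = M.atomBonds ∪ M.contBonds := (sdiff_union_of_subset hcb).symm
    have h6 : ∑' b : (M.atomBonds ∪ M.contBonds : Set (Plane × Plane)),
        radial ϕ (y b.1.2 - y b.1.1) = ∑' b : M.atomBonds, radial ϕ (y b.1.2 - y b.1.1) +
          ∑' b : M.contBonds, radial ϕ (y b.1.2 - y b.1.1) :=
      Summable.tsum_union_disjoint (f := fun b : Plane × Plane => radial ϕ (y b.2 - y b.1))
        disjoint_sdiff_left h1 h2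
    rw [atomEnergy, ← h6, ← h5]
  rw [h4, acEnergy, h2.tsum_sub h3]
  ring

/-- The consistency estimate for periodic piecewise affine deformations. -/
theorem exists_modelling_error_bound {κ : ℝ} (hκ : 0 < κ) (hκ1 : κ ≤ 1) :
    ∃ c : ℝ≥0, ∀ (N : ℕ) (_ : 0 < N) (M : Mesh N) (_ : ∀ T ∈ M.elems, Fat κ T) (ϕ : ℝ → ℝ)
      (_ : IsPotential ϕ) (B : Plane →L[ℝ] Plane) (y : Plane → Plane), 0 < B.det →
      M.PeriodicOnAtoms B y → M.PeriodicPA B y → 0 < M.muC y →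
      ENNReal.ofReal |M.atomEnergy ϕ y - M.acEnergy ϕ y| ≤
        c * decaySum ϕ (M.muC y) * M.jumpNormSq y := by
  obtain ⟨C, hC⟩ := exists_elems_ball_bound hκ hκ1 2
  obtain ⟨K, hK⟩ := exists_lattice_ball_bound 3
  -- `C ^ 2` is the square of the factor in `bondVar`; `9 * C * ‖r‖` bounds the number of edges near
  -- a bond, and `9 * K * ‖r‖` the number of lattice points near an edge per unit of its length.
  -- With the two powers from the directional derivative this gives `‖r‖ ^ 4`.
  refine ⟨81 * C ^ 3 * K, fun N hN M hF ϕ hϕ B y hB hy hpa hμ => ?_⟩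
  have hCM := hC N M hF
  rw [atomEnergy_sub_acEnergy hN hκ hκ1 hF hB hy hpa hμ hϕ, ← Real.norm_eq_abs, ofReal_norm]
  refine enorm_tsum_le_tsum_enorm.trans ?_
  have h1 : ∀ b : M.contBonds, ‖radial ϕ (y b.1.2 - y b.1.1) - ∫ t in (0 : ℝ)..1,
        radial ϕ (dirDeriv (b.1.2 - b.1.1) y (b.1.1 + t • (b.1.2 - b.1.1)))‖ₑ ≤
      decayM ϕ 2 (M.muC y * ‖b.1.2 - b.1.1‖) * M.bondVar C y b.1.1 (b.1.2 - b.1.1) ^ 2 := by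
    intro b
    have h := enorm_bond_error_le hN hκ hκ1 hF hpa (contBonds_segment b.2).1
      (contBonds_segment b.2).2 hϕ hμ hCM (bondVar_ne_top hCM y _ _)
    rwa [add_sub_cancel] at h
  refine (ENNReal.tsum_le_tsum h1).trans ?_
  refine (tsum_bonds_le (fun x r => decayM ϕ 2 (M.muC y * ‖r‖) * M.bondVar C y x r ^ 2)
    (fun b hb => hb.1)).trans ?_
  rw [decaySum, ← ENNReal.tsum_mul_left, ← ENNReal.tsum_mul_right]
  refine ENNReal.tsum_le_tsum fun r => ?_
  have hr1 : 1 ≤ ‖(r : Plane)‖ := one_le_norm_of_mem_lattice r.2.1 r.2.2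
  rw [ENNReal.tsum_mul_left]
  set n := (⌈‖(r : Plane)‖⌉₊ + 1) * (3 * C) with hn
  have h2 : ∑' x : M.atoms, M.bondVar C y x r ^ 2 ≤
      C ^ 2 * ((n : ℕ) * (‖(r : Plane)‖ₑ ^ 2 *
        (ENNReal.ofReal (9 * K * ‖(r : Plane)‖) * M.jumpNormSq y))) := by
    refine (ENNReal.tsum_le_tsum fun x : M.atoms =>
      bondVar_sq_le hCM y x.1 r).trans ?_
    rw [ENNReal.tsum_mul_left, ENNReal.tsum_mul_left, ENNReal.tsum_mul_left]
    gcongr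
    exact tsum_atoms_jumpSq_le hN hK hpa hr1
  have h3 : (n : ℝ≥0∞) ≤ ENNReal.ofReal (9 * C * ‖(r : Plane)‖) := by
    rw [← ENNReal.ofReal_natCast]
    apply ENNReal.ofReal_le_ofReal
    have := natCeil_add_one_le hr1
    rw [hn, Nat.cast_mul, Nat.cast_mul]
    calc ((⌈‖(r : Plane)‖⌉₊ + 1 : ℕ) : ℝ) * (((3 : ℕ) : ℝ) * C)
        ≤ (3 * ‖(r : Plane)‖) * (((3 : ℕ) : ℝ) * C) := by gcongr
      _ = 9 * C * ‖(r : Plane)‖ := by push_cast; ring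
  have h4 : ∀ m : ℕ, ENNReal.ofReal (9 * m * ‖(r : Plane)‖) = 9 * m * ‖(r : Plane)‖ₑ := by
    intro m
    rw [ENNReal.ofReal_mul (by positivity), ENNReal.ofReal_mul (by positivity), ofReal_norm,
      ENNReal.ofReal_natCast]
    norm_num
  rw [h4] at h2 h3
  calc decayM ϕ 2 (M.muC y * ‖(r : Plane)‖) * ∑' x : M.atoms, M.bondVar C y x r ^ 2
      ≤ decayM ϕ 2 (M.muC y * ‖(r : Plane)‖) * (C ^ 2 * ((9 * C * ‖(r : Plane)‖ₑ) *
          (‖(r : Plane)‖ₑ ^ 2 * (9 * K * ‖(r : Plane)‖ₑ * M.jumpNormSq y)))) := by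
        gcongr
        exact h2.trans (by gcongr)
    _ = _ := by
        push_cast
        ring

end Mesh

/-! ### Affine interpolation and the nodal interpolant. -/

lemma affineMap_sum (A : Plane →ᵃ[ℝ] Plane) (T : Finset Plane) (c : Plane → ℝ)
    (hc : ∑ q ∈ T, c q = 1) : A (∑ q ∈ T, c q • q) = ∑ q ∈ T, c q • A q := by
  have h : ∀ x, A x = A.linear x + A 0 := fun x => by simpa using A.map_vadd 0 x
  have h2 : ∑ q ∈ T, c q • A q = ∑ q ∈ T, (c q • A.linear q + c q • A 0) :=
    Finset.sum_congr rfl fun q _ => by rw [h q, smul_add]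
  rw [h2, h, map_sum, Finset.sum_add_distrib, ← Finset.sum_smul, hc, one_smul]
  congr 1
  exact Finset.sum_congr rfl fun q _ => map_smul _ _ _

lemma affineMap_eqOn_hull {A A' : Plane →ᵃ[ℝ] Plane} {T : Finset Plane}
    (h : ∀ q ∈ T, A q = A' q) {x : Plane} (hx : x ∈ convexHull ℝ (T : Set Plane)) :
    A x = A' x := by
  obtain ⟨c, -, hc, rfl⟩ := Finset.mem_convexHull'.1 hx
  rw [affineMap_sum A T c hc, affineMap_sum A' T c hc]
  exact Finset.sum_congr rfl fun q hq => by rw [h q hq]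

lemma Fat.det2_ne_zero {κ : ℝ} (hκ : 0 < κ) {T : Finset Plane} (h : Fat κ T) {p q r : Plane}
    (hp : p ∈ T) (hq : q ∈ T) (hr : r ∈ T) (hpq : p ≠ q) (hqr : q ≠ r) (hpr : p ≠ r) :
    det2 (p - q) (r - q) ≠ 0 := by
  have h1 := h p hp q hq r hr hpq hqr hpr
  have h2 : 0 < ‖p - q‖ := norm_pos_iff.2 (sub_ne_zero.2 hpq)
  have h3 : 0 < ‖r - q‖ := norm_pos_iff.2 (sub_ne_zero.2 hqr.symm)
  intro h4
  rw [h4, abs_zero] at h1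
  have : 0 < κ * (‖p - q‖ * ‖r - q‖) := by positivity
  linarith

lemma exists_affine_interpolant {κ : ℝ} (hκ : 0 < κ) {T : Finset Plane} (hc : T.card = 3)
    (h : Fat κ T) (y : Plane → Plane) : ∃ A : Plane →ᵃ[ℝ] Plane, ∀ q ∈ T, A q = y q := by
  obtain ⟨p, q, r, hpq, hpr, hqr, rfl⟩ := Finset.card_eq_three.1 hc
  have hD := h.det2_ne_zero hκ (p := q) (q := p) (r := r) (by simp) (by simp) (by simp) hpq.symm
    hpr hqr
  set u := q - p with hu
  set v := r - p with hv
  let L : Plane →ₗ[ℝ] Plane :=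
    { toFun := fun x => (det2 x v / det2 u v) • (y q - y p) + (det2 u x / det2 u v) • (y r - y p)
      map_add' := fun x x' => by simp only [det2_add_left, det2_add_right, add_div]; module
      map_smul' := fun c x => by
        simp only [det2_smul_left, det2_smul_right, mul_div_assoc, RingHom.id_apply]; module }
  have hL : ∀ x, L x = (det2 x v / det2 u v) • (y q - y p) + (det2 u x / det2 u v) • (y r - y p) :=
    fun x => rfl
  let A : Plane →ᵃ[ℝ] Plane := (L.toAffineMap - AffineMap.const ℝ Plane (L p)) +
    AffineMap.const ℝ Plane (y p)
  have hA : ∀ x, A x = L (x - p) + y p := by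
    intro x
    simp only [A, AffineMap.coe_add, AffineMap.coe_sub, Pi.add_apply, Pi.sub_apply,
      LinearMap.coe_toAffineMap, AffineMap.const_apply, map_sub]
  refine ⟨A, ?_⟩
  intro x hx
  rw [hA]
  simp only [Finset.mem_insert, Finset.mem_singleton] at hx
  rcases hx with rfl | rfl | rfl
  · simp
  · rw [← hu, hL, div_self hD, det2_self]; simp
  · rw [← hv, hL, div_self hD, det2_self]; simp

namespace Mesh

variable {N : ℕ} {M : Mesh N}

lemma periodic_of_generators {A : Set Plane} {B : Plane →L[ℝ] Plane} {y : Plane → Plane}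
    (hA : ∀ x ∈ A, ∀ z ∈ lattice, x + (N : ℝ) • z ∈ A)
    (h1 : ∀ x ∈ A, y (x + (N : ℝ) • a1) = y x + B ((N : ℝ) • a1))
    (h2 : ∀ x ∈ A, y (x + (N : ℝ) • a2) = y x + B ((N : ℝ) • a2)) :
    ∀ x ∈ A, ∀ z ∈ lattice, y (x + (N : ℝ) • z) = y x + B ((N : ℝ) • z) := by
  have key : ∀ a ∈ lattice, (∀ x ∈ A, y (x + (N : ℝ) • a) = y x + B ((N : ℝ) • a)) →
      ∀ m : ℤ, ∀ x ∈ A, y (x + (N : ℝ) • (m : ℝ) • a) = y x + B ((N : ℝ) • (m : ℝ) • a) := by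
    intro a ha h m
    induction m with
    | zero => intro x hx; simp
    | succ i ih =>
      intro x hx
      have hm : x + (N : ℝ) • ((i : ℤ) : ℝ) • a ∈ A := by
        refine hA x hx _ ?_
        simpa using nsmul_mem_lattice i ha
      have e : x + (N : ℝ) • (((i : ℤ) + 1 : ℤ) : ℝ) • a =
          x + (N : ℝ) • ((i : ℤ) : ℝ) • a + (N : ℝ) • a := by push_cast; module
      rw [e, h _ hm, ih x hx, add_assoc, ← map_add]
      congr 2; push_cast; module
    | pred i ih =>
      intro x hx
      have hm : x + (N : ℝ) • ((-(i : ℤ) - 1 : ℤ) : ℝ) • a ∈ A := by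
        refine hA x hx _ ?_
        have := neg_mem_lattice (nsmul_mem_lattice (i + 1) ha)
        convert! this using 1
        push_cast; module
      have e : x + (N : ℝ) • ((-(i : ℤ) : ℤ) : ℝ) • a =
          x + (N : ℝ) • ((-(i : ℤ) - 1 : ℤ) : ℝ) • a + (N : ℝ) • a := by push_cast; module
      have h3 := ih x hx
      rw [e, h _ hm] at h3
      have h4 : B ((N : ℝ) • ((-(i : ℤ) : ℤ) : ℝ) • a) =
          B ((N : ℝ) • ((-(i : ℤ) - 1 : ℤ) : ℝ) • a) + B ((N : ℝ) • a) := by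
        rw [← map_add]; congr 1; push_cast; module
      rw [h4, ← add_assoc] at h3
      exact add_right_cancel h3
  rintro x hx z ⟨m, n, rfl⟩
  have hm : x + (N : ℝ) • (m : ℝ) • a1 ∈ A := hA x hx _ ⟨m, 0, by simp⟩
  rw [smul_add, ← add_assoc, key a2 a2_mem_lattice h2 n _ hm, key a1 a1_mem_lattice h1 m x hx,
    map_add, add_assoc]

lemma IsDeformation.periodicOnAtoms {B : Plane →L[ℝ] Plane} {y : Plane → Plane}
    (h : M.IsDeformation B y) : M.PeriodicOnAtoms B y :=
  periodic_of_generators (fun _ hx _ hz => translate_mem_periodic hx hz) h.periodic₁ h.periodic₂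

/-- The vertices determine an affine map on an element, so periodicity at vertices extends by
barycentric coordinates to the whole continuum mesh. -/
lemma IsPA.periodicPA {B : Plane →L[ℝ] Plane} {y : Plane → Plane} (hy : M.IsPA y)
    (h : ∀ T ∈ M.contElemsPer, ∀ q ∈ T, ∀ z ∈ lattice,
      y (q + (N : ℝ) • z) = y q + B ((N : ℝ) • z)) : M.PeriodicPA B y := by
  refine ⟨hy, fun x hx z hz => ?_⟩
  obtain ⟨T, hT, hxT⟩ := mem_iUnion₂.1 hx
  have hT' : translate ((N : ℝ) • z) T ∈ M.contElemsPer := translate_mem_periodicFamily hT hz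
  obtain ⟨A, hA⟩ := hy T hT
  obtain ⟨A', hA'⟩ := hy _ hT'
  have hmem : ∀ w ∈ convexHull ℝ (T : Set Plane), w + (N : ℝ) • z ∈
      convexHull ℝ ((translate ((N : ℝ) • z) T : Finset Plane) : Set Plane) := fun w hw => by
    rw [mem_convexHull_translate, add_sub_cancel_right]; exact hw
  obtain ⟨c, hc0, hc, rfl⟩ := Finset.mem_convexHull'.1 hxT
  rw [hA' _ (hmem _ hxT), hA _ hxT, affineMap_sum A T c hc]
  have h1 : ∑ q ∈ T, c q • q + (N : ℝ) • z = ∑ q ∈ translate ((N : ℝ) • z) T,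
      c (q - (N : ℝ) • z) • q := by
    simp only [translate, Finset.sum_map, addRightEmbedding_apply, add_sub_cancel_right, smul_add,
      Finset.sum_add_distrib, ← Finset.sum_smul, hc, one_smul]
  rw [h1, affineMap_sum A' _ (fun q => c (q - (N : ℝ) • z))
    (by simp [translate, Finset.sum_map, hc])]
  simp only [translate, Finset.sum_map, addRightEmbedding_apply, add_sub_cancel_right]
  have h2 : ∀ q ∈ T, c q • A' (q + (N : ℝ) • z) = c q • A q + c q • B ((N : ℝ) • z) := by
    intro q hq
    have hq' : q ∈ convexHull ℝ (T : Set Plane) := subset_convexHull _ _ hq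
    rw [← hA' _ (hmem q hq'), ← hA q hq', h T hT q hq z hz, smul_add]
  rw [Finset.sum_congr rfl h2, Finset.sum_add_distrib, ← Finset.sum_smul, hc, one_smul]

lemma IsCoarseDeformation.periodicPA (hN : 0 < N) {B : Plane →L[ℝ] Plane} {y : Plane → Plane}
    (hB : M.IsDeformation B y) (h : M.IsCoarseDeformation y) : M.PeriodicPA B y :=
  IsPA.periodicPA h.affine fun _ hT _ hq _ hz =>
    hB.periodicOnAtoms _ (contElemsPer_subset_atomsPer hN hT hq) _ hz

/-! ### The nodal interpolant -/

/-- The choice made in `interp` is harmless: if two elements contain `x`, regularity places `x` in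
the hull of their common vertices, where the two affine interpolants agree. -/
lemma interp_eq {κ : ℝ} (hκ : 0 < κ) (hF : ∀ T ∈ M.elems, Fat κ T) {y : Plane → Plane}
    {T : Finset Plane} (hT : T ∈ M.contElemsPer) {A : Plane →ᵃ[ℝ] Plane}
    (hA : ∀ q ∈ T, A q = y q) {x : Plane} (hx : x ∈ convexHull ℝ (T : Set Plane)) :
    M.interp y x = A x := by
  classical
  have hex : ∃ v, M.IsNodalValue y x v := by
    obtain ⟨c, h1, h2, h3⟩ := Finset.mem_convexHull'.1 hx
    exact ⟨_, T, hT, c, h1, h2, h3, rfl⟩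
  rw [interp, dif_pos hex]
  obtain ⟨T', hT', c, h1, h2, h3, h4⟩ := hex.choose_spec
  obtain ⟨A', hA'⟩ := exists_affine_interpolant hκ (elemsPer_card (contElemsPer_subset hT'))
    (fat_elemsPer hF (contElemsPer_subset hT')) y
  have h5 : hex.choose = A' x := by
    rw [h4, ← h3, affineMap_sum A' T' c h2]
    exact Finset.sum_congr rfl fun q hq => by rw [hA' q hq]
  have hx' : x ∈ convexHull ℝ (T' : Set Plane) := Finset.mem_convexHull'.2 ⟨c, h1, h2, h3⟩
  have hxi : x ∈ convexHull ℝ ((T ∩ T' : Finset Plane) : Set Plane) := by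
    rw [Finset.coe_inter, ← M.regular T (contElemsPer_subset hT) T' (contElemsPer_subset hT')]
    exact ⟨hx, hx'⟩
  rw [h5]
  refine affineMap_eqOn_hull (fun q hq => ?_) hxi
  rw [Finset.mem_inter] at hq
  rw [hA q hq.1, hA' q hq.2]

lemma interp_eq_of_mem {κ : ℝ} (hκ : 0 < κ) (hF : ∀ T ∈ M.elems, Fat κ T) (y : Plane → Plane)
    {T : Finset Plane} (hT : T ∈ M.contElemsPer) {q : Plane} (hq : q ∈ T) :
    M.interp y q = y q := by
  obtain ⟨A, hA⟩ := exists_affine_interpolant hκ (elemsPer_card (contElemsPer_subset hT))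
    (fat_elemsPer hF (contElemsPer_subset hT)) y
  rw [interp_eq hκ hF hT hA (subset_convexHull _ _ hq), hA q hq]

lemma interp_eq_of_notMem {y : Plane → Plane} {x : Plane} (hx : x ∉ hullUnion M.contElemsPer) :
    M.interp y x = y x := by
  rw [interp, dif_neg]
  rintro ⟨v, T, hT, c, h1, h2, h3, -⟩
  exact hx (mem_iUnion₂.2 ⟨T, hT, Finset.mem_convexHull'.2 ⟨c, h1, h2, h3⟩⟩)

lemma interp_isPA {κ : ℝ} (hκ : 0 < κ) (hF : ∀ T ∈ M.elems, Fat κ T) (y : Plane → Plane) :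
    M.IsPA (M.interp y) := by
  intro T hT
  obtain ⟨A, hA⟩ := exists_affine_interpolant hκ (elemsPer_card (contElemsPer_subset hT))
    (fat_elemsPer hF (contElemsPer_subset hT)) y
  exact ⟨A, fun x hx => interp_eq hκ hF hT hA hx⟩

lemma interp_periodicPA (hN : 0 < N) {κ : ℝ} (hκ : 0 < κ) (hF : ∀ T ∈ M.elems, Fat κ T)
    {B : Plane →L[ℝ] Plane} {y : Plane → Plane} (hy : M.PeriodicOnAtoms B y) :
    M.PeriodicPA B (M.interp y) := by
  refine (interp_isPA hκ hF y).periodicPA fun T hT q hq z hz => ?_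
  have hT' : translate ((N : ℝ) • z) T ∈ M.contElemsPer := translate_mem_periodicFamily hT hz
  rw [interp_eq_of_mem hκ hF y hT hq, interp_eq_of_mem hκ hF y hT'
    (by rw [mem_translate, add_sub_cancel_right]; exact hq)]
  exact hy q (contElemsPer_subset_atomsPer hN hT hq) z hz

lemma translate_mem_hullUnion {x z : Plane} (hz : z ∈ lattice)
    (hx : x ∈ hullUnion M.contElemsPer) : x + (N : ℝ) • z ∈ hullUnion M.contElemsPer := by
  obtain ⟨T, hT, hxT⟩ := mem_iUnion₂.1 hx
  refine mem_iUnion₂.2 ⟨_, translate_mem_periodicFamily hT hz, ?_⟩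
  rw [mem_convexHull_translate, add_sub_cancel_right]
  exact hxT

lemma interp_periodicOnAtoms (hN : 0 < N) {κ : ℝ} (hκ : 0 < κ) (hF : ∀ T ∈ M.elems, Fat κ T)
    {B : Plane →L[ℝ] Plane} {y : Plane → Plane} (hy : M.PeriodicOnAtoms B y) :
    M.PeriodicOnAtoms B (M.interp y) := by
  intro x hx z hz
  by_cases h : x ∈ hullUnion M.contElemsPer
  · exact (interp_periodicPA hN hκ hF hy).per x h z hz
  · have h' : x + (N : ℝ) • z ∉ hullUnion M.contElemsPer := by
      intro hc
      have := translate_mem_hullUnion (neg_mem_lattice hz) hc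
      rw [smul_neg, add_neg_cancel_right] at this
      exact h this
    rw [interp_eq_of_notMem h, interp_eq_of_notMem h']
    exact hy x hx z hz

end Mesh

/-! ### Second order Taylor remainders -/

/-- The squared Frobenius norm of the second derivative of `u`. -/
noncomputable def hessSq (u : Plane → Plane) (z : Plane) : ℝ≥0∞ :=
  ∑ i : Fin 2, ∑ j : Fin 2,
    ‖fderiv ℝ (fderiv ℝ u) z (EuclideanSpace.single i 1) (EuclideanSpace.single j 1)‖ₑ ^ 2

lemma enorm_apply_apply_sq_le (D : Plane →L[ℝ] Plane →L[ℝ] Plane) (a b : Plane) :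
    ‖D a b‖ₑ ^ 2 ≤ ‖a‖ₑ ^ 2 * ‖b‖ₑ ^ 2 * ∑ i : Fin 2, ∑ j : Fin 2,
      ‖D (EuclideanSpace.single i 1) (EuclideanSpace.single j 1)‖ₑ ^ 2 := by
  refine (enorm_apply_sq_le (D a) b).trans ?_
  rw [mul_comm (‖a‖ₑ ^ 2), mul_assoc]
  gcongr
  rw [Finset.sum_comm, Finset.mul_sum]
  refine Finset.sum_le_sum fun j _ => ?_
  exact enorm_apply_sq_le (D.flip (EuclideanSpace.single j 1)) a

lemma sq_lintegral_le {α : Type*} [MeasurableSpace α] {μ : Measure α} [IsProbabilityMeasure μ]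
    {g : α → ℝ≥0∞} (hg : AEMeasurable g μ) : (∫⁻ a, g a ∂μ) ^ 2 ≤ ∫⁻ a, g a ^ 2 ∂μ := by
  have h := ENNReal.lintegral_mul_le_Lp_mul_Lq μ (p := 2) (q := 2)
    (Real.HolderConjugate.two_two) hg (aemeasurable_const (b := (1 : ℝ≥0∞)))
  simp only [Pi.mul_apply, mul_one, ENNReal.one_rpow, lintegral_const, measure_univ] at h
  calc (∫⁻ a, g a ∂μ) ^ 2 ≤ ((∫⁻ a, g a ^ (2 : ℝ) ∂μ) ^ (1 / 2 : ℝ)) ^ 2 := by gcongr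
    _ = ∫⁻ a, g a ^ 2 ∂μ := by
      rw [← ENNReal.rpow_natCast, ← ENNReal.rpow_mul]
      norm_num

lemma taylor_remainder_eq {u : Plane → Plane} (hu : ContDiff ℝ 2 u) (x p : Plane) :
    u p - u x - fderiv ℝ u x (p - x) = ∫ t in (0 : ℝ)..1,
      (1 - t) • fderiv ℝ (fderiv ℝ u) (x + t • (p - x)) (p - x) (p - x) := by
  have hd : Differentiable ℝ u := hu.differentiable (by norm_num)
  have hf1 : ContDiff ℝ 1 (fderiv ℝ u) := hu.fderiv_right (by norm_num)
  have hd1 : Differentiable ℝ (fderiv ℝ u) := hf1.differentiable (by norm_num)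
  have hline : ∀ t : ℝ, HasDerivAt (fun t : ℝ => x + t • (p - x)) (p - x) t := fun t => by
    simpa using ((hasDerivAt_id t).smul_const (p - x)).const_add x
  have h1 : ∀ t : ℝ, HasDerivAt (fun t : ℝ => u (x + t • (p - x)))
      (fderiv ℝ u (x + t • (p - x)) (p - x)) t := fun t =>
    (hd _).hasFDerivAt.comp_hasDerivAt t (hline t)
  have h2 : ∀ t : ℝ, HasDerivAt (fun t : ℝ => fderiv ℝ u (x + t • (p - x)) (p - x))
      (fderiv ℝ (fderiv ℝ u) (x + t • (p - x)) (p - x) (p - x)) t := fun t => by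
    have := ((hd1 _).hasFDerivAt.comp_hasDerivAt t (hline t)).clm_apply
      (hasDerivAt_const t (p - x))
    simpa using this
  -- Integration by parts is replaced by an explicit antiderivative of the integrand.
  have h3 : ∀ t : ℝ, HasDerivAt
      (fun t : ℝ => (1 - t) • fderiv ℝ u (x + t • (p - x)) (p - x) + u (x + t • (p - x)))
      ((1 - t) • fderiv ℝ (fderiv ℝ u) (x + t • (p - x)) (p - x) (p - x)) t := fun t => by
    have h4 : HasDerivAt (fun t : ℝ => 1 - t) (-1) t := by
      simpa using (hasDerivAt_id t).const_sub 1
    convert! (h4.smul (h2 t)).add (h1 t) using 1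
    module
  have hcont : Continuous fun t : ℝ =>
      (1 - t) • fderiv ℝ (fderiv ℝ u) (x + t • (p - x)) (p - x) (p - x) := by
    have := hf1.continuous_fderiv (by norm_num)
    fun_prop
  rw [intervalIntegral.integral_eq_sub_of_hasDerivAt (fun t _ => h3 t)
    (hcont.intervalIntegrable _ _)]
  simp only [sub_self, zero_smul, zero_add, one_smul, add_sub_cancel, sub_zero, add_zero]
  abel

lemma continuous_hessSq {u : Plane → Plane} (hu : ContDiff ℝ 2 u) : Continuous (hessSq u) := by
  have hf1 : ContDiff ℝ 1 (fderiv ℝ u) := hu.fderiv_right (by norm_num)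
  have := hf1.continuous_fderiv (by norm_num)
  unfold hessSq
  fun_prop

/-- Cauchy–Schwarz on the unit interval; the weight (1 - t)² is kept because it later cancels a
Jacobian. -/
lemma enorm_taylor_remainder_sq_le {u : Plane → Plane} (hu : ContDiff ℝ 2 u) (x p : Plane) :
    ‖u p - u x - fderiv ℝ u x (p - x)‖ₑ ^ 2 ≤ ‖p - x‖ₑ ^ 4 *
      ∫⁻ t in Ioo (0 : ℝ) 1, ENNReal.ofReal ((1 - t) ^ 2) * hessSq u (x + t • (p - x)) := by
  have hf1 : ContDiff ℝ 1 (fderiv ℝ u) := hu.fderiv_right (by norm_num)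
  have hf2 := hf1.continuous_fderiv (by norm_num)
  have : IsProbabilityMeasure (volume.restrict (Ioc (0 : ℝ) 1)) := ⟨by simp⟩
  rw [taylor_remainder_eq hu, intervalIntegral.integral_of_le zero_le_one]
  refine le_trans (pow_le_pow_left₀ zero_le (enorm_integral_le_lintegral_enorm _) 2) ?_
  refine (sq_lintegral_le (by fun_prop)).trans ?_
  rw [restrict_Ioo_eq_restrict_Ioc, ← lintegral_const_mul _
    (by have := continuous_hessSq hu; fun_prop)]
  refine lintegral_mono fun t => ?_
  rw [enorm_smul, mul_pow, mul_left_comm]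
  have h1 : ‖(1 - t : ℝ)‖ₑ ^ 2 = ENNReal.ofReal ((1 - t) ^ 2) := by
    rw [← ofReal_norm, ← ENNReal.ofReal_pow (norm_nonneg _), Real.norm_eq_abs, sq_abs]
  rw [h1]
  gcongr
  refine (enorm_apply_apply_sq_le _ _ _).trans_eq ?_
  rw [hessSq]
  ring

lemma lintegral_comp_homothety {g : Plane → ℝ≥0∞} (hg : Measurable g) (p : Plane) {s : ℝ}
    (hs : s ≠ 0) : ENNReal.ofReal (s ^ 2) * ∫⁻ x, g (s • x + p) = ∫⁻ x, g x := by
  have h1 : ∫⁻ x, g (s • x + p) = ENNReal.ofReal |(s ^ 2)⁻¹| * ∫⁻ x, g x := by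
    have h2 := Measure.map_addHaar_smul (volume : Measure Plane) hs
    rw [finrank_euclideanSpace_fin] at h2
    rw [← lintegral_add_right_eq_self (μ := volume) g p, ← smul_eq_mul, ← lintegral_smul_measure, ← h2,
      lintegral_map (by fun_prop) (by fun_prop)]
  rw [h1, ← mul_assoc, ← ENNReal.ofReal_mul (sq_nonneg s), abs_of_nonneg (by positivity),
    mul_inv_cancel₀ (by positivity), ENNReal.ofReal_one, one_mul]

/-- For fixed t the map x ↦ (1 - t) x + t p is a homothety of the plane with Jacobian (1 - t)²,
exactly the weight in the Taylor remainder. Each t therefore contributes at most the integral over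
`K`, with no singularity as t → 1. -/
lemma lintegral_taylor_remainder_sq_le {u : Plane → Plane} (hu : ContDiff ℝ 2 u) {S K : Set Plane}
    (hS : MeasurableSet S) (hK : MeasurableSet K) {p : Plane} {h : ℝ≥0}
    (hSK : ∀ x ∈ S, ∀ t ∈ Ioo (0 : ℝ) 1, x + t • (p - x) ∈ K) (hh : ∀ x ∈ S, ‖p - x‖ₑ ≤ h) :
    ∫⁻ x in S, ‖u p - u x - fderiv ℝ u x (p - x)‖ₑ ^ 2 ≤ h ^ 4 * ∫⁻ z in K, hessSq u z := by
  have hc := continuous_hessSq hu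
  set G : Plane → ℝ≥0∞ := K.indicator (hessSq u) with hG
  have hGm : Measurable G := hc.measurable.indicator hK
  have h1 : ∀ x ∈ S, ‖u p - u x - fderiv ℝ u x (p - x)‖ₑ ^ 2 ≤ h ^ 4 *
      ∫⁻ t in Ioo (0 : ℝ) 1, ENNReal.ofReal ((1 - t) ^ 2) * G ((1 - t) • x + t • p) := by
    intro x hx
    refine (enorm_taylor_remainder_sq_le hu x p).trans ?_
    gcongr ?_ ^ 4 * ?_
    · exact hh x hx
    · refine setLIntegral_mono' (measurableSet_Ioo (a := (0 : ℝ)) (b := 1)) fun t ht => ?_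
      have e : (1 - t) • x + t • p = x + t • (p - x) := by module
      rw [e, hG, indicator_of_mem (hSK x hx t ht)]
  have hmeas : Measurable (Function.uncurry fun (x : Plane) (t : ℝ) =>
      ENNReal.ofReal ((1 - t) ^ 2) * G ((1 - t) • x + t • p)) := by
    unfold Function.uncurry
    fun_prop
  calc ∫⁻ x in S, ‖u p - u x - fderiv ℝ u x (p - x)‖ₑ ^ 2
      ≤ ∫⁻ x in S, h ^ 4 *
          ∫⁻ t in Ioo (0 : ℝ) 1, ENNReal.ofReal ((1 - t) ^ 2) * G ((1 - t) • x + t • p) :=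
        setLIntegral_mono' hS h1
    _ ≤ ∫⁻ x, h ^ 4 *
          ∫⁻ t in Ioo (0 : ℝ) 1, ENNReal.ofReal ((1 - t) ^ 2) * G ((1 - t) • x + t • p) :=
        setLIntegral_le_lintegral _ _
    _ = h ^ 4 * ∫⁻ x, ∫⁻ t in Ioo (0 : ℝ) 1,
          ENNReal.ofReal ((1 - t) ^ 2) * G ((1 - t) • x + t • p) :=
        lintegral_const_mul _ hmeas.lintegral_prod_right'
    _ = h ^ 4 * ∫⁻ t in Ioo (0 : ℝ) 1, ∫⁻ x,
          ENNReal.ofReal ((1 - t) ^ 2) * G ((1 - t) • x + t • p) := by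
        rw [lintegral_lintegral_swap hmeas.aemeasurable]
    _ = h ^ 4 * ∫⁻ t in Ioo (0 : ℝ) 1, ∫⁻ z, G z := by
        congr 1
        refine setLIntegral_congr_fun measurableSet_Ioo fun t ht => ?_
        rw [lintegral_const_mul _ (by fun_prop),
          lintegral_comp_homothety hGm _ (sub_ne_zero.2 ht.2.ne')]
    _ = h ^ 4 * ∫⁻ z in K, hessSq u z := by
        rw [hG, lintegral_indicator hK]
        simp

/-- A functional that annihilates affine maps is controlled by second derivatives. -/
lemma volume_mul_enorm_sum_sq_le {ι : Type*} [Fintype ι] {u : Plane → Plane} (hu : ContDiff ℝ 2 u)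
    {S K : Set Plane} (hS : MeasurableSet S) (hK : MeasurableSet K) {p : ι → Plane} {c : ι → ℝ}
    (hc0 : ∑ i, c i = 0) (hc1 : ∑ i, c i • p i = 0) {h C : ℝ≥0}
    (hSK : ∀ i, ∀ x ∈ S, ∀ t ∈ Ioo (0 : ℝ) 1, x + t • (p i - x) ∈ K)
    (hh : ∀ i, ∀ x ∈ S, ‖p i - x‖ₑ ≤ h) (hC : ∀ i, ‖c i‖ₑ ≤ C) :
    volume S * ‖∑ i, c i • u (p i)‖ₑ ^ 2 ≤
      (Fintype.card ι : ℝ≥0∞) ^ 2 * C ^ 2 * h ^ 4 * ∫⁻ z in K, hessSq u z := by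
  set R : ι → Plane → Plane := fun i x => u (p i) - u x - fderiv ℝ u x (p i - x) with hR
  have hcont : ∀ i, Continuous (R i) := fun i => by
    have h1 := hu.continuous
    have h2 := hu.continuous_fderiv (by norm_num)
    simp only [hR]
    fun_prop
  -- The coefficients have vanishing zeroth and first moments, so the affine Taylor polynomial at
  -- any `x` drops out.
  have hsum : ∀ x, ∑ i, c i • u (p i) = ∑ i, c i • R i x := by
    intro x
    have h1 : ∑ i, c i • R i x = ∑ i, c i • u (p i) - (∑ i, c i) • u x -
        fderiv ℝ u x (∑ i, c i • p i - (∑ i, c i) • x) := by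
      simp only [hR, smul_sub, Finset.sum_sub_distrib, Finset.sum_smul, map_sub, map_sum, map_smul]
    rw [h1, hc0, hc1]
    simp
  have hpt : ∀ x, ‖∑ i, c i • u (p i)‖ₑ ^ 2 ≤
      (Fintype.card ι : ℝ≥0∞) * C ^ 2 * ∑ i, ‖R i x‖ₑ ^ 2 := by
    intro x
    rw [hsum x]
    have h1 : ‖∑ i, c i • R i x‖ ≤ C * ∑ i, ‖R i x‖ := by
      rw [Finset.mul_sum]
      refine (norm_sum_le _ _).trans (Finset.sum_le_sum fun i _ => ?_)
      rw [norm_smul]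
      gcongr
      have := hC i
      rw [enorm_le_coe] at this
      exact_mod_cast this
    have h2 : ‖∑ i, c i • R i x‖ ^ 2 ≤ (Fintype.card ι : ℝ) * C ^ 2 * ∑ i, ‖R i x‖ ^ 2 := by
      calc ‖∑ i, c i • R i x‖ ^ 2 ≤ (C * ∑ i, ‖R i x‖) ^ 2 := by gcongr
        _ = C ^ 2 * (∑ i, ‖R i x‖) ^ 2 := by ring
        _ ≤ C ^ 2 * ((Fintype.card ι : ℝ) * ∑ i, ‖R i x‖ ^ 2) := by
          gcongr
          exact sq_sum_le_card_mul_sum_sq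
        _ = _ := by ring
    have h3 := ENNReal.ofReal_le_ofReal h2
    rw [ENNReal.ofReal_mul (by positivity), ENNReal.ofReal_mul (by positivity),
      ENNReal.ofReal_sum_of_nonneg (fun i _ => by positivity), ENNReal.ofReal_natCast,
      ENNReal.ofReal_pow (by positivity), ENNReal.ofReal_pow (by positivity),
      ENNReal.ofReal_coe_nnreal, ofReal_norm] at h3
    refine h3.trans_eq ?_
    congr 1
    exact Finset.sum_congr rfl fun i _ => by
      rw [ENNReal.ofReal_pow (norm_nonneg _), ofReal_norm]
  calc volume S * ‖∑ i, c i • u (p i)‖ₑ ^ 2 = ∫⁻ x in S, ‖∑ i, c i • u (p i)‖ₑ ^ 2 := by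
        rw [setLIntegral_const, mul_comm]
    _ ≤ ∫⁻ x in S, (Fintype.card ι : ℝ≥0∞) * C ^ 2 * ∑ i, ‖R i x‖ₑ ^ 2 :=
        lintegral_mono fun x => hpt x
    _ = (Fintype.card ι : ℝ≥0∞) * C ^ 2 * ∑ i, ∫⁻ x in S, ‖R i x‖ₑ ^ 2 := by
        rw [lintegral_const_mul _ (by fun_prop), lintegral_finsetSum _ (by fun_prop)]
    _ ≤ (Fintype.card ι : ℝ≥0∞) * C ^ 2 * ∑ i : ι, h ^ 4 * ∫⁻ z in K, hessSq u z := by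
        gcongr with i
        exact lintegral_taylor_remainder_sq_le hu hS hK (hSK i) (hh i)
    _ = _ := by
        rw [Finset.sum_const, Finset.card_univ, nsmul_eq_mul]
        ring

/-! ### Two adjacent triangles -/

lemma mem_triangle_iff {p q r x : Plane} : x ∈ convexHull ℝ ({p, q, r} : Set Plane) ↔
    ∃ a b : ℝ, 0 ≤ a ∧ 0 ≤ b ∧ a + b ≤ 1 ∧ x = p + a • (q - p) + b • (r - p) := by
  rw [convexHull_insert ⟨q, by simp⟩, convexHull_pair, mem_convexJoin]
  simp only [mem_singleton_iff, exists_eq_left, segment_eq_image', mem_image, mem_Icc]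
  constructor
  · rintro ⟨_, ⟨s, hs, rfl⟩, t, ht, rfl⟩
    refine ⟨t * (1 - s), t * s, mul_nonneg ht.1 (sub_nonneg.2 hs.2), mul_nonneg ht.1 hs.1, ?_, ?_⟩
    · nlinarith [ht.2]
    · module
  · rintro ⟨a, b, ha, hb, hab, rfl⟩
    rcases eq_or_lt_of_le (add_nonneg ha hb) with h0 | h0
    · have ha0 : a = 0 := by linarith
      have hb0 : b = 0 := by linarith
      exact ⟨q, ⟨0, by simp, by simp⟩, 0, by simp, by simp [ha0, hb0]⟩
    · refine ⟨_, ⟨b / (a + b), ⟨by positivity, (div_le_one h0).2 (by linarith)⟩, rfl⟩, a + b,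
        ⟨h0.le, hab⟩, ?_⟩
      have e : (a + b) • ((b / (a + b)) • (r - q)) = b • (r - q) := by
        rw [smul_smul, mul_div_cancel₀ _ h0.ne']
      rw [add_sub_right_comm, smul_add, e]
      module

/-- Coordinates refer to the common edge e and the edge v of the first triangle: (A, b) is a start
near the midpoint of e, and (α, β) with β < 0 is the opposite vertex q of the second triangle. The
path to q stays on the side of v only up to t ≤ κ²/8, too short a time for its first coordinate to
leave the edge. -/
lemma path_coords_above {κ α β A b t : ℝ} (hκ : 0 < κ) (hκ1 : κ ≤ 1) (hα : κ ^ 2 * |α| ≤ 1)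
    (hβ : β ≤ -κ ^ 3) (hb0 : 0 ≤ b) (hb : b ≤ κ ^ 5 / 8) (hA : 7 / 16 ≤ A) (hAb : A + b ≤ 9 / 16)
    (ht0 : 0 ≤ t) (ht1 : t ≤ 1) (h : 0 ≤ (1 - t) * b + t * β) :
    0 ≤ (1 - t) * A + t * α ∧ (1 - t) * A + t * α + ((1 - t) * b + t * β) ≤ 1 := by
  have h1 : t * κ ^ 3 ≤ κ ^ 5 / 8 := by nlinarith
  have h2 : t ≤ κ ^ 2 / 8 := by
    have h3 : 0 < κ ^ 3 := by positivity
    refine le_of_mul_le_mul_right ?_ h3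
    calc t * κ ^ 3 ≤ κ ^ 5 / 8 := h1
      _ = κ ^ 2 / 8 * κ ^ 3 := by ring
  have h3 : t * |α| ≤ 1 / 8 := by nlinarith [abs_nonneg α]
  have h4 : |t * α| ≤ 1 / 8 := by rwa [abs_mul, abs_of_nonneg ht0]
  have h5 : t ≤ 1 / 8 := by nlinarith
  have h6 := abs_le.1 h4
  have h7 : t * β ≤ 0 := mul_nonpos_of_nonneg_of_nonpos ht0 (by nlinarith [pow_pos hκ 3])
  constructor
  · nlinarith
  · nlinarith

/-- On the other side the path is described in the basis e, q: writing b = -γβ turns the start into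
(A + αγ, -γ) with γ small, so the first coordinate is still near the middle of the edge. -/
lemma path_coords_below {κ α β A b t : ℝ} (hκ : 0 < κ) (hα : κ ^ 2 * |α| ≤ 1)
    (hβ : β ≤ -κ ^ 3) (hb0 : 0 ≤ b) (hb : b ≤ κ ^ 5 / 8) (hA : 7 / 16 ≤ A) (hAb : A + b ≤ 9 / 16)
    (ht1 : t ≤ 1) (h : (1 - t) * b + t * β ≤ 0) :
    ∃ γ : ℝ, b = -γ * β ∧ 0 ≤ (1 - t) * (A + α * γ) ∧ 0 ≤ t - (1 - t) * γ ∧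
      (1 - t) * (A + α * γ) + (t - (1 - t) * γ) ≤ 1 := by
  have hκ3 : 0 < κ ^ 3 := by positivity
  have hβ0 : β < 0 := by linarith
  obtain ⟨γ, hγ⟩ : ∃ γ, b = -γ * β := ⟨-(b / β), by
    rw [neg_neg, div_mul_cancel₀ _ hβ0.ne]⟩
  have hγ0 : 0 ≤ γ := by
    by_contra! hc
    nlinarith
  have h2 : γ ≤ κ ^ 2 / 8 := by
    refine le_of_mul_le_mul_right ?_ hκ3
    calc γ * κ ^ 3 ≤ -γ * β := by nlinarith
      _ ≤ κ ^ 2 / 8 * κ ^ 3 := by rw [← hγ]; refine hb.trans_eq (by ring)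
  have h3 : γ * |α| ≤ 1 / 8 := by nlinarith [abs_nonneg α]
  have h4 : |α * γ| ≤ 1 / 8 := by rw [abs_mul, abs_of_nonneg hγ0]; linarith
  have h6 := abs_le.1 h4
  refine ⟨γ, hγ, mul_nonneg (by linarith) (by linarith), ?_, ?_⟩
  · rw [hγ] at h
    have : β * (t - (1 - t) * γ) ≤ 0 := by linarith
    by_contra! hc
    nlinarith
  · have : (1 - t) * (1 - (A + α * γ) + γ) ≥ 0 := mul_nonneg (by linarith) (by linarith)
    nlinarith

/-- Coordinates of the vertices of two adjacent triangles with common edge `p, p + e`. -/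
structure AdjacentPair (κ : ℝ) (e v q : Plane) (α β : ℝ) : Prop where
  eq : q = α • e + β • v
  alpha_le : κ ^ 2 * |α| ≤ 1
  beta_le : β ≤ -κ ^ 3
  le_beta : κ ^ 3 * |β| ≤ 1
  det_ge : κ * (‖e‖ * ‖v‖) ≤ |det2 e v|
  det_ge' : κ * (‖e‖ * ‖q‖) ≤ |det2 e q|
  norm_v_le : κ * ‖v‖ ≤ ‖e‖
  norm_q_le : κ * ‖q‖ ≤ ‖e‖
  le_norm_v : κ * ‖e‖ ≤ ‖v‖
  le_norm_q : κ * ‖e‖ ≤ ‖q‖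
  norm_e_pos : 0 < ‖e‖

/-- The coordinates of q are quotients of area forms, so fatness bounds them. Negativity of β says
that the triangles lie on opposite sides of the common edge, and this is where regularity enters. -/
lemma exists_adjacentPair {κ : ℝ} (hκ : 0 < κ) {p₀ p₁ p₂ p₃ : Plane}
    (h01 : p₀ ≠ p₁) (h02 : p₀ ≠ p₂) (h03 : p₀ ≠ p₃) (h12 : p₁ ≠ p₂) (h13 : p₁ ≠ p₃)
    (h23 : p₂ ≠ p₃) (hT : Fat κ {p₀, p₁, p₂}) (hT' : Fat κ {p₀, p₁, p₃})
    (hreg : convexHull ℝ ({p₀, p₁, p₂} : Set Plane) ∩ convexHull ℝ ({p₀, p₁, p₃} : Set Plane) =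
      convexHull ℝ (({p₀, p₁, p₂} : Set Plane) ∩ {p₀, p₁, p₃})) :
    ∃ α β : ℝ, AdjacentPair κ (p₁ - p₀) (p₂ - p₀) (p₃ - p₀) α β := by
  set e := p₁ - p₀ with he
  set v := p₂ - p₀ with hv
  set q := p₃ - p₀ with hq
  have dv : κ * (‖e‖ * ‖v‖) ≤ |det2 e v| :=
    hT p₁ (by simp) p₀ (by simp) p₂ (by simp) h01.symm h02 h12
  have dq : κ * (‖e‖ * ‖q‖) ≤ |det2 e q| :=
    hT' p₁ (by simp) p₀ (by simp) p₃ (by simp) h01.symm h03 h13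
  have hep : 0 < ‖e‖ := norm_pos_iff.2 (sub_ne_zero.2 h01.symm)
  have hvp : 0 < ‖v‖ := norm_pos_iff.2 (sub_ne_zero.2 h02.symm)
  have hqp : 0 < ‖q‖ := norm_pos_iff.2 (sub_ne_zero.2 h03.symm)
  have n1 : κ * ‖v‖ ≤ ‖e‖ := by
    have := hT.norm_le (p := p₀) (q := p₂) (r := p₁) (by simp) (by simp) (by simp) h02 h12.symm h01
    rwa [norm_sub_rev, norm_sub_rev p₀ p₁] at this
  have n2 : κ * ‖e‖ ≤ ‖v‖ := by
    have := hT.norm_le (p := p₀) (q := p₁) (r := p₂) (by simp) (by simp) (by simp) h01 h12 h02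
    rwa [norm_sub_rev, norm_sub_rev p₀ p₂] at this
  have n3 : κ * ‖q‖ ≤ ‖e‖ := by
    have := hT'.norm_le (p := p₀) (q := p₃) (r := p₁) (by simp) (by simp) (by simp) h03 h13.symm h01
    rwa [norm_sub_rev, norm_sub_rev p₀ p₁] at this
  have n4 : κ * ‖e‖ ≤ ‖q‖ := by
    have := hT'.norm_le (p := p₀) (q := p₁) (r := p₃) (by simp) (by simp) (by simp) h01 h13 h03
    rwa [norm_sub_rev, norm_sub_rev p₀ p₃] at this
  have hD0 : 0 < |det2 e v| := lt_of_lt_of_le (by positivity) dv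
  have hD : det2 e v ≠ 0 := abs_pos.1 hD0
  have hD3 : det2 e q ≠ 0 := abs_pos.1 (lt_of_lt_of_le (by positivity) dq)
  obtain ⟨α, β, hα, hβ⟩ : ∃ α β, α = det2 q v / det2 e v ∧ β = det2 e q / det2 e v :=
    ⟨_, _, rfl, rfl⟩
  have hcomb : q = α • e + β • v := by rw [hα, hβ]; exact eq_comb_of_det2_ne_zero hD q
  have hβ0 : β ≠ 0 := by rw [hβ]; exact div_ne_zero hD3 hD
  have hβneg : β < 0 := by
    by_contra! hc
    have hβp : 0 < β := lt_of_le_of_ne hc hβ0.symm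
    -- If β were positive, this `s` is small enough for the point p₀ + e/2 + sβ v to lie in both
    -- triangles although it is not on the common edge.
    obtain ⟨s, hs⟩ : ∃ s : ℝ, s = 1 / (4 * (1 + |α| + β)) := ⟨_, rfl⟩
    have hden : 0 < 4 * (1 + |α| + β) := by positivity
    have hs0 : 0 < s := by rw [hs]; positivity
    have hs1 : s * (1 + |α| + β) = 1 / 4 := by rw [hs]; field_simp
    have habs := neg_abs_le α
    have habs' := le_abs_self α
    have hx1 : p₀ + (1 / 2 : ℝ) • e + (s * β) • v ∈ convexHull ℝ ({p₀, p₁, p₂} : Set Plane) :=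
      mem_triangle_iff.2 ⟨1 / 2, s * β, by norm_num, by positivity, by
        nlinarith [abs_nonneg α], rfl⟩
    have hx2 : p₀ + (1 / 2 : ℝ) • e + (s * β) • v ∈ convexHull ℝ ({p₀, p₁, p₃} : Set Plane) := by
      refine mem_triangle_iff.2 ⟨1 / 2 - s * α, s, ?_, hs0.le, ?_, ?_⟩
      · nlinarith
      · nlinarith
      · rw [← he, ← hq, hcomb]; module
    have hx3 : p₀ + (1 / 2 : ℝ) • e + (s * β) • v ∈ convexHull ℝ ({p₀, p₁} : Set Plane) := by
      have : ({p₀, p₁, p₂} : Set Plane) ∩ {p₀, p₁, p₃} ⊆ {p₀, p₁} := by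
        rintro x ⟨hx, hx'⟩
        simp only [mem_insert_iff, mem_singleton_iff] at hx hx' ⊢
        rcases hx with h | h | h
        · exact Or.inl h
        · exact Or.inr h
        · subst h
          rcases hx' with h | h | h
          · exact Or.inl h
          · exact Or.inr h
          · exact absurd h h23
      exact convexHull_mono this (hreg ▸ ⟨hx1, hx2⟩)
    rw [convexHull_pair, segment_eq_image'] at hx3
    obtain ⟨θ, -, hθ⟩ := hx3
    simp only [← he] at hθ
    have h5 : θ • e = (1 / 2 : ℝ) • e + (s * β) • v := by
      rw [add_assoc] at hθ
      exact add_left_cancel hθ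
    have h6 := congrArg (det2 e) h5
    rw [det2_add_right, det2_smul_right, det2_smul_right, det2_smul_right, det2_self] at h6
    simp only [mul_zero, zero_add] at h6
    exact mul_ne_zero (mul_ne_zero hs0.ne' hβ0) hD h6.symm
  have hαabs : |α| * |det2 e v| = |det2 q v| := by
    rw [hα, abs_div, div_mul_cancel₀ _ hD0.ne']
  have hβabs : |β| * |det2 e v| = |det2 e q| := by
    rw [hβ, abs_div, div_mul_cancel₀ _ hD0.ne']
  have hqv := abs_det2_le q v
  have heq := abs_det2_le e q
  have hev := abs_det2_le e v
  have hev0 : 0 < ‖e‖ * ‖v‖ := by positivity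
  refine ⟨α, β, hcomb, ?_, ?_, ?_, dv, dq, n1, n3, n2, n4, hep⟩
  · refine le_of_mul_le_mul_right (a := ‖e‖ * ‖v‖) ?_ hev0
    calc κ ^ 2 * |α| * (‖e‖ * ‖v‖) = κ * |α| * (κ * (‖e‖ * ‖v‖)) := by ring
      _ ≤ κ * |α| * |det2 e v| := by gcongr
      _ = κ * |det2 q v| := by rw [← hαabs]; ring
      _ ≤ κ * (‖q‖ * ‖v‖) := by gcongr
      _ = κ * ‖q‖ * ‖v‖ := by ring
      _ ≤ ‖e‖ * ‖v‖ := by gcongr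
      _ = 1 * (‖e‖ * ‖v‖) := by ring
  · have h1 : κ ^ 3 ≤ |β| := by
      refine le_of_mul_le_mul_right (a := ‖e‖ * ‖v‖) ?_ hev0
      calc κ ^ 3 * (‖e‖ * ‖v‖) = κ * (‖e‖ * (κ * (κ * ‖v‖))) := by ring
        _ ≤ κ * (‖e‖ * (κ * ‖e‖)) := by gcongr
        _ ≤ κ * (‖e‖ * ‖q‖) := by gcongr
        _ ≤ |det2 e q| := dq
        _ = |β| * |det2 e v| := hβabs.symm
        _ ≤ |β| * (‖e‖ * ‖v‖) := by gcongr
    rw [abs_of_neg hβneg] at h1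
    linarith
  · refine le_of_mul_le_mul_right (a := ‖e‖ * ‖v‖) ?_ hev0
    calc κ ^ 3 * |β| * (‖e‖ * ‖v‖) = κ ^ 2 * |β| * (κ * (‖e‖ * ‖v‖)) := by ring
      _ ≤ κ ^ 2 * |β| * |det2 e v| := by gcongr
      _ = κ ^ 2 * |det2 e q| := by rw [← hβabs]; ring
      _ ≤ κ ^ 2 * (‖e‖ * ‖q‖) := by gcongr
      _ = κ * ‖q‖ * (κ * ‖e‖) := by ring
      _ ≤ ‖e‖ * ‖v‖ := by gcongr
      _ = 1 * (‖e‖ * ‖v‖) := by ring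

namespace AdjacentPair

variable {κ : ℝ} {e v q : Plane} {α β : ℝ}

/-- A jump of gradients across the common edge is controlled by the second difference. -/
lemma frobSq_le (hκ : 0 < κ) (h : AdjacentPair κ e v q α β) {G : Plane →L[ℝ] Plane}
    (hG : G e = 0) : frobSq G ≤ ‖(2 / (κ ^ 2 * ‖e‖)) • G q‖ₑ ^ 2 := by
  have he := h.norm_e_pos
  have hqp : 0 < ‖q‖ := lt_of_lt_of_le (by positivity) h.le_norm_q
  have hD0 : 0 < |det2 e q| := lt_of_lt_of_le (by positivity) h.det_ge'
  have hD : det2 e q ≠ 0 := abs_pos.1 hD0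
  have hGx : ∀ x : Plane, ‖x‖ ≤ 1 → ‖G x‖ ≤ 1 / (κ ^ 2 * ‖e‖) * ‖G q‖ := by
    intro x hx
    rw [eq_comb_of_det2_ne_zero hD x, map_add, map_smul, map_smul, hG, smul_zero, zero_add,
      norm_smul, Real.norm_eq_abs, abs_div]
    gcongr ?_ * _
    rw [div_le_div_iff₀ hD0 (by positivity), one_mul]
    calc |det2 e x| * (κ ^ 2 * ‖e‖) ≤ ‖e‖ * ‖x‖ * (κ ^ 2 * ‖e‖) := by
          gcongr; exact abs_det2_le e x
      _ ≤ ‖e‖ * 1 * (κ ^ 2 * ‖e‖) := by gcongr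
      _ = κ * (‖e‖ * (κ * ‖e‖)) := by ring
      _ ≤ κ * (‖e‖ * ‖q‖) := by gcongr; exact h.le_norm_q
      _ ≤ |det2 e q| := h.det_ge'
  have hsum : ∑ i : Fin 2, ‖G (EuclideanSpace.single i 1)‖ ^ 2 ≤
      ‖(2 / (κ ^ 2 * ‖e‖)) • G q‖ ^ 2 := by
    have h1 : ∀ i : Fin 2, ‖G (EuclideanSpace.single i 1)‖ ^ 2 ≤
        (1 / (κ ^ 2 * ‖e‖) * ‖G q‖) ^ 2 := fun i => by
      gcongr
      exact hGx _ (by simp)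
    rw [norm_smul, Real.norm_eq_abs, abs_of_pos (by positivity), Fin.sum_univ_two]
    calc _ ≤ (1 / (κ ^ 2 * ‖e‖) * ‖G q‖) ^ 2 + (1 / (κ ^ 2 * ‖e‖) * ‖G q‖) ^ 2 :=
          add_le_add (h1 0) (h1 1)
      _ ≤ 4 * (1 / (κ ^ 2 * ‖e‖) * ‖G q‖) ^ 2 := by
          nlinarith [sq_nonneg (1 / (κ ^ 2 * ‖e‖) * ‖G q‖)]
      _ = _ := by ring
  have h2 := ENNReal.ofReal_le_ofReal hsum
  rw [ENNReal.ofReal_sum_of_nonneg (fun i _ => by positivity),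
    ENNReal.ofReal_pow (norm_nonneg _), ofReal_norm] at h2
  refine le_trans (le_of_eq ?_) h2
  exact Finset.sum_congr rfl fun i _ => by rw [ENNReal.ofReal_pow (norm_nonneg _), ofReal_norm]

/-- The vertices of the first triangle are visible by convexity; the path to q is split where it
crosses the line through the common edge. -/
lemma path_mem (hκ : 0 < κ) (hκ1 : κ ≤ 1) (h : AdjacentPair κ e v q α β) (p : Plane) {A b t : ℝ}
    (hb0 : 0 ≤ b) (hb : b ≤ κ ^ 5 / 8) (hA : 7 / 16 ≤ A) (hAb : A + b ≤ 9 / 16)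
    (ht : t ∈ Ioo (0 : ℝ) 1) (i : Fin 4) :
    (p + A • e + b • v) + t • ((![p, p + e, p + v, p + q] : Fin 4 → Plane) i -
      (p + A • e + b • v)) ∈ convexHull ℝ ({p, p + e, p + v} : Set Plane) ∪
        convexHull ℝ ({p, p + e, p + q} : Set Plane) := by
  have hx : p + A • e + b • v ∈ convexHull ℝ ({p, p + e, p + v} : Set Plane) :=
    mem_triangle_iff.2 ⟨A, b, by linarith, hb0, by linarith, by simp⟩
  have hconv : ∀ y ∈ ({p, p + e, p + v} : Set Plane), (p + A • e + b • v) +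
      t • (y - (p + A • e + b • v)) ∈ convexHull ℝ ({p, p + e, p + v} : Set Plane) :=
    fun y hy => (convex_convexHull ℝ _).add_smul_sub_mem hx (subset_convexHull _ _ hy)
      ⟨ht.1.le, ht.2.le⟩
  fin_cases i
  · exact Or.inl (hconv _ (by simp))
  · exact Or.inl (hconv _ (by simp))
  · exact Or.inl (hconv _ (by simp))
  · rcases le_total 0 ((1 - t) * b + t * β) with h0 | h0
    · obtain ⟨h1, h2⟩ := path_coords_above hκ hκ1 h.alpha_le h.beta_le hb0 hb hA hAb ht.1.le
        ht.2.le h0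
      refine Or.inl (mem_triangle_iff.2 ⟨_, _, h1, h0, h2, ?_⟩)
      simp only [Fin.reduceFinMk, Matrix.cons_val, h.eq]
      module
    · obtain ⟨γ, hγ, h1, h2, h3⟩ := path_coords_below hκ h.alpha_le h.beta_le hb0 hb hA hAb
        ht.2.le h0
      refine Or.inr (mem_triangle_iff.2 ⟨_, _, h1, h2, h3, ?_⟩)
      simp only [Fin.reduceFinMk, Matrix.cons_val, h.eq, hγ]
      module

lemma norm_sub_le (hκ : 0 < κ) (hκ1 : κ ≤ 1) (h : AdjacentPair κ e v q α β) (p : Plane) {A b : ℝ}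
    (hb0 : 0 ≤ b) (hA : 7 / 16 ≤ A) (hAb : A + b ≤ 9 / 16) (i : Fin 4) :
    ‖(![p, p + e, p + v, p + q] : Fin 4 → Plane) i - (p + A • e + b • v)‖ ≤ 3 * ‖e‖ / κ := by
  have he : ‖e‖ ≤ ‖e‖ / κ := by
    rw [le_div_iff₀ hκ]
    exact mul_le_of_le_one_right (norm_nonneg _) hκ1
  have hv : ‖v‖ ≤ ‖e‖ / κ := by rw [le_div_iff₀ hκ, mul_comm]; exact h.norm_v_le
  have hq : ‖q‖ ≤ ‖e‖ / κ := by rw [le_div_iff₀ hκ, mul_comm]; exact h.norm_q_le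
  have h1 : ‖A • e + b • v‖ ≤ 2 * (‖e‖ / κ) := by
    refine (norm_add_le _ _).trans ?_
    rw [norm_smul, norm_smul, Real.norm_eq_abs, Real.norm_eq_abs, abs_of_nonneg hb0,
      abs_of_nonneg (by linarith : (0 : ℝ) ≤ A)]
    have := norm_nonneg e
    have := norm_nonneg v
    nlinarith
  have key : ∀ w : Plane, ‖w‖ ≤ ‖e‖ / κ → ‖p + w - (p + A • e + b • v)‖ ≤ 3 * ‖e‖ / κ := by
    intro w hw
    have e1 : p + w - (p + A • e + b • v) = w - (A • e + b • v) := by abel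
    rw [e1]
    refine (_root_.norm_sub_le _ _).trans ?_
    rw [mul_div_assoc]
    linarith
  fin_cases i
  · simpa using key 0 (by rw [norm_zero]; exact (norm_nonneg _).trans he)
  · exact key e he
  · exact key v hv
  · exact key q hq

lemma coeff_le (hκ : 0 < κ) (hκ1 : κ ≤ 1) (h : AdjacentPair κ e v q α β) (i : Fin 4) :
    |(![-(1 - α - β), -α, -β, 1] : Fin 4 → ℝ) i| ≤ 3 / κ ^ 3 := by
  have hκ3 : κ ^ 3 ≤ 1 := pow_le_one₀ hκ.le hκ1
  have h3 : 0 < κ ^ 3 := by positivity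
  have h0 : 1 ≤ 1 / κ ^ 3 := by rwa [le_div_iff₀ h3, one_mul]
  have hα : |α| ≤ 1 / κ ^ 3 := by
    rw [le_div_iff₀ h3]
    calc |α| * κ ^ 3 = κ ^ 2 * |α| * κ := by ring
      _ ≤ 1 * 1 := by gcongr; exact h.alpha_le
      _ = 1 := one_mul 1
  have hβ : |β| ≤ 1 / κ ^ 3 := by rw [le_div_iff₀ h3, mul_comm]; exact h.le_beta
  have e3 : 3 / κ ^ 3 = 3 * (1 / κ ^ 3) := by ring
  rw [e3]
  have hα' := abs_le.1 hα
  have hβ' := abs_le.1 hβ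
  fin_cases i <;> simp only [Fin.reduceFinMk, Fin.zero_eta, Fin.mk_one, Matrix.cons_val] <;>
    rw [abs_le] <;> constructor <;> linarith

/-- The area of `S` is at least of order |e|², the coefficients are at most of order 1/|e| and the
distances at most of order |e|, so all powers of |e| cancel and the constant depends on κ only. The
number 46656 is 4² · 6² · 3⁴. -/
lemma enorm_sum_sq_le (hκ : 0 < κ) (hκ1 : κ ≤ 1) (h : AdjacentPair κ e v q α β) (p : Plane)
    {u : Plane → Plane} (hu : ContDiff ℝ 2 u) :
    ‖∑ i : Fin 4, (2 / (κ ^ 2 * ‖e‖) * (![-(1 - α - β), -α, -β, 1] : Fin 4 → ℝ) i) •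
        u ((![p, p + e, p + v, p + q] : Fin 4 → Plane) i)‖ₑ ^ 2 ≤
      ENNReal.ofReal (46656 / κ ^ 14) / (ENNReal.ofReal ((κ ^ 5 / 8) ^ 2 * κ ^ 2) * unitArea) *
        ∫⁻ z in convexHull ℝ ({p, p + e, p + v} : Set Plane) ∪
          convexHull ℝ ({p, p + e, p + q} : Set Plane), hessSq u z := by
  have he := h.norm_e_pos
  obtain ⟨δ, hδ⟩ : ∃ δ : ℝ, δ = κ ^ 5 / 8 := ⟨_, rfl⟩
  have hδ0 : 0 < δ := by rw [hδ]; positivity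
  have hδ1 : δ ≤ 1 / 8 := by
    have : κ ^ 5 ≤ 1 := pow_le_one₀ hκ.le hκ1
    rw [hδ]; linarith
  -- With this base point the base of the small triangle is centred at the midpoint of the common
  -- edge.
  set P := p + ((1 - δ) / 2) • e with hP
  set S := convexHull ℝ ({P, P + δ • e, P + δ • v} : Set Plane) with hS
  have hSx : ∀ x ∈ S, ∃ A b : ℝ, 0 ≤ b ∧ b ≤ κ ^ 5 / 8 ∧ 7 / 16 ≤ A ∧ A + b ≤ 9 / 16 ∧
      x = p + A • e + b • v := by
    intro x hx
    obtain ⟨a, b, ha, hb, hab, rfl⟩ := mem_triangle_iff.1 hx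
    refine ⟨(1 - δ) / 2 + δ * a, δ * b, by positivity, ?_, by nlinarith, by nlinarith, ?_⟩
    · rw [← hδ]; nlinarith
    · simp only [hP, add_sub_cancel_left]
      module
  have hfin : ∀ s : Finset Plane, MeasurableSet (convexHull ℝ (s : Set Plane)) := fun s =>
    (isCompact_hull s).isClosed.measurableSet
  have hSm : MeasurableSet S := by simpa using hfin {P, P + δ • e, P + δ • v}
  have hK1 : MeasurableSet (convexHull ℝ ({p, p + e, p + v} : Set Plane)) := by
    simpa using hfin {p, p + e, p + v}
  have hK2 : MeasurableSet (convexHull ℝ ({p, p + e, p + q} : Set Plane)) := by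
    simpa using hfin {p, p + e, p + q}
  have hmain := volume_mul_enorm_sum_sq_le (ι := Fin 4) hu hSm (hK1.union hK2)
    (p := ![p, p + e, p + v, p + q])
    (c := fun i => 2 / (κ ^ 2 * ‖e‖) * (![-(1 - α - β), -α, -β, 1] : Fin 4 → ℝ) i)
    (h := (3 * ‖e‖ / κ).toNNReal) (C := (6 / (κ ^ 5 * ‖e‖)).toNNReal) ?_ ?_ ?_ ?_ ?_
  · set X := ‖∑ i : Fin 4, (2 / (κ ^ 2 * ‖e‖) * (![-(1 - α - β), -α, -β, 1] : Fin 4 → ℝ) i) •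
        u ((![p, p + e, p + v, p + q] : Fin 4 → Plane) i)‖ₑ ^ 2 with hX
    set Y := ∫⁻ z in convexHull ℝ ({p, p + e, p + v} : Set Plane) ∪
          convexHull ℝ ({p, p + e, p + q} : Set Plane), hessSq u z with hY
    have hvol : ENNReal.ofReal (‖e‖ ^ 2) * (ENNReal.ofReal ((κ ^ 5 / 8) ^ 2 * κ ^ 2) * unitArea) ≤
        volume S := by
      refine le_trans ?_ (volume_triangle_ge P (P + δ • e) (P + δ • v))
      rw [← mul_assoc, ← ENNReal.ofReal_mul (by positivity)]
      gcongr
      rw [add_sub_cancel_left, add_sub_cancel_left, det2_smul_left, det2_smul_right, abs_mul,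
        abs_mul, abs_of_pos hδ0, ← hδ]
      calc ‖e‖ ^ 2 * (δ ^ 2 * κ ^ 2) = δ * (δ * (κ * (‖e‖ * (κ * ‖e‖)))) := by ring
        _ ≤ δ * (δ * (κ * (‖e‖ * ‖v‖))) := by gcongr; exact h.le_norm_v
        _ ≤ _ := by gcongr; exact h.det_ge
    have hcoef : ((Fintype.card (Fin 4) : ℕ) : ℝ≥0∞) ^ 2 *
        ((6 / (κ ^ 5 * ‖e‖)).toNNReal : ℝ≥0∞) ^ 2 * ((3 * ‖e‖ / κ).toNNReal : ℝ≥0∞) ^ 4 =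
        ENNReal.ofReal (‖e‖ ^ 2) * ENNReal.ofReal (46656 / κ ^ 14) := by
      have e4 : ((Fintype.card (Fin 4) : ℕ) : ℝ≥0∞) = ENNReal.ofReal 4 := by simp
      rw [e4, ← ENNReal.ofReal, ← ENNReal.ofReal, ← ENNReal.ofReal_pow (by positivity),
        ← ENNReal.ofReal_pow (by positivity), ← ENNReal.ofReal_pow (by positivity),
        ← ENNReal.ofReal_mul (by positivity), ← ENNReal.ofReal_mul (by positivity),
        ← ENNReal.ofReal_mul (by positivity)]
      congr 1
      field_simp
      norm_num
    rw [hcoef] at hmain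
    have hE0 : ENNReal.ofReal (‖e‖ ^ 2) ≠ 0 := by
      rw [Ne, ENNReal.ofReal_eq_zero, not_le]; positivity
    have h1 : ENNReal.ofReal (‖e‖ ^ 2) *
        (ENNReal.ofReal ((κ ^ 5 / 8) ^ 2 * κ ^ 2) * unitArea * X) ≤
        ENNReal.ofReal (‖e‖ ^ 2) * (ENNReal.ofReal (46656 / κ ^ 14) * Y) := by
      rw [← mul_assoc, ← mul_assoc (ENNReal.ofReal (‖e‖ ^ 2)) (ENNReal.ofReal (46656 / κ ^ 14))]
      exact (mul_le_mul_left hvol X).trans hmain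
    rw [ENNReal.mul_le_mul_iff_right hE0 ENNReal.ofReal_ne_top] at h1
    have hA0 : ENNReal.ofReal ((κ ^ 5 / 8) ^ 2 * κ ^ 2) * unitArea ≠ 0 := by
      refine mul_ne_zero ?_ unitArea_pos.ne'
      rw [Ne, ENNReal.ofReal_eq_zero, not_le]; positivity
    have hAt : ENNReal.ofReal ((κ ^ 5 / 8) ^ 2 * κ ^ 2) * unitArea ≠ ⊤ :=
      ENNReal.mul_ne_top ENNReal.ofReal_ne_top unitArea_ne_top
    rw [mul_comm _ Y, ← mul_div_assoc, ENNReal.le_div_iff_mul_le (Or.inl hA0)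
      (Or.inl hAt), mul_comm, mul_comm Y]
    exact h1
  · rw [← Finset.mul_sum]
    simp only [Fin.sum_univ_four, Matrix.cons_val]
    ring
  · simp only [mul_smul]
    rw [← Finset.smul_sum]
    simp only [Fin.sum_univ_four, Matrix.cons_val, h.eq]
    refine smul_eq_zero_of_right _ ?_
    module
  · intro i x hx t ht
    obtain ⟨A, b, hb0, hb, hA, hAb, rfl⟩ := hSx x hx
    exact h.path_mem hκ hκ1 p hb0 hb hA hAb ht i
  · intro i x hx
    obtain ⟨A, b, hb0, hb, hA, hAb, rfl⟩ := hSx x hx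
    rw [← ofReal_norm]
    exact ENNReal.ofReal_le_ofReal (h.norm_sub_le hκ hκ1 p hb0 hA hAb i)
  · intro i
    rw [← ofReal_norm]
    refine ENNReal.ofReal_le_ofReal ?_
    rw [Real.norm_eq_abs, abs_mul, abs_of_pos (by positivity)]
    calc _ ≤ 2 / (κ ^ 2 * ‖e‖) * (3 / κ ^ 3) := by gcongr; exact h.coeff_le hκ hκ1 i
      _ = 6 / (κ ^ 5 * ‖e‖) := by field_simp; norm_num

end AdjacentPair

/-- For two adjacent triangles, the jump of the gradient of a piecewise affine map across the common
edge is controlled by a functional of the nodal values, which in turn is controlled by second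
derivatives. -/
lemma exists_jump_functional {κ : ℝ} (hκ : 0 < κ) (hκ1 : κ ≤ 1) : ∃ C : ℝ≥0,
    ∀ T T' f : Finset Plane, T.card = 3 → T'.card = 3 → f.card = 2 → f ⊆ T → f ⊆ T' → T ≠ T' →
      Fat κ T → Fat κ T' → convexHull ℝ (T : Set Plane) ∩ convexHull ℝ (T' : Set Plane) =
        convexHull ℝ ((T : Set Plane) ∩ (T' : Set Plane)) →
      ∃ (p : Fin 4 → Plane) (c : Fin 4 → ℝ), (∀ i, p i ∈ T ∨ p i ∈ T') ∧
        (∀ (g g' : Plane →L[ℝ] Plane) (y : Plane → Plane),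
          (∀ a ∈ T, ∀ b ∈ T, g (b - a) = y b - y a) →
          (∀ a ∈ T', ∀ b ∈ T', g' (b - a) = y b - y a) →
          frobSq (g' - g) ≤ ‖∑ i, c i • y (p i)‖ₑ ^ 2) ∧
        ∀ u : Plane → Plane, ContDiff ℝ 2 u → ‖∑ i, c i • u (p i)‖ₑ ^ 2 ≤
          C * ∫⁻ z in convexHull ℝ (T : Set Plane) ∪ convexHull ℝ (T' : Set Plane), hessSq u z := by
  obtain ⟨C, hC⟩ : ∃ C : ℝ≥0, (C : ℝ≥0∞) = ENNReal.ofReal (46656 / κ ^ 14) /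
      (ENNReal.ofReal ((κ ^ 5 / 8) ^ 2 * κ ^ 2) * unitArea) := by
    have hA0 : ENNReal.ofReal ((κ ^ 5 / 8) ^ 2 * κ ^ 2) * unitArea ≠ 0 := by
      refine mul_ne_zero ?_ unitArea_pos.ne'
      rw [Ne, ENNReal.ofReal_eq_zero, not_le]; positivity
    exact ⟨_, ENNReal.coe_toNNReal (ENNReal.div_ne_top ENNReal.ofReal_ne_top hA0)⟩
  refine ⟨C, fun T T' f hT hT' hf hfT hfT' hne hF hF' hreg => ?_⟩
  have third : ∀ {T : Finset Plane} {p₀ p₁ : Plane}, T.card = 3 → p₀ ≠ p₁ → p₀ ∈ T → p₁ ∈ T →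
      ∃ p₂, p₀ ≠ p₂ ∧ p₁ ≠ p₂ ∧ T = {p₀, p₁, p₂} := by
    intro T p₀ p₁ hT h01 h0 h1
    obtain ⟨p₂, h2⟩ : ((T.erase p₀).erase p₁).Nonempty := by
      rw [← Finset.card_pos, Finset.card_erase_of_mem (by simp [h1, h01.symm]),
        Finset.card_erase_of_mem h0, hT]
      norm_num
    simp only [Finset.mem_erase] at h2
    refine ⟨p₂, h2.2.1.symm, h2.1.symm, (Finset.eq_of_subset_of_card_le ?_ ?_).symm⟩
    · intro x hx
      simp only [Finset.mem_insert, Finset.mem_singleton] at hx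
      rcases hx with rfl | rfl | rfl
      exacts [h0, h1, h2.2.2]
    · rw [hT, Finset.card_eq_three.2 ⟨p₀, p₁, p₂, h01, h2.2.1.symm, h2.1.symm, rfl⟩]
  obtain ⟨p₀, p₁, h01, rfl⟩ := Finset.card_eq_two.1 hf
  obtain ⟨p₂, h02, h12, rfl⟩ := third hT h01 (hfT (by simp)) (hfT (by simp))
  obtain ⟨p₃, h03, h13, rfl⟩ := third hT' h01 (hfT' (by simp)) (hfT' (by simp))
  have h23 : p₂ ≠ p₃ := fun h => hne (by rw [h])
  simp only [Finset.coe_insert, Finset.coe_singleton] at hreg ⊢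
  obtain ⟨α, β, h⟩ := exists_adjacentPair hκ h01 h02 h03 h12 h13 h23 hF hF' hreg
  -- Up to scaling, the functional is the value at `p₃` minus the value there of the affine
  -- extension from the first triangle.
  refine ⟨![p₀, p₀ + (p₁ - p₀), p₀ + (p₂ - p₀), p₀ + (p₃ - p₀)],
    fun i => 2 / (κ ^ 2 * ‖p₁ - p₀‖) * (![-(1 - α - β), -α, -β, 1] : Fin 4 → ℝ) i, ?_, ?_, ?_⟩
  · intro i
    fin_cases i <;> simp
  · intro g g' y hg hg'
    have h1 : (g' - g) (p₁ - p₀) = 0 := by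
      rw [sub_apply, hg p₀ (by simp) p₁ (by simp), hg' p₀ (by simp) p₁ (by simp),
        sub_self]
    have h2 : g (p₃ - p₀) = α • (y p₁ - y p₀) + β • (y p₂ - y p₀) := by
      rw [h.eq, map_add, map_smul, map_smul, hg p₀ (by simp) p₁ (by simp),
        hg p₀ (by simp) p₂ (by simp)]
    refine (h.frobSq_le hκ h1).trans_eq ?_
    congr 2
    simp only [mul_smul]
    rw [← Finset.smul_sum, sub_apply, h2, hg' p₀ (by simp) p₃ (by simp)]
    congr 1
    simp only [Fin.sum_univ_four, Matrix.cons_val, add_sub_cancel]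
    module
  · intro u hu
    have := h.enorm_sum_sq_le hκ hκ1 p₀ hu
    simp only [add_sub_cancel] at this ⊢
    rw [hC]
    exact this

/-! ### Mollification -/

lemma LocBounded.locallyIntegrable {g : Plane → Plane} (hg : LocBounded g) :
    LocallyIntegrable g volume := by
  intro x
  refine ⟨Metric.closedBall 0 (‖x‖ + 1), ?_, ?_⟩
  · refine Filter.mem_of_superset (Metric.closedBall_mem_nhds x one_pos) ?_
    refine Metric.closedBall_subset_closedBall' ?_
    rw [dist_zero_right, add_comm]
  · have : IsFiniteMeasure (volume.restrict (Metric.closedBall (0 : Plane) (‖x‖ + 1))) :=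
      ⟨by rw [Measure.restrict_apply_univ]; exact measure_closedBall_lt_top⟩
    exact (hg (‖x‖ + 1)).integrable (by norm_num)

/-- The convolution of `w` with the kernel `ρ`. -/
noncomputable def mollify (ρ : Plane → ℝ) (w : Plane → Plane) : Plane → Plane :=
  convolution ρ w (ContinuousLinearMap.lsmul ℝ ℝ) volume

lemma mollify_eq_flip (ρ : Plane → ℝ) (w : Plane → Plane) : mollify ρ w =
    convolution w ρ (ContinuousLinearMap.lsmul ℝ ℝ).flip volume := (convolution_flip _).symm

lemma mollify_apply (ρ : Plane → ℝ) (w : Plane → Plane) (x : Plane) :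
    mollify ρ w x = ∫ t, ρ (x - t) • w t := by
  rw [mollify_eq_flip]
  rfl

lemma contDiff_mollify {ρ : Plane → ℝ} (hρ : ContDiff ℝ ∞ ρ) (hc : HasCompactSupport ρ)
    {w : Plane → Plane} (hw : LocallyIntegrable w volume) : ContDiff ℝ ∞ (mollify ρ w) := by
  rw [mollify_eq_flip]
  exact hc.contDiff_convolution_right _ hw hρ

/-- The derivative falls on the kernel, and `ρ (x - ·)` is an admissible test function for the weak
derivative; its reflected argument accounts for the sign. -/
lemma fderiv_mollify {ρ : Plane → ℝ} (hρ : ContDiff ℝ ∞ ρ) (hc : HasCompactSupport ρ)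
    {w g : Plane → Plane} (hw : LocallyIntegrable w volume) {i : Fin 2}
    (h : IsWeakPartial i w g) (x : Plane) :
    fderiv ℝ (mollify ρ w) x (EuclideanSpace.single i 1) = mollify ρ g x := by
  have hρ1 : ContDiff ℝ 1 ρ := hρ.of_le (by exact_mod_cast le_top)
  have h1 := (hc.hasFDerivAt_convolution_right (ContinuousLinearMap.lsmul ℝ ℝ).flip hw hρ1 x).fderiv
  rw [← mollify_eq_flip] at h1
  rw [h1, convolution_precompR_apply _ hw (hc.fderiv ℝ) (hρ1.continuous_fderiv (by norm_num)),
    mollify_apply]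
  have hψ : ContDiff ℝ ∞ fun t => ρ (x - t) := hρ.comp (contDiff_const.sub contDiff_id)
  have hψc : HasCompactSupport fun t => ρ (x - t) :=
    hc.comp_homeomorph (Homeomorph.subLeft x)
  have h2 := h _ hψ hψc
  have h3 : ∀ t, fderiv ℝ (fun t => ρ (x - t)) t (EuclideanSpace.single i 1) =
      -fderiv ℝ ρ (x - t) (EuclideanSpace.single i 1) := by
    intro t
    have h4 : HasFDerivAt (fun t => x - t) (-ContinuousLinearMap.id ℝ Plane) t :=
      (hasFDerivAt_id t).const_sub x
    have h5 := ((hρ1.differentiable (by norm_num) (x - t)).hasFDerivAt.comp t h4).fderiv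
    have h6 : (ρ ∘ fun t => x - t) = fun t => ρ (x - t) := rfl
    rw [h6] at h5
    rw [h5]
    simp
  simp only [h3, neg_smul, integral_neg, neg_inj] at h2
  exact h2

lemma norm_mollify_le {ρ : Plane → ℝ} (hρ : Continuous ρ) (hc : HasCompactSupport ρ)
    (h0 : ∀ x, 0 ≤ ρ x) (h1 : ∫ x, ρ x = 1) (hsupp : ∀ x, ρ x ≠ 0 → ‖x‖ ≤ 1) {g : Plane → Plane}
    {R C : ℝ} (hg : ∀ᵐ t, t ∈ Metric.closedBall (0 : Plane) (R + 1) → ‖g t‖ ≤ C) {x : Plane}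
    (hx : ‖x‖ ≤ R) : ‖mollify ρ g x‖ ≤ C := by
  rw [mollify_apply]
  have hint : Integrable fun t => ρ (x - t) * C :=
    ((hρ.integrable_of_hasCompactSupport hc).comp_sub_left x).mul_const C
  refine (norm_integral_le_of_norm_le hint ?_).trans_eq ?_
  · filter_upwards [hg] with t ht
    rw [norm_smul, Real.norm_eq_abs, abs_of_nonneg (h0 _)]
    by_cases h : ρ (x - t) = 0
    · simp [h]
    · refine mul_le_mul_of_nonneg_left (ht ?_) (h0 _)
      rw [mem_closedBall_zero_iff]
      have h2 := hsupp _ h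
      calc ‖t‖ = ‖x - (x - t)‖ := by congr 1; abel
        _ ≤ ‖x‖ + ‖x - t‖ := norm_sub_le _ _
        _ ≤ R + 1 := add_le_add hx h2
  · rw [integral_mul_const, integral_sub_left_eq_self ρ volume x, h1, one_mul]

/-- The kernel has mass one, so the additive constant in the quasi-periodicity survives. -/
lemma mollify_add {ρ : Plane → ℝ} (hρ : Continuous ρ) (hc : HasCompactSupport ρ)
    (h1 : ∫ x, ρ x = 1) {w : Plane → Plane} (hw : Continuous w) {a b : Plane}
    (h : ∀ x, w (x + a) = w x + b) (x : Plane) : mollify ρ w (x + a) = mollify ρ w x + b := by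
  have e : ∀ y, mollify ρ w y = ∫ t, ρ t • w (y - t) := fun y => rfl
  have hi : ∀ f : Plane → Plane, Continuous f → Integrable fun t => ρ t • f t := fun f hf =>
    (hρ.smul hf).integrable_of_hasCompactSupport hc.smul_right
  rw [e, e]
  have h2 : ∀ t, ρ t • w (x + a - t) = ρ t • w (x - t) + ρ t • b := fun t => by
    rw [add_sub_right_comm, h, smul_add]
  simp only [h2]
  rw [integral_add (hi _ (by fun_prop)) (hi _ (by fun_prop)), integral_smul_const, h1, one_smul]

lemma hessSq_add {u : Plane → Plane} {a b : Plane} (h : ∀ x, u (x + a) = u x + b) (x : Plane) :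
    hessSq u (x + a) = hessSq u x := by
  have h1 : ∀ y, fderiv ℝ u (y + a) = fderiv ℝ u y := fun y => by
    rw [← fderiv_comp_add_right, funext h, fderiv_add_const]
  have h2 : fderiv ℝ (fderiv ℝ u) (x + a) = fderiv ℝ (fderiv ℝ u) x := by
    rw [← fderiv_comp_add_right, funext h1]
  rw [hessSq, h2, hessSq]

lemma hessSq_mollify {ρ : Plane → ℝ} (hρ : ContDiff ℝ ∞ ρ) (hc : HasCompactSupport ρ)
    {w : Plane → Plane} {G : Fin 2 → Plane → Plane} {H : Fin 2 → Fin 2 → Plane → Plane}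
    (hw : LocallyIntegrable w volume) (hG : ∀ i, LocallyIntegrable (G i) volume)
    (hwG : ∀ i, IsWeakPartial i w (G i)) (hGH : ∀ i j, IsWeakPartial j (G i) (H i j)) (x : Plane) :
    hessSq (mollify ρ w) x = ∑ i : Fin 2, ∑ j : Fin 2, ‖mollify ρ (H i j) x‖ₑ ^ 2 := by
  rw [hessSq, Finset.sum_comm]
  refine Finset.sum_congr rfl fun j _ => Finset.sum_congr rfl fun i _ => ?_
  congr 2
  have hd : ContDiff ℝ 1 (fderiv ℝ (mollify ρ w)) :=
    (contDiff_mollify hρ hc hw).fderiv_right (by norm_cast)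
  have h1 : (fun y => fderiv ℝ (mollify ρ w) y (EuclideanSpace.single j 1)) = mollify ρ (G j) :=
    funext fun y => fderiv_mollify hρ hc hw (hwG j) y
  rw [← fderiv_mollify hρ hc (hG j) (hGH j i), ← h1]
  have h2 := ((hd.differentiable (by norm_num) x).hasFDerivAt.clm_apply
    (hasFDerivAt_const (EuclideanSpace.single j (1 : ℝ)) x)).fderiv
  rw [h2]
  simp

lemma exists_ae_norm_le {g : Plane → Plane} (hg : LocBounded g) (R : ℝ) :
    ∃ C : ℝ, ∀ᵐ t, t ∈ Metric.closedBall (0 : Plane) R → ‖g t‖ ≤ C := by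
  have h1 := (hg R).eLpNorm_ne_top
  rw [eLpNorm_exponent_top] at h1
  refine ⟨(eLpNormEssSup g (volume.restrict (Metric.closedBall 0 R))).toReal,
    (ae_restrict_iff' Metric.isClosed_closedBall.measurableSet).1 ?_⟩
  filter_upwards [ae_le_eLpNormEssSup (f := g)] with t ht
  rw [← toReal_enorm]
  exact ENNReal.toReal_mono h1 ht

open Filter Topology in
/-- Smooth approximation of a map with bounded weak second derivatives. -/
lemma exists_smooth_approximation {w : Plane → Plane} {H : Fin 2 → Fin 2 → Plane → Plane}
    (hwH : HasWeakHessian w H) : ∃ u : ℕ → Plane → Plane, (∀ n, ContDiff ℝ 2 (u n)) ∧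
      (∀ x, Tendsto (fun n => u n x) atTop (𝓝 (w x))) ∧
      (∀ a b, (∀ x, w (x + a) = w x + b) → ∀ n x, hessSq (u n) (x + a) = hessSq (u n) x) ∧
      ∀ K : Set Plane, MeasurableSet K → Bornology.IsBounded K →
        Tendsto (fun n => ∫⁻ x in K, hessSq (u n) x) atTop
          (𝓝 (∫⁻ x in K, ∑ i : Fin 2, ∑ j : Fin 2, ‖H i j x‖ₑ ^ 2)) := by
  obtain ⟨hwc, hH, G, hG, hwG, hGH⟩ := hwH
  let φ : ℕ → ContDiffBump (0 : Plane) := fun n =>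
    ⟨1 / (2 * ((n : ℝ) + 1)), 1 / ((n : ℝ) + 1), by positivity, by
      refine one_div_lt_one_div_of_lt (by positivity) (by linarith [n.cast_nonneg (α := ℝ)])⟩
  have hout : ∀ n, (φ n).rOut = 1 / ((n : ℝ) + 1) := fun n => rfl
  have hφ0 : Tendsto (fun n => (φ n).rOut) atTop (𝓝 0) := tendsto_one_div_add_atTop_nhds_zero_nat
  -- The bounded ratio of outer to inner radius is what almost everywhere convergence of the
  -- mollified second derivatives requires.
  have hφK : ∀ᶠ n in atTop, (φ n).rOut ≤ 2 * (φ n).rIn := by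
    refine Eventually.of_forall fun n => le_of_eq ?_
    change 1 / ((n : ℝ) + 1) = 2 * (1 / (2 * ((n : ℝ) + 1)))
    field_simp
  set ρ : ℕ → Plane → ℝ := fun n => (φ n).normed volume with hρdef
  have hρ : ∀ n, ContDiff ℝ ∞ (ρ n) := fun n => (φ n).contDiff_normed
  have hρc : ∀ n, HasCompactSupport (ρ n) := fun n => (φ n).hasCompactSupport_normed
  have hρ0 : ∀ n x, 0 ≤ ρ n x := fun n x => (φ n).nonneg_normed x
  have hρ1 : ∀ n, ∫ x, ρ n x = 1 := fun n => (φ n).integral_normed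
  have hρs : ∀ n x, ρ n x ≠ 0 → ‖x‖ ≤ 1 := by
    intro n x hx
    have h1 : x ∈ Function.support (ρ n) := hx
    rw [hρdef, (φ n).support_normed_eq, mem_ball_zero_iff] at h1
    refine h1.le.trans ?_
    rw [hout, div_le_one (by positivity)]
    linarith [n.cast_nonneg (α := ℝ)]
  have hwl := hwc.locallyIntegrable (μ := volume)
  refine ⟨fun n => mollify (ρ n) w, fun n =>
    contDiff_infty.1 (contDiff_mollify (hρ n) (hρc n) hwl) 2, fun x =>
    ContDiffBump.convolution_tendsto_right_of_continuous hφ0 hwc x, fun a b hab n x =>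
    hessSq_add (mollify_add (hρ n).continuous (hρc n) (hρ1 n) hwc hab) x, fun K hK hKb => ?_⟩
  obtain ⟨R, hR⟩ := hKb.exists_norm_le
  choose C hC using fun i j => exists_ae_norm_le (hH i j) (R + 1)
  have hfin : IsFiniteMeasure (volume.restrict K) :=
    ⟨by rw [Measure.restrict_apply_univ]; exact hKb.measure_lt_top⟩
  have heq : ∀ n, hessSq (mollify (ρ n) w) =
      fun x => ∑ i : Fin 2, ∑ j : Fin 2, ‖mollify (ρ n) (H i j) x‖ₑ ^ 2 := fun n =>
    funext fun x => hessSq_mollify (hρ n) (hρc n) hwl (fun i => (hG i).locallyIntegrable) hwG hGH x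
  have hcont : ∀ n i j, Continuous (mollify (ρ n) (H i j)) := fun n i j =>
    (contDiff_mollify (hρ n) (hρc n) (hH i j).locallyIntegrable).continuous
  simp only [heq]
  -- The essential bounds of `H` on a ball one unit larger dominate all mollifications on `K`, since
  -- the kernels are supported in the unit ball.
  refine tendsto_lintegral_of_dominated_convergence
    (fun _ => ∑ i : Fin 2, ∑ j : Fin 2, ENNReal.ofReal (C i j) ^ 2) (fun n => ?_) (fun n => ?_)
    ?_ ?_
  · have := hcont n
    fun_prop
  · refine (ae_restrict_iff' hK).2 (Eventually.of_forall fun x hx => ?_)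
    refine Finset.sum_le_sum fun i _ => Finset.sum_le_sum fun j _ => ?_
    gcongr
    rw [← ofReal_norm]
    exact ENNReal.ofReal_le_ofReal (norm_mollify_le (hρ n).continuous (hρc n) (hρ0 n) (hρ1 n)
      (hρs n) (hC i j) (hR x hx))
  · rw [lintegral_const]
    refine ENNReal.mul_ne_top ?_ (measure_ne_top _ _)
    simp
  · have hae : ∀ i j, ∀ᵐ x, Tendsto (fun n => mollify (ρ n) (H i j) x) atTop (𝓝 (H i j x)) :=
      fun i j => ContDiffBump.ae_convolution_tendsto_right_of_locallyIntegrable hφ0 hφK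
        (hH i j).locallyIntegrable
    refine ae_restrict_of_ae ?_
    have hae' := ae_all_iff.2 fun i => ae_all_iff.2 (hae i)
    filter_upwards [hae'] with x hx
    refine tendsto_finsetSum _ fun i _ => tendsto_finsetSum _ fun j _ => ?_
    exact ENNReal.Tendsto.pow ((continuous_enorm.tendsto _).comp (hx i j))

lemma setLIntegral_hull_translate {F : Plane → ℝ≥0∞} (hF : Measurable F) {a : Plane}
    (h : ∀ x, F (x + a) = F x) (T : Finset Plane) :
    ∫⁻ x in convexHull ℝ ((translate a T : Finset Plane) : Set Plane), F x =
      ∫⁻ x in convexHull ℝ (T : Set Plane), F x := by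
  rw [← (measurePreserving_add_right volume a).setLIntegral_comp_preimage
    (isCompact_hull _).isClosed.measurableSet hF]
  have e : (fun x => x + a) ⁻¹' convexHull ℝ ((translate a T : Finset Plane) : Set Plane) =
      convexHull ℝ (T : Set Plane) := by
    ext x
    rw [mem_preimage, mem_convexHull_translate, add_sub_cancel_right]
  rw [e]
  simp only [h]

lemma ediam_translate (a : Plane) (T : Finset Plane) :
    Metric.ediam ((translate a T : Finset Plane) : Set Plane) = Metric.ediam (T : Set Plane) := by
  have : ((translate a T : Finset Plane) : Set Plane) = (fun x => x + a) '' (T : Set Plane) := by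
    simp [translate]
  rw [this]
  exact (IsometryEquiv.addRight a).isometry.ediam_image _

/-! ### Jumps of the interpolant against second derivatives. -/

namespace Mesh

variable {N : ℕ} {M : Mesh N}

/-- The translate of an edge which lies in the chosen copy `contEdges` is unique. -/
lemma contEdges_translate_unique (hN : 0 < N) {f f' e : Finset Plane} (hf : f ∈ M.contEdges)
    (hf' : f' ∈ M.contEdges) {z z' : Plane} (hz : z ∈ lattice) (hz' : z' ∈ lattice)
    (h : f = translate ((N : ℝ) • z) e) (h' : f' = translate ((N : ℝ) • z') e) : f = f' := by
  obtain ⟨hc, -, hcell, -⟩ := hf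
  obtain ⟨hc', -, hcell', -⟩ := hf'
  obtain ⟨p, q, hpq, rfl⟩ := Finset.card_eq_two.1 hc
  have hmem : ∀ x ∈ ({p, q} : Finset Plane), x + (N : ℝ) • (z' - z) ∈ f' := by
    intro x hx
    rw [h, mem_translate] at hx
    rw [h', mem_translate]
    convert! hx using 1
    module
  have h1 : (1 / 2 : ℝ) • p + (1 / 2 : ℝ) • q ∈ cell N :=
    hcell p (by simp) q (by simp) hpq ⟨1 / 2, 1 / 2, by norm_num, by norm_num, by norm_num, rfl⟩
  have h2 := hcell' _ (hmem p (by simp)) _ (hmem q (by simp)) (fun hh => hpq (add_right_cancel hh))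
    ⟨1 / 2, 1 / 2, by norm_num, by norm_num, by norm_num, rfl⟩
  have h3 := eq_zero_of_translate_mem_cell hN (sub_mem_lattice hz' hz) h1
    (by convert! h2 using 1; module)
  rw [h, h', sub_eq_zero.1 h3]

open Classical in
/-- The elementwise weighted integrals add up to at most the weighted integral over the continuum
region. -/
lemma sum_elems_le (F : Plane → ℝ≥0∞) :
    ∑ T ∈ (finite_elems (M := M)).toFinset.filter (fun T => T ∉ M.atomElems),
      Metric.ediam (T : Set Plane) * ∫⁻ x in convexHull ℝ (T : Set Plane), F x ≤
        ∫⁻ x in M.contRegion, M.meshSize x * F x := by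
  have hmem : ∀ T ∈ (finite_elems (M := M)).toFinset.filter (fun T => T ∉ M.atomElems),
      T ∈ M.elems \ M.atomElems := fun T hT => by
    rw [Finset.mem_filter, Set.Finite.mem_toFinset] at hT
    exact hT
  have hclosed : IsClosed M.atomRegion := isClosed_hullUnion (finite_elems.subset M.atomElems_subset)
  -- Up to null sets `V T` is the whole element, but unlike the closed element it lies in the
  -- half-open continuum region.
  set V : Finset Plane → Set Plane := fun T =>
    interior (convexHull ℝ (T : Set Plane)) \ M.atomRegion with hV
  have hVm : ∀ T, MeasurableSet (V T) := fun T =>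
    (isOpen_interior.sdiff hclosed).measurableSet
  have hVsub : ∀ T, V T ⊆ convexHull ℝ (T : Set Plane) := fun T x hx => interior_subset hx.1
  have hVae : ∀ T ∈ M.elems \ M.atomElems, V T =ᵐ[volume] convexHull ℝ (T : Set Plane) := by
    intro T hT
    refine (hVsub T).eventuallyLE.antisymm ?_
    refine ae_le_set.2 ?_
    have h1 : convexHull ℝ (T : Set Plane) \ V T ⊆ frontier (convexHull ℝ (T : Set Plane)) ∪
        ⋃ T' ∈ M.atomElems, convexHull ℝ (T : Set Plane) ∩ convexHull ℝ (T' : Set Plane) := by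
      rintro x ⟨hx, hxV⟩
      by_cases h : x ∈ interior (convexHull ℝ (T : Set Plane))
      · have h2 : x ∈ M.atomRegion := by
          by_contra hc
          exact hxV ⟨h, hc⟩
        obtain ⟨T', hT', hx'⟩ := mem_iUnion₂.1 h2
        exact Or.inr (mem_iUnion₂.2 ⟨T', hT', hx, hx'⟩)
      · exact Or.inl ⟨subset_closure hx, h⟩
    refine measure_mono_null h1 (measure_union_null
      ((convex_convexHull ℝ _).addHaar_frontier volume) ?_)
    refine (measure_biUnion_null_iff (finite_elems.subset M.atomElems_subset).countable).2
      fun T' hT' => ?_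
    exact volume_inter_eq_zero (subset_periodicFamily hT.1) (atomElem_mem_elemsPer hT')
      (fun h => hT.2 (h ▸ hT'))
  have hVcont : ∀ T ∈ M.elems \ M.atomElems, V T ⊆ M.contRegion := by
    rintro T hT x ⟨hx, hxa⟩
    have h1 : x ∈ cell N := interior_closure_cell_subset_cell
      (interior_mono (M.subset_cell T hT.1) hx)
    exact ⟨subset_closure ⟨h1, hxa⟩, h1⟩
  have hsize : ∀ T ∈ M.elems \ M.atomElems, ∀ x ∈ V T,
      Metric.ediam (T : Set Plane) ≤ M.meshSize x := by
    intro T hT x hx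
    rw [← convexHull_ediam]
    exact le_iSup₂_of_le T (subset_periodicFamily hT) (le_iSup_of_le (hVsub T hx) le_rfl)
  calc _ ≤ ∑ T ∈ (finite_elems (M := M)).toFinset.filter (fun T => T ∉ M.atomElems),
        ∫⁻ x in V T, M.meshSize x * F x := by
        refine Finset.sum_le_sum fun T hT => ?_
        have hT' := hmem T hT
        rw [← setLIntegral_congr (hVae T hT'),
          ← lintegral_const_mul' _ _ (T.finite_toSet.isBounded.ediam_ne_top)]
        refine setLIntegral_mono' (hVm T) fun x hx => ?_
        gcongr
        exact hsize T hT' x hx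
    _ = ∫⁻ x in ⋃ T ∈ (finite_elems (M := M)).toFinset.filter (fun T => T ∉ M.atomElems), V T,
        M.meshSize x * F x := by
        refine (lintegral_biUnion_finset₀ ?_ (fun T _ => (hVm T).nullMeasurableSet) _).symm
        intro T hT T' hT' hne
        refine measure_mono_null (inter_subset_inter (hVsub T) (hVsub T')) ?_
        exact volume_inter_eq_zero (subset_periodicFamily (hmem T hT).1)
          (subset_periodicFamily (hmem T' hT').1) hne
    _ ≤ ∫⁻ x in M.contRegion, M.meshSize x * F x :=
        lintegral_mono_set (iUnion₂_subset fun T hT => hVcont T (hmem T hT))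

/-- The jump of the gradient of a piecewise affine map across an edge, in terms of the weak second
derivatives of a conforming interpolant on the representatives of the adjacent elements. -/
lemma exists_frobSq_jump_le {κ : ℝ} (hκ : 0 < κ) (hκ1 : κ ≤ 1) : ∃ C : ℝ≥0,
    ∀ (N : ℕ) (M : Mesh N) (_ : ∀ T ∈ M.elems, Fat κ T) (B : Plane →L[ℝ] Plane)
      (v w : Plane → Plane) (_ : M.IsPA v) (_ : ∀ T ∈ M.contElemsPer, ∀ q ∈ T, w q = v q)
      (_ : ∀ x, w (x + (N : ℝ) • a1) = B ((N : ℝ) • a1) + w x)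
      (_ : ∀ x, w (x + (N : ℝ) • a2) = B ((N : ℝ) • a2) + w x)
      (H : Fin 2 → Fin 2 → Plane → Plane) (_ : HasWeakHessian w H)
      (T₀ T₀' : Finset Plane) (_ : T₀ ∈ M.elems \ M.atomElems) (_ : T₀' ∈ M.elems \ M.atomElems)
      (z z' : Plane) (_ : z ∈ lattice) (_ : z' ∈ lattice) (f : Finset Plane) (_ : f.card = 2)
      (_ : f ⊆ translate ((N : ℝ) • z) T₀) (_ : f ⊆ translate ((N : ℝ) • z') T₀'),
      frobSq (gradOn (translate ((N : ℝ) • z) T₀) v - gradOn (translate ((N : ℝ) • z') T₀') v) ≤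
        C * ((∫⁻ x in convexHull ℝ (T₀ : Set Plane), ∑ i : Fin 2, ∑ j : Fin 2, ‖H i j x‖ₑ ^ 2) +
          ∫⁻ x in convexHull ℝ (T₀' : Set Plane), ∑ i : Fin 2, ∑ j : Fin 2, ‖H i j x‖ₑ ^ 2) := by
  obtain ⟨C, hC⟩ := exists_jump_functional hκ hκ1
  refine ⟨C, fun N M hF B v w hv hwv hw1 hw2 H hH T₀ T₀' hT₀ hT₀' z z' hz hz' f hf hfT hfT' => ?_⟩
  set T := translate ((N : ℝ) • z) T₀ with hTdef
  set T' := translate ((N : ℝ) • z') T₀' with hTdef'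
  have hT : T ∈ M.contElemsPer := ⟨T₀, hT₀, z, hz, rfl⟩
  have hT' : T' ∈ M.contElemsPer := ⟨T₀', hT₀', z', hz', rfl⟩
  -- The supremum defining `jumpSq` includes coinciding elements, for which the jump is zero.
  by_cases hne : T = T'
  · rw [hne, sub_self]
    simp [frobSq]
  have hE := contElemsPer_subset hT
  have hE' := contElemsPer_subset hT'
  obtain ⟨p, c, hp, hg, hu⟩ := hC T' T f (elemsPer_card hE') (elemsPer_card hE) hf hfT' hfT
    (Ne.symm hne) (fat_elemsPer hF hE') (fat_elemsPer hF hE) (M.regular T' hE' T hE)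
  refine (hg (gradOn T' v) (gradOn T v) v (fun a ha b hb => ?_) (fun a ha b hb => ?_)).trans ?_
  · exact (hv.sub_eq hT' (subset_convexHull ℝ _ ha) (subset_convexHull ℝ _ hb)).symm
  · exact (hv.sub_eq hT (subset_convexHull ℝ _ ha) (subset_convexHull ℝ _ hb)).symm
  have hsum : ∑ i, c i • v (p i) = ∑ i, c i • w (p i) := by
    refine Finset.sum_congr rfl fun i _ => ?_
    rcases hp i with h | h
    · rw [hwv T' hT' _ h]
    · rw [hwv T hT _ h]
  rw [hsum]
  have hwper := periodic_of_generators (N := N) (A := univ) (B := B) (y := w)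
    (fun _ _ _ _ => mem_univ _) (fun x _ => by rw [hw1, add_comm])
    (fun x _ => by rw [hw2, add_comm])
  obtain ⟨u, hu2, huw, huper, hulim⟩ := exists_smooth_approximation hH
  have hI : ∀ S : Finset Plane, Filter.Tendsto
      (fun n => ∫⁻ x in convexHull ℝ (S : Set Plane), hessSq (u n) x) Filter.atTop
      (nhds (∫⁻ x in convexHull ℝ (S : Set Plane), ∑ i : Fin 2, ∑ j : Fin 2, ‖H i j x‖ₑ ^ 2)) :=
    fun S => hulim _ (isCompact_hull S).isClosed.measurableSet (isCompact_hull S).isBounded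
  have hleft : Filter.Tendsto (fun n => ‖∑ i, c i • u n (p i)‖ₑ ^ 2) Filter.atTop
      (nhds (‖∑ i, c i • w (p i)‖ₑ ^ 2)) := by
    refine ENNReal.Tendsto.pow ((continuous_enorm.tendsto _).comp ?_)
    exact tendsto_finsetSum _ fun i _ => (huw (p i)).const_smul (c i)
  refine le_of_tendsto_of_tendsto' hleft (ENNReal.Tendsto.const_mul ((hI T₀).add (hI T₀'))
    (Or.inr ENNReal.coe_ne_top)) fun n => ?_
  refine (hu (u n) (hu2 n)).trans ?_
  gcongr
  refine (lintegral_union_le _ _ _).trans_eq ?_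
  have hm : Measurable (hessSq (u n)) := (continuous_hessSq (hu2 n)).measurable
  rw [hTdef, hTdef', setLIntegral_hull_translate hm (huper _ _
      (fun x => hwper x (mem_univ x) z hz) n), setLIntegral_hull_translate hm (huper _ _
      (fun x => hwper x (mem_univ x) z' hz') n), add_comm]

/-- The jump across an edge is charged to the representatives in the cell of the two elements, and
the length of the edge is at most their diameters. Each pair of an element of the cell and one of
its edges corresponds to at most one member of `contEdges`, so an element is charged only through
its three edges. -/
theorem exists_jumpNormSq_le {κ : ℝ} (hκ : 0 < κ) (hκ1 : κ ≤ 1) : ∃ C : ℝ≥0, 1 ≤ C ∧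
    ∀ (N : ℕ) (_ : 0 < N) (M : Mesh N) (_ : ∀ T ∈ M.elems, Fat κ T) (B : Plane →L[ℝ] Plane)
      (v w : Plane → Plane) (_ : M.IsPA v) (_ : ∀ T ∈ M.contElemsPer, ∀ q ∈ T, w q = v q)
      (_ : ∀ x, w (x + (N : ℝ) • a1) = B ((N : ℝ) • a1) + w x)
      (_ : ∀ x, w (x + (N : ℝ) • a2) = B ((N : ℝ) • a2) + w x),
      M.jumpNormSq v ≤ C * M.hessNormSq w := by
  classical
  obtain ⟨C, hC⟩ := exists_frobSq_jump_le hκ hκ1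
  -- Two elements at an edge and three edges per element give `6 * C`; adding 1 makes the constant
  -- nonzero, so that division by it in `ℝ≥0∞` is legitimate.
  refine ⟨6 * C + 1, by simp, fun N hN M hF B v w hv hwv hw1 hw2 => ?_⟩
  have hC0 : ((6 * C + 1 : ℝ≥0) : ℝ≥0∞) ≠ 0 := by simp
  rw [hessNormSq, mul_comm, ← ENNReal.div_le_iff_le_mul (Or.inl hC0) (Or.inl ENNReal.coe_ne_top)]
  refine le_iInf₂ fun H hH => ?_
  rw [ENNReal.div_le_iff_le_mul (Or.inl hC0) (Or.inl ENNReal.coe_ne_top), mul_comm]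
  set E := (finite_elems (M := M)).toFinset.filter (fun T => T ∉ M.atomElems) with hE
  have hEmem : ∀ T, T ∈ E ↔ T ∈ M.elems \ M.atomElems := fun T => by
    rw [hE, Finset.mem_filter, Set.Finite.mem_toFinset]; rfl
  set F : Plane → ℝ≥0∞ := fun x => ∑ i : Fin 2, ∑ j : Fin 2, ‖H i j x‖ₑ ^ 2 with hFdef
  set I : Finset Plane → ℝ≥0∞ := fun T =>
    Metric.ediam (T : Set Plane) * ∫⁻ x in convexHull ℝ (T : Set Plane), F x with hIdef
  let P : Finset (Σ _ : Finset Plane, Finset Plane) := E.sigma fun T => T.powersetCard 2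
  let r : (Σ _ : Finset Plane, Finset Plane) → Finset Plane → ℝ≥0∞ := fun s f =>
    if ∃ z ∈ lattice, f = translate ((N : ℝ) • z) s.2 then I s.1 else 0
  have hone : ∀ f ∈ M.contEdges, ∀ T₀ ∈ M.elems \ M.atomElems, ∀ z ∈ lattice,
      f ⊆ translate ((N : ℝ) • z) T₀ →
      Metric.ediam (f : Set Plane) * ∫⁻ x in convexHull ℝ (T₀ : Set Plane), F x ≤
        ∑ s ∈ P, r s f := by
    intro f hf T₀ hT₀ z hz hfT
    have h1 : f = translate ((N : ℝ) • z) (translate ((N : ℝ) • -z) f) := by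
      rw [ACCoupling.translate_translate, smul_neg, neg_add_cancel, ACCoupling.translate_zero]
    have h2 : translate ((N : ℝ) • -z) f ⊆ T₀ := by
      intro x hx
      rw [mem_translate, smul_neg, sub_neg_eq_add] at hx
      have := hfT hx
      rwa [mem_translate, add_sub_cancel_right] at this
    have h3 : (⟨T₀, translate ((N : ℝ) • -z) f⟩ : Σ _ : Finset Plane, Finset Plane) ∈ P :=
      Finset.mem_sigma.2 ⟨(hEmem T₀).2 hT₀, Finset.mem_powersetCard.2
        ⟨h2, by rw [card_translate]; exact hf.1⟩⟩
    refine le_trans ?_ (Finset.single_le_sum (f := fun s => r s f) (fun _ _ => zero_le) h3)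
    have h4 : r ⟨T₀, translate ((N : ℝ) • -z) f⟩ f = I T₀ := if_pos ⟨z, hz, h1⟩
    simp only [h4, hIdef]
    gcongr ?_ * _
    refine (Metric.ediam_mono (Finset.coe_subset.2 hfT)).trans_eq (ediam_translate _ _)
  have hedge : ∀ f ∈ M.contEdges, Metric.ediam (f : Set Plane) * M.jumpSq v f ≤
      2 * C * ∑ s ∈ P, r s f := by
    intro f hf
    simp only [jumpSq, ENNReal.mul_iSup]
    refine iSup₂_le fun T hT => iSup₂_le fun T' hT' => iSup_le fun hfT => ?_
    obtain ⟨T₀, hT₀, z, hz, rfl⟩ := mem_contElemsPer_of_contEdges hN hf hT hfT.1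
    obtain ⟨T₀', hT₀', z', hz', rfl⟩ := mem_contElemsPer_of_contEdges hN hf hT' hfT.2
    calc _ ≤ Metric.ediam (f : Set Plane) * (C * ((∫⁻ x in convexHull ℝ (T₀ : Set Plane), F x) +
          ∫⁻ x in convexHull ℝ (T₀' : Set Plane), F x)) := by
          gcongr
          exact hC N M hF B v w hv hwv hw1 hw2 H hH T₀ T₀' hT₀ hT₀' z z' hz hz' f hf.1 hfT.1 hfT.2
      _ = C * (Metric.ediam (f : Set Plane) * (∫⁻ x in convexHull ℝ (T₀ : Set Plane), F x) +
          Metric.ediam (f : Set Plane) * ∫⁻ x in convexHull ℝ (T₀' : Set Plane), F x) := by ring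
      _ ≤ C * (∑ s ∈ P, r s f + ∑ s ∈ P, r s f) := by
          gcongr
          · exact hone f hf T₀ hT₀ z hz hfT.1
          · exact hone f hf T₀' hT₀' z' hz' hfT.2
      _ = _ := by ring
  have htsum : ∀ s, ∑' f : M.contEdges, r s f ≤ I s.1 := by
    intro s
    by_cases h : ∃ f ∈ M.contEdges, ∃ z ∈ lattice, f = translate ((N : ℝ) • z) s.2
    · obtain ⟨f, hf, z, hz, hfz⟩ := h
      rw [tsum_eq_single (⟨f, hf⟩ : M.contEdges)]
      · exact (if_pos ⟨z, hz, hfz⟩ : r s f = I s.1).le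
      · rintro ⟨f', hf'⟩ hne
        refine if_neg ?_
        rintro ⟨z', hz', hfz'⟩
        exact hne (Subtype.ext (contEdges_translate_unique hN hf' hf hz' hz hfz' hfz))
    · have h0 : ∀ f : M.contEdges, r s f = 0 := fun f =>
        if_neg fun ⟨z, hz, hfz⟩ => h ⟨f, f.2, z, hz, hfz⟩
      simp [h0]
  calc M.jumpNormSq v ≤ ∑' f : M.contEdges, 2 * C * ∑ s ∈ P, r s f :=
        ENNReal.tsum_le_tsum fun f => hedge f f.2
    _ = 2 * C * ∑ s ∈ P, ∑' f : M.contEdges, r s f := by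
        rw [ENNReal.tsum_mul_left, Summable.tsum_finsetSum fun _ _ => ENNReal.summable]
    _ ≤ 2 * C * ∑ s ∈ P, I s.1 := by
        gcongr with s
        exact htsum s
    _ = 2 * C * (3 * ∑ T ∈ E, I T) := by
        rw [Finset.sum_sigma]
        congr 1
        rw [Finset.mul_sum]
        refine Finset.sum_congr rfl fun T hT => ?_
        simp only
        rw [Finset.sum_const, Finset.card_powersetCard, M.card_eq T ((hEmem T).1 hT).1, nsmul_eq_mul]
        norm_num [Nat.choose]
    _ ≤ 2 * C * (3 * ∫⁻ x in M.contRegion, M.meshSize x * F x) := by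
        gcongr
        exact sum_elems_le F
    _ ≤ ((6 * C + 1 : ℝ≥0) : ℝ≥0∞) * ∫⁻ x in M.contRegion, M.meshSize x * F x := by
        rw [← mul_assoc]
        gcongr
        push_cast
        refine le_trans (le_of_eq ?_) le_self_add
        ring

end Mesh

end ACCoupling

/-! ### Both parts of the theorem. -/

theorem lemma7p3 (σ : ℝ) :
    ∃ c₁ c₂ : ℝ≥0, ∀ (N : ℕ) (_ : 0 < N) (M : ACCoupling.Mesh N) (_ : M.ShapeRegular σ)
      (ϕ : ℝ → ℝ) (_ : ACCoupling.IsPotential ϕ),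
      (∀ yh : ACCoupling.Plane → ACCoupling.Plane, M.IsCoarseDeformation yh →
        ENNReal.ofReal |M.atomEnergy ϕ yh - M.acEnergy ϕ yh| ≤
          c₁ * ACCoupling.decaySum ϕ (M.muC yh) * M.jumpNormSq yh) ∧
      (∀ (B : ACCoupling.Plane →L[ℝ] ACCoupling.Plane) (y : ACCoupling.Plane → ACCoupling.Plane),
        M.IsDeformation B y → 0 < M.muC (M.interp y) →
        ENNReal.ofReal |M.atomEnergy ϕ (M.interp y) - M.acEnergy ϕ (M.interp y)| ≤
          c₂ * ACCoupling.decaySum ϕ (M.muC (M.interp y)) *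
            ⨅ w ∈ M.smoothInterps B y, M.hessNormSq w) := by
  obtain ⟨κ, hκ, hκ1, hfat⟩ := ACCoupling.exists_fat σ
  obtain ⟨c, hc⟩ := ACCoupling.Mesh.exists_modelling_error_bound hκ hκ1
  obtain ⟨C, hC1, hC⟩ := ACCoupling.Mesh.exists_jumpNormSq_le hκ hκ1
  refine ⟨c, c * C, fun N hN M hM ϕ hϕ => ⟨fun yh hy => ?_, fun B y hy hμ => ?_⟩⟩
  · obtain ⟨B, hB⟩ := hy.deformation
    exact hc N hN M (hfat N M hM) ϕ hϕ B yh hB.det_pos hB.periodicOnAtoms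
      (hy.periodicPA hN hB) hy.muC_pos
  · have hF := hfat N M hM
    refine (hc N hN M hF ϕ hϕ B _ hy.det_pos
      (ACCoupling.Mesh.interp_periodicOnAtoms hN hκ hF hy.periodicOnAtoms)
      (ACCoupling.Mesh.interp_periodicPA hN hκ hF hy.periodicOnAtoms) hμ).trans ?_
    rw [ENNReal.coe_mul, mul_right_comm (c : ℝ≥0∞) (C : ℝ≥0∞),
      mul_assoc ((c : ℝ≥0∞) * _) (C : ℝ≥0∞)]
    gcongr
    have hle : ∀ w ∈ M.smoothInterps B y, M.jumpNormSq (M.interp y) ≤ C * M.hessNormSq w :=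
      fun w hw => hC N hN M hF B _ w (ACCoupling.Mesh.interp_isPA hκ hF y)
        (fun T hT q hq => by
          rw [hw.2.1 q (ACCoupling.Mesh.contElemsPer_subset_atomsPer hN hT hq),
            ACCoupling.Mesh.interp_eq_of_mem hκ hF y hT hq]) hw.2.2.1 hw.2.2.2
    have hC0 : (C : ℝ≥0∞) ≠ 0 := by
      exact_mod_cast (zero_lt_one.trans_le hC1).ne'
    -- Dividing by the nonzero finite constant isolates the infimum, so that each competitor can be
    -- treated separately; an empty class of interpolants causes no difficulty.
    rw [mul_comm, ← ENNReal.div_le_iff_le_mul (Or.inl hC0) (Or.inl ENNReal.coe_ne_top)]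
    refine le_iInf₂ fun w hw => ?_
    rw [ENNReal.div_le_iff_le_mul (Or.inl hC0) (Or.inl ENNReal.coe_ne_top), mul_comm]
    exact hle w hw
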